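/- Throughout, *double category* means pseudo double category: arrows compose strictly, while proarrows $m\colon x\mathrel{⇸}y$ have an external composition $\odot$ (written in diagrammatic order) and external identities $\mathrm{id}_x$ that are associative and unital up to coherent invertible globular cells. The finite and the unrestricted version of the result are stated simultaneously; in the finite version every set below ("index set", "apex") is finite, in the other one it is an arbitrary small set. **Strong coproducts.** Let $\mathbb D$ be a double category. For families of objects $(x_i)_{i\in I}$ and $(y_j)_{j\in J}$, a *span-indexed family of proarrows* $m\colon x\mathrel{⇸}y$ consists of a span $I\xleftarrow{l}A\xrightarrow{r}J$ of (finite) sets with apex $A$ and proarrows $m_a\colon x_{l(a)}\mathrel{⇸}y_{r(a)}$, $a\in A$. Such families compose, $(m\odot n)_{(a,b)}=m_a\odot n_b$, over the pullback of the spans; the identity family on $x$ is $(\mathrm{id}_{x_i})_{i\in I}$ over the identity span. The double category $\mathbb D$ *has strong (finite) coproducts* if it is equipped with * for each family of objects $x=(x_i)_{i\in I}$, a coproduct $\Sigma x$ in the category of objects and arrows of $\mathbb D$, with coprojections $\iota_i\colon x_i\to\Sigma x$; * for each span-indexed family $m\colon x\mathrel{⇸}y$, a proarrow $\Sigma m\colon\Sigma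 x\mathrel{⇸}\Sigma y$ and cells $\iota_a\colon m_a\to\Sigma m$ with left boundary $\iota_{l(a)}$ and right boundary $\iota_{r(a)}$, which are universal: for every proarrow $n\colon t\mathrel{⇸}t'$, all arrows $f_i\colon x_i\to t$ and $g_j\colon y_j\to t'$, and all cells $\gamma_a\colon m_a\to n$ with left boundary $f_{l(a)}$ and right boundary $g_{r(a)}$, there is exactly one cell $\Sigma m\to n$ whose boundaries are the arrows $\Sigma x\to t$ and $\Sigma y\to t'$ induced by $f$ and $g$ and whose composite with $\iota_a$ is $\gamma_a$ for every $a\in A$; such that the comparison cells $\Sigma(m\odot n)\to\Sigma m\odot\Sigma n$ and $\Sigma(\mathrm{id}_{x_i})_{i\in I}\to\mathrm{id}_{\Sigma x}$ induced by the universal property are all invertible. In that case coproducts over a fixed (finite) set $I$ (with proarrow families indexed by the identity span on $I$) form a pseudo double functor $\Sigma\colon\mathbb D^I\to\mathbb D$, where $\mathbb D^I$ has pointwise structure. A function $f_0\colon I\to J$ between (finite) sets gives by reindexing a double functor $\mathbb D^{f_0}\colon\mathbb D^J\to\mathbb D^I$ and, through the universal property, a natural transformation $$\Sigma(f_0)\colon\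 \Sigma\circ\mathbb D^{f_0}\Rightarrow\Sigma\colon\ \mathbb D^J\to\mathbb D .$$ Its component at a family of objects $x=(x_j)_{j\in J}$ is the arrow $\Sigma(f_0)_x\colon\Sigma_{i\in I}x_{f_0(i)}\to\Sigma_{j\in J}x_j$, and its component at a parallel family of proarrows $m=(m_j\colon x_j\mathrel{⇸}y_j)_{j\in J}$ is the cell $\Sigma(f_0)_m\colon\Sigma_{i\in I}m_{f_0(i)}\to\Sigma_{j\in J}m_j$ with boundaries $\Sigma(f_0)_x$ and $\Sigma(f_0)_y$; both restrict along the $i$-th coprojection to the $f_0(i)$-th coprojection. **Companions, conjoints, commuters.** A *companion* of an arrow $f\colon x\to y$ is a proarrow $f_!\colon x\mathrel{⇸}y$ with cells $\eta\colon\mathrm{id}_x\to f_!$ (boundaries $1_x,f$) and $\varepsilon\colon f_!\to\mathrm{id}_y$ (boundaries $f,1_y$) such that the composite of $\eta$ followed by $\varepsilon$ is $\mathrm{id}_f$ and $\eta\odot\varepsilon=1_{f_!}$ up to the unitors; a *conjoint* $f^*\colon y\mathrel{⇸}x$ is defined dually, with $\eta\colon\mathrm{id}_x\to f^*$ (boundaries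 $f,1_x$), $\varepsilon\colon f^*\to\mathrm{id}_y$ (boundaries $1_y,f$). A cell $\alpha\colon m\to n$ with left boundary $f$ and right boundary $g$ is a *commuter* if $f$ and $g$ have companions and the globular cell $\alpha_!\colon m\odot g_!\to f_!\odot n$ obtained by pasting $\alpha$ with $\eta$ of $f_!$ and $\varepsilon$ of $g_!$ is invertible; it is a *cocommuter* if $f$ and $g$ have conjoints and the analogous globular cell $\alpha^*\colon f^*\odot m\to n\odot g^*$ is invertible. **The double category $\mathbb{L}\mathrm{ax}_{\mathrm{ps}}(\mathbb D^J,\mathbb D)$** has lax double functors $\mathbb D^J\to\mathbb D$ as objects, natural transformations as arrows, pseudo protransformations as proarrows and modifications as cells. **Proposition.** Let $\mathbb D$ be a double category with strong (finite) coproducts. For any function $f_0\colon I\to J$ between (finite) sets, the natural transformation $\Sigma(f_0)\colon\Sigma\circ\mathbb D^{f_0}\Rightarrow\Sigma$ has both a companion $\Sigma(f_0)_!$ and a conjoint $\Sigma(f_0)^*$ in the double category $\mathbb{L}\mathrm{ax}_{\mathrm{ps}}(\mathbb D^J,\mathbb D)$; in particular these are pseudo protransformations. Moreover, for every $J$-indexed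 parallel family of proarrows $m=(m_j\colon x_j\mathrel{⇸}y_j)_{j\in J}$, the component cell $\Sigma(f_0)_m$ is both a commuter and a cocommuter; this includes that its boundary arrows $\Sigma(f_0)_x$ and $\Sigma(f_0)_y$ have companions and conjoints in $\mathbb D$. -/

import Mathlib

open CategoryTheory

universe w u v p c u₁ v₁ p₁ c₁ u₂ v₂ p₂ c₂ u₃ v₃ p₃ c₃

set_option linter.checkUnivs false

/-- A (pseudo) double category, that is, a pseudocategory internal to categories. The objects and
arrows are those of the category `D`; proarrows are indexed by their source and target; a cell
`α : Cell m n` goes from the proarrow `m` (top) to the proarrow `n` (bottom) and has a left and a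
right boundary arrow. Cells compose strictly in the vertical direction (`vcomp`), and weakly in the
horizontal direction (`hcomp`, defined when the boundaries match). -/
class DoubleCategory (D : Type u) extends Category.{v} D where
  Pro : D → D → Type p
  Cell : {x y w z : D} → Pro x y → Pro w z → Type c
  left : {x y w z : D} → {m : Pro x y} → {n : Pro w z} → Cell m n → (x ⟶ w)
  right : {x y w z : D} → {m : Pro x y} → {n : Pro w z} → Cell m n → (y ⟶ z)
  -- vertical category of proarrows and cells, with source and target functors
  cid : {x y : D} → (m : Pro x y) → Cell m m
  vcomp : {x y x' y' x'' y'' : D} → {m : Pro x y} → {n : Pro x' y'} → {k : Pro x'' y''} →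
    Cell m n → Cell n k → Cell m k
  left_cid : ∀ {x y : D} (m : Pro x y), left (cid m) = 𝟙 x
  right_cid : ∀ {x y : D} (m : Pro x y), right (cid m) = 𝟙 y
  left_vcomp : ∀ {x y x' y' x'' y'' : D} {m : Pro x y} {n : Pro x' y'} {k : Pro x'' y''}
    (α : Cell m n) (β : Cell n k), left (vcomp α β) = left α ≫ left β
  right_vcomp : ∀ {x y x' y' x'' y'' : D} {m : Pro x y} {n : Pro x' y'} {k : Pro x'' y''}
    (α : Cell m n) (β : Cell n k), right (vcomp α β) = right α ≫ right β
  cid_vcomp : ∀ {x y x' y' : D} {m : Pro x y} {n : Pro x' y'} (α : Cell m n),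
    vcomp (cid m) α = α
  vcomp_cid : ∀ {x y x' y' : D} {m : Pro x y} {n : Pro x' y'} (α : Cell m n),
    vcomp α (cid n) = α
  vcomp_assoc : ∀ {x y x' y' x'' y'' x₃ y₃ : D} {m : Pro x y} {n : Pro x' y'} {k : Pro x'' y''}
    {l : Pro x₃ y₃} (α : Cell m n) (β : Cell n k) (γ : Cell k l),
    vcomp (vcomp α β) γ = vcomp α (vcomp β γ)
  -- external identities
  unit : (x : D) → Pro x x
  unitCell : {x y : D} → (x ⟶ y) → Cell (unit x) (unit y)
  left_unitCell : ∀ {x y : D} (f : x ⟶ y), left (unitCell f) = f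
  right_unitCell : ∀ {x y : D} (f : x ⟶ y), right (unitCell f) = f
  unitCell_id : ∀ x : D, unitCell (𝟙 x) = cid (unit x)
  unitCell_comp : ∀ {x y z : D} (f : x ⟶ y) (g : y ⟶ z),
    unitCell (f ≫ g) = vcomp (unitCell f) (unitCell g)
  -- external composition
  pcomp : {x y z : D} → Pro x y → Pro y z → Pro x z
  hcomp : {x y z x' y' z' : D} → {m : Pro x y} → {n : Pro y z} → {m' : Pro x' y'} →
    {n' : Pro y' z'} → (α : Cell m m') → (β : Cell n n') → right α = left β →
    Cell (pcomp m n) (pcomp m' n')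
  left_hcomp : ∀ {x y z x' y' z' : D} {m : Pro x y} {n : Pro y z} {m' : Pro x' y'}
    {n' : Pro y' z'} (α : Cell m m') (β : Cell n n') (h : right α = left β),
    left (hcomp α β h) = left α
  right_hcomp : ∀ {x y z x' y' z' : D} {m : Pro x y} {n : Pro y z} {m' : Pro x' y'}
    {n' : Pro y' z'} (α : Cell m m') (β : Cell n n') (h : right α = left β),
    right (hcomp α β h) = right β
  hcomp_cid : ∀ {x y z : D} (m : Pro x y) (n : Pro y z) (h : right (cid m) = left (cid n)),
    hcomp (cid m) (cid n) h = cid (pcomp m n)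
  hcomp_vcomp : ∀ {x y z x' y' z' x'' y'' z'' : D} {m : Pro x y} {n : Pro y z} {m' : Pro x' y'}
    {n' : Pro y' z'} {m'' : Pro x'' y''} {n'' : Pro y'' z''} (α : Cell m m') (β : Cell n n')
    (α' : Cell m' m'') (β' : Cell n' n'') (h : right α = left β) (h' : right α' = left β')
    (h'' : right (vcomp α α') = left (vcomp β β')),
    hcomp (vcomp α α') (vcomp β β') h'' = vcomp (hcomp α β h) (hcomp α' β' h')
  -- associators
  assocHom : {x y z t : D} → (m : Pro x y) → (n : Pro y z) → (k : Pro z t) →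
    Cell (pcomp (pcomp m n) k) (pcomp m (pcomp n k))
  assocInv : {x y z t : D} → (m : Pro x y) → (n : Pro y z) → (k : Pro z t) →
    Cell (pcomp m (pcomp n k)) (pcomp (pcomp m n) k)
  left_assocHom : ∀ {x y z t : D} (m : Pro x y) (n : Pro y z) (k : Pro z t),
    left (assocHom m n k) = 𝟙 x
  right_assocHom : ∀ {x y z t : D} (m : Pro x y) (n : Pro y z) (k : Pro z t),
    right (assocHom m n k) = 𝟙 t
  assocHom_inv : ∀ {x y z t : D} (m : Pro x y) (n : Pro y z) (k : Pro z t),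
    vcomp (assocHom m n k) (assocInv m n k) = cid _
  assocInv_hom : ∀ {x y z t : D} (m : Pro x y) (n : Pro y z) (k : Pro z t),
    vcomp (assocInv m n k) (assocHom m n k) = cid _
  assoc_naturality : ∀ {x y z t x' y' z' t' : D} {m : Pro x y} {n : Pro y z} {k : Pro z t}
    {m' : Pro x' y'} {n' : Pro y' z'} {k' : Pro z' t'} (α : Cell m m') (β : Cell n n')
    (γ : Cell k k') (h : right α = left β) (h' : right β = left γ)
    (h₁ : right (hcomp α β h) = left γ) (h₂ : right α = left (hcomp β γ h')),
    vcomp (hcomp (hcomp α β h) γ h₁) (assocHom m' n' k') =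
      vcomp (assocHom m n k) (hcomp α (hcomp β γ h') h₂)
  -- unitors
  lunitHom : {x y : D} → (m : Pro x y) → Cell (pcomp (unit x) m) m
  lunitInv : {x y : D} → (m : Pro x y) → Cell m (pcomp (unit x) m)
  left_lunitHom : ∀ {x y : D} (m : Pro x y), left (lunitHom m) = 𝟙 x
  right_lunitHom : ∀ {x y : D} (m : Pro x y), right (lunitHom m) = 𝟙 y
  lunitHom_inv : ∀ {x y : D} (m : Pro x y), vcomp (lunitHom m) (lunitInv m) = cid _
  lunitInv_hom : ∀ {x y : D} (m : Pro x y), vcomp (lunitInv m) (lunitHom m) = cid _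
  lunit_naturality : ∀ {x y x' y' : D} {m : Pro x y} {m' : Pro x' y'} (α : Cell m m')
    (h : right (unitCell (left α)) = left α),
    vcomp (hcomp (unitCell (left α)) α h) (lunitHom m') = vcomp (lunitHom m) α
  runitHom : {x y : D} → (m : Pro x y) → Cell (pcomp m (unit y)) m
  runitInv : {x y : D} → (m : Pro x y) → Cell m (pcomp m (unit y))
  left_runitHom : ∀ {x y : D} (m : Pro x y), left (runitHom m) = 𝟙 x
  right_runitHom : ∀ {x y : D} (m : Pro x y), right (runitHom m) = 𝟙 y
  runitHom_inv : ∀ {x y : D} (m : Pro x y), vcomp (runitHom m) (runitInv m) = cid _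
  runitInv_hom : ∀ {x y : D} (m : Pro x y), vcomp (runitInv m) (runitHom m) = cid _
  runit_naturality : ∀ {x y x' y' : D} {m : Pro x y} {m' : Pro x' y'} (α : Cell m m')
    (h : right α = left (unitCell (right α))),
    vcomp (hcomp α (unitCell (right α)) h) (runitHom m') = vcomp (runitHom m) α
  -- coherence
  pentagon : ∀ {x y z t s : D} (m : Pro x y) (n : Pro y z) (k : Pro z t) (l : Pro t s)
    (h : right (assocHom m n k) = left (cid l)) (h' : right (cid m) = left (assocHom n k l)),
    vcomp (hcomp (assocHom m n k) (cid l) h)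
      (vcomp (assocHom m (pcomp n k) l) (hcomp (cid m) (assocHom n k l) h')) =
      vcomp (assocHom (pcomp m n) k l) (assocHom m n (pcomp k l))
  triangle : ∀ {x y z : D} (m : Pro x y) (n : Pro y z)
    (h : right (cid m) = left (lunitHom n)) (h' : right (runitHom m) = left (cid n)),
    vcomp (assocHom m (unit y) n) (hcomp (cid m) (lunitHom n) h) = hcomp (runitHom m) (cid n) h'

namespace DoubleCategory

infixr:80 " ≫ᵥ " => DoubleCategory.vcomp
infixr:85 " ⊙ " => DoubleCategory.pcomp

attribute [simp] left_cid right_cid left_vcomp right_vcomp cid_vcomp vcomp_cid vcomp_assoc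
  left_unitCell right_unitCell unitCell_id left_hcomp right_hcomp hcomp_cid
  left_assocHom right_assocHom assocHom_inv assocInv_hom
  left_lunitHom right_lunitHom lunitHom_inv lunitInv_hom
  left_runitHom right_runitHom runitHom_inv runitInv_hom

section Basic

variable {D : Type u} [DoubleCategory.{u, v, p, c} D]

theorem left_eq_id_of_inv {x y : D} {m n : Pro x y} {α : Cell m n} {β : Cell n m}
    (h : α ≫ᵥ β = cid m) (hα : left α = 𝟙 x) : left β = 𝟙 x := by
  have := congrArg left h
  simpa [hα] using this

theorem right_eq_id_of_inv {x y : D} {m n : Pro x y} {α : Cell m n} {β : Cell n m}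
    (h : α ≫ᵥ β = cid m) (hα : right α = 𝟙 y) : right β = 𝟙 y := by
  have := congrArg right h
  simpa [hα] using this

@[simp] theorem left_assocInv {x y z t : D} (m : Pro x y) (n : Pro y z) (k : Pro z t) :
    left (assocInv m n k) = 𝟙 x :=
  left_eq_id_of_inv (assocHom_inv m n k) (left_assocHom m n k)

@[simp] theorem right_assocInv {x y z t : D} (m : Pro x y) (n : Pro y z) (k : Pro z t) :
    right (assocInv m n k) = 𝟙 t :=
  right_eq_id_of_inv (assocHom_inv m n k) (right_assocHom m n k)

@[simp] theorem left_lunitInv {x y : D} (m : Pro x y) : left (lunitInv m) = 𝟙 x :=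
  left_eq_id_of_inv (lunitHom_inv m) (left_lunitHom m)

@[simp] theorem right_lunitInv {x y : D} (m : Pro x y) : right (lunitInv m) = 𝟙 y :=
  right_eq_id_of_inv (lunitHom_inv m) (right_lunitHom m)

@[simp] theorem left_runitInv {x y : D} (m : Pro x y) : left (runitInv m) = 𝟙 x :=
  left_eq_id_of_inv (runitHom_inv m) (left_runitHom m)

@[simp] theorem right_runitInv {x y : D} (m : Pro x y) : right (runitInv m) = 𝟙 y :=
  right_eq_id_of_inv (runitHom_inv m) (right_runitHom m)

/-- A cell is invertible if it is an isomorphism for vertical composition. -/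
def IsInvertible {x y x' y' : D} {m : Pro x y} {n : Pro x' y'} (α : Cell m n) : Prop :=
  ∃ β : Cell n m, α ≫ᵥ β = cid m ∧ β ≫ᵥ α = cid n

/-- A companion of an arrow `f : x ⟶ y`: a proarrow `f_! : x ⇸ y` with unit and counit cells. -/
structure Companion {x y : D} (f : x ⟶ y) where
  pro : Pro x y
  η : Cell (unit x) pro
  ε : Cell pro (unit y)
  left_η : left η = 𝟙 x
  right_η : right η = f
  left_ε : left ε = f
  right_ε : right ε = 𝟙 y
  /-- `η ⊙ ε = 1`, up to the unitors -/
  hcomp_eq : lunitInv pro ≫ᵥ hcomp η ε (right_η.trans left_ε.symm) ≫ᵥ runitHom pro = cid pro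
  vcomp_eq : η ≫ᵥ ε = unitCell f

/-- A conjoint of an arrow `f : x ⟶ y`: a proarrow `f^* : y ⇸ x` with unit and counit cells. -/
structure Conjoint {x y : D} (f : x ⟶ y) where
  pro : Pro y x
  η : Cell (unit x) pro
  ε : Cell pro (unit y)
  left_η : left η = f
  right_η : right η = 𝟙 x
  left_ε : left ε = 𝟙 y
  right_ε : right ε = f
  /-- `ε ⊙ η = 1`, up to the unitors -/
  hcomp_eq : runitInv pro ≫ᵥ hcomp ε η (right_ε.trans left_η.symm) ≫ᵥ lunitHom pro = cid pro
  vcomp_eq : η ≫ᵥ ε = unitCell f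

/-- The globular cell `α_! : m ⊙ g_! → f_! ⊙ n` obtained from a cell `α : m → n` with left and
right boundaries `f` and `g` by sliding the boundaries along chosen companions. -/
def companionReshape {x y w z : D} {m : Pro x y} {n : Pro w z} (α : Cell m n)
    (f : Companion (left α)) (g : Companion (right α)) : Cell (m ⊙ g.pro) (f.pro ⊙ n) :=
  hcomp (lunitInv m) (cid g.pro) (by simp) ≫ᵥ
    hcomp (hcomp f.η α f.right_η) g.ε (by rw [right_hcomp, g.left_ε]) ≫ᵥ runitHom (f.pro ⊙ n)

/-- The globular cell `α^* : f^* ⊙ m → n ⊙ g^*` obtained from a cell `α : m → n` with left and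
right boundaries `f` and `g` by sliding the boundaries along chosen conjoints. -/
def conjointReshape {x y w z : D} {m : Pro x y} {n : Pro w z} (α : Cell m n)
    (f : Conjoint (left α)) (g : Conjoint (right α)) : Cell (f.pro ⊙ m) (n ⊙ g.pro) :=
  runitInv (f.pro ⊙ m) ≫ᵥ
    hcomp (hcomp f.ε α f.right_ε) g.η (by rw [right_hcomp, g.left_η]) ≫ᵥ
      hcomp (lunitHom n) (cid g.pro) (by simp)

/-- A cell is a commuter if its boundary arrows have companions and the cell `α_!`, formed with
any choice of these, is invertible. -/
def IsCommuter {x y w z : D} {m : Pro x y} {n : Pro w z} (α : Cell m n) : Prop :=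
  Nonempty (Companion (left α)) ∧ Nonempty (Companion (right α)) ∧
    ∀ (f : Companion (left α)) (g : Companion (right α)), IsInvertible (companionReshape α f g)

/-- A cell is a cocommuter if its boundary arrows have conjoints and the cell `α^*`, formed with
any choice of these, is invertible. -/
def IsCocommuter {x y w z : D} {m : Pro x y} {n : Pro w z} (α : Cell m n) : Prop :=
  Nonempty (Conjoint (left α)) ∧ Nonempty (Conjoint (right α)) ∧
    ∀ (f : Conjoint (left α)) (g : Conjoint (right α)), IsInvertible (conjointReshape α f g)

end Basic

/-- The power `D^I` of a double category, with everything defined pointwise. -/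
instance piDoubleCategory (I : Type w) (D : Type u) [DoubleCategory.{u, v, p, c} D] :
    DoubleCategory.{max w u, max w v, max w p, max w c} (I → D) where
  toCategory := CategoryTheory.pi (fun _ => D)
  Pro x y := ∀ i, Pro (x i) (y i)
  Cell m n := ∀ i, Cell (m i) (n i)
  left α i := left (α i)
  right α i := right (α i)
  cid m i := cid (m i)
  vcomp α β i := α i ≫ᵥ β i
  left_cid m := funext fun i => left_cid (m i)
  right_cid m := funext fun i => right_cid (m i)
  left_vcomp α β := funext fun i => left_vcomp (α i) (β i)
  right_vcomp α β := funext fun i => right_vcomp (α i) (β i)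
  cid_vcomp α := funext fun i => cid_vcomp (α i)
  vcomp_cid α := funext fun i => vcomp_cid (α i)
  vcomp_assoc α β γ := funext fun i => vcomp_assoc (α i) (β i) (γ i)
  unit x i := unit (x i)
  unitCell f i := unitCell (f i)
  left_unitCell f := funext fun i => left_unitCell (f i)
  right_unitCell f := funext fun i => right_unitCell (f i)
  unitCell_id x := funext fun i => unitCell_id (x i)
  unitCell_comp f g := funext fun i => unitCell_comp (f i) (g i)
  pcomp m n i := m i ⊙ n i
  hcomp α β h i := hcomp (α i) (β i) (congrFun h i)
  left_hcomp α β h := funext fun i => left_hcomp (α i) (β i) (congrFun h i)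
  right_hcomp α β h := funext fun i => right_hcomp (α i) (β i) (congrFun h i)
  hcomp_cid m n _ := funext fun i => hcomp_cid (m i) (n i) _
  hcomp_vcomp α β α' β' h h' _ := funext fun i =>
    hcomp_vcomp (α i) (β i) (α' i) (β' i) (congrFun h i) (congrFun h' i) _
  assocHom m n k i := assocHom (m i) (n i) (k i)
  assocInv m n k i := assocInv (m i) (n i) (k i)
  left_assocHom m n k := funext fun i => left_assocHom (m i) (n i) (k i)
  right_assocHom m n k := funext fun i => right_assocHom (m i) (n i) (k i)
  assocHom_inv m n k := funext fun i => assocHom_inv (m i) (n i) (k i)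
  assocInv_hom m n k := funext fun i => assocInv_hom (m i) (n i) (k i)
  assoc_naturality α β γ h h' h₁ h₂ := funext fun i =>
    assoc_naturality (α i) (β i) (γ i) (congrFun h i) (congrFun h' i) (congrFun h₁ i)
      (congrFun h₂ i)
  lunitHom m i := lunitHom (m i)
  lunitInv m i := lunitInv (m i)
  left_lunitHom m := funext fun i => left_lunitHom (m i)
  right_lunitHom m := funext fun i => right_lunitHom (m i)
  lunitHom_inv m := funext fun i => lunitHom_inv (m i)
  lunitInv_hom m := funext fun i => lunitInv_hom (m i)
  lunit_naturality α h := funext fun i => lunit_naturality (α i) (congrFun h i)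
  runitHom m i := runitHom (m i)
  runitInv m i := runitInv (m i)
  left_runitHom m := funext fun i => left_runitHom (m i)
  right_runitHom m := funext fun i => right_runitHom (m i)
  runitHom_inv m := funext fun i => runitHom_inv (m i)
  runitInv_hom m := funext fun i => runitInv_hom (m i)
  runit_naturality α h := funext fun i => runit_naturality (α i) (congrFun h i)
  pentagon m n k l h h' := funext fun i =>
    pentagon (m i) (n i) (k i) (l i) (congrFun h i) (congrFun h' i)
  triangle m n h h' := funext fun i => triangle (m i) (n i) (congrFun h i) (congrFun h' i)

end DoubleCategory

open DoubleCategory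

/-- A lax double functor between double categories. -/
structure LaxDoubleFunctor (D : Type u₁) [DoubleCategory.{u₁, v₁, p₁, c₁} D]
    (E : Type u₂) [DoubleCategory.{u₂, v₂, p₂, c₂} E] extends D ⥤ E where
  mapPro : {x y : D} → Pro x y → Pro (obj x) (obj y)
  mapCell : {x y w z : D} → {m : Pro x y} → {n : Pro w z} → Cell m n → Cell (mapPro m) (mapPro n)
  left_mapCell : ∀ {x y w z : D} {m : Pro x y} {n : Pro w z} (α : Cell m n),
    left (mapCell α) = map (left α)
  right_mapCell : ∀ {x y w z : D} {m : Pro x y} {n : Pro w z} (α : Cell m n),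
    right (mapCell α) = map (right α)
  mapCell_cid : ∀ {x y : D} (m : Pro x y), mapCell (cid m) = cid (mapPro m)
  mapCell_vcomp : ∀ {x y x' y' x'' y'' : D} {m : Pro x y} {n : Pro x' y'} {k : Pro x'' y''}
    (α : Cell m n) (β : Cell n k), mapCell (α ≫ᵥ β) = mapCell α ≫ᵥ mapCell β
  -- composition and identity comparisons
  comp : {x y z : D} → (m : Pro x y) → (n : Pro y z) →
    Cell (mapPro m ⊙ mapPro n) (mapPro (m ⊙ n))
  left_comp : ∀ {x y z : D} (m : Pro x y) (n : Pro y z), left (comp m n) = 𝟙 (obj x)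
  right_comp : ∀ {x y z : D} (m : Pro x y) (n : Pro y z), right (comp m n) = 𝟙 (obj z)
  comp_naturality : ∀ {x y z x' y' z' : D} {m : Pro x y} {n : Pro y z} {m' : Pro x' y'}
    {n' : Pro y' z'} (α : Cell m m') (β : Cell n n') (h : right α = left β)
    (h' : right (mapCell α) = left (mapCell β)),
    hcomp (mapCell α) (mapCell β) h' ≫ᵥ comp m' n' = comp m n ≫ᵥ mapCell (hcomp α β h)
  idn : (x : D) → Cell (unit (obj x)) (mapPro (unit x))
  left_idn : ∀ x : D, left (idn x) = 𝟙 (obj x)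
  right_idn : ∀ x : D, right (idn x) = 𝟙 (obj x)
  idn_naturality : ∀ {x y : D} (f : x ⟶ y),
    unitCell (map f) ≫ᵥ idn y = idn x ≫ᵥ mapCell (unitCell f)
  -- coherence
  map_assoc : ∀ {x y z t : D} (m : Pro x y) (n : Pro y z) (k : Pro z t)
    (h : right (comp m n) = left (cid (mapPro k))) (h' : right (cid (mapPro m)) = left (comp n k)),
    hcomp (comp m n) (cid (mapPro k)) h ≫ᵥ comp (m ⊙ n) k ≫ᵥ mapCell (assocHom m n k) =
      assocHom (mapPro m) (mapPro n) (mapPro k) ≫ᵥ hcomp (cid (mapPro m)) (comp n k) h' ≫ᵥ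
        comp m (n ⊙ k)
  map_lunit : ∀ {x y : D} (m : Pro x y) (h : right (idn x) = left (cid (mapPro m))),
    hcomp (idn x) (cid (mapPro m)) h ≫ᵥ comp (unit x) m ≫ᵥ mapCell (lunitHom m) =
      lunitHom (mapPro m)
  map_runit : ∀ {x y : D} (m : Pro x y) (h : right (cid (mapPro m)) = left (idn y)),
    hcomp (cid (mapPro m)) (idn y) h ≫ᵥ comp m (unit y) ≫ᵥ mapCell (runitHom m) =
      runitHom (mapPro m)

namespace LaxDoubleFunctor

attribute [simp] left_mapCell right_mapCell mapCell_cid mapCell_vcomp left_comp right_comp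
  left_idn right_idn

variable {C : Type u₁} [DoubleCategory.{u₁, v₁, p₁, c₁} C]
  {D : Type u₂} [DoubleCategory.{u₂, v₂, p₂, c₂} D] {E : Type u₃} [DoubleCategory.{u₃, v₃, p₃, c₃} E]

/-- Composition of lax double functors, in diagrammatic order. -/
def compose (F : LaxDoubleFunctor C D) (G : LaxDoubleFunctor D E) : LaxDoubleFunctor C E where
  toFunctor := F.toFunctor ⋙ G.toFunctor
  mapPro m := G.mapPro (F.mapPro m)
  mapCell α := G.mapCell (F.mapCell α)
  left_mapCell α := by simp
  right_mapCell α := by simp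
  mapCell_cid m := by simp
  mapCell_vcomp α β := by simp
  comp m n := G.comp (F.mapPro m) (F.mapPro n) ≫ᵥ G.mapCell (F.comp m n)
  left_comp m n := by simp
  right_comp m n := by simp
  comp_naturality α β h h' := by
    rw [← vcomp_assoc, G.comp_naturality _ _ (by simp [h]), vcomp_assoc, vcomp_assoc,
      ← G.mapCell_vcomp, ← G.mapCell_vcomp, F.comp_naturality]
  idn x := G.idn (F.obj x) ≫ᵥ G.mapCell (F.idn x)
  left_idn x := by simp
  right_idn x := by simp
  idn_naturality f := by
    rw [vcomp_assoc, ← G.mapCell_vcomp, ← F.idn_naturality, G.mapCell_vcomp, ← vcomp_assoc,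
      ← vcomp_assoc, ← G.idn_naturality]
    rfl
  map_assoc m n k h h' := by
    have e₁ := hcomp_vcomp (G.comp (F.mapPro m) (F.mapPro n)) (cid (G.mapPro (F.mapPro k)))
      (G.mapCell (F.comp m n)) (G.mapCell (cid (F.mapPro k))) (by simp) (by simp) (by simp)
    have e₂ := hcomp_vcomp (cid (G.mapPro (F.mapPro m))) (G.comp (F.mapPro n) (F.mapPro k))
      (G.mapCell (cid (F.mapPro m))) (G.mapCell (F.comp n k)) (by simp) (by simp) (by simp)
    have e₃ := G.comp_naturality (F.comp m n) (cid (F.mapPro k)) (by simp) (by simp)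
    have e₄ := G.comp_naturality (cid (F.mapPro m)) (F.comp n k) (by simp) (by simp)
    have e₅ := G.map_assoc (F.mapPro m) (F.mapPro n) (F.mapPro k) (by simp) (by simp)
    have e₆ := congrArg G.mapCell (F.map_assoc m n k (by simp) (by simp))
    simp only [mapCell_cid, cid_vcomp, mapCell_vcomp] at e₁ e₂ e₃ e₄ e₅ e₆
    rw [e₁, e₂]
    simp only [vcomp_assoc]
    rw [← vcomp_assoc _ (G.comp _ _), e₃, vcomp_assoc, e₆, ← vcomp_assoc (G.comp _ _),
      ← vcomp_assoc, e₅, ← vcomp_assoc _ (G.comp (F.mapPro m) _), e₄]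
    simp only [vcomp_assoc]
  map_lunit m h := by
    have e₁ := hcomp_vcomp (G.idn _) (cid (G.mapPro (F.mapPro m)))
      (G.mapCell (F.idn _)) (G.mapCell (cid (F.mapPro m))) (by simp) (by simp) (by simp)
    have e₃ := G.comp_naturality (F.idn _) (cid (F.mapPro m)) (by simp) (by simp)
    have e₅ := G.map_lunit (F.mapPro m) (by simp)
    have e₆ := congrArg G.mapCell (F.map_lunit m (by simp))
    simp only [mapCell_cid, cid_vcomp, mapCell_vcomp] at e₁ e₃ e₅ e₆
    rw [e₁]
    simp only [vcomp_assoc]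
    rw [← vcomp_assoc _ (G.comp _ _), e₃, vcomp_assoc, e₆, e₅]
  map_runit m h := by
    have e₁ := hcomp_vcomp (cid (G.mapPro (F.mapPro m))) (G.idn _)
      (G.mapCell (cid (F.mapPro m))) (G.mapCell (F.idn _)) (by simp) (by simp) (by simp)
    have e₃ := G.comp_naturality (cid (F.mapPro m)) (F.idn _) (by simp) (by simp)
    have e₅ := G.map_runit (F.mapPro m) (by simp)
    have e₆ := congrArg G.mapCell (F.map_runit m (by simp))
    simp only [mapCell_cid, cid_vcomp, mapCell_vcomp] at e₁ e₃ e₅ e₆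
    rw [e₁]
    simp only [vcomp_assoc]
    rw [← vcomp_assoc _ (G.comp _ _), e₃, vcomp_assoc, e₆, e₅]

end LaxDoubleFunctor

/-- The (strict) double functor `D^f : D^J → D^I` reindexing families along `f : I → J`. -/
def reindex {D : Type u} [DoubleCategory.{u, v, p, c} D] {I J : Type w} (f : I → J) :
    LaxDoubleFunctor (J → D) (I → D) where
  obj x i := x (f i)
  map g i := g (f i)
  mapPro m i := m (f i)
  mapCell α i := α (f i)
  left_mapCell _ := rfl
  right_mapCell _ := rfl
  mapCell_cid _ := rfl
  mapCell_vcomp _ _ := rfl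
  comp m n := cid (D := I → D) (fun i => m (f i) ⊙ n (f i))
  left_comp m n := left_cid (D := I → D) _
  right_comp m n := right_cid (D := I → D) _
  comp_naturality α β h h' := (vcomp_cid (D := I → D) _).trans (cid_vcomp (D := I → D) _).symm
  idn x := cid (D := I → D) (fun i => unit (x (f i)))
  left_idn x := left_cid (D := I → D) _
  right_idn x := right_cid (D := I → D) _
  idn_naturality g := (vcomp_cid (D := I → D) _).trans (cid_vcomp (D := I → D) _).symm
  map_assoc m n k h h' := by
    funext i
    change hcomp (D := D) (cid _) (cid _) _ ≫ᵥ cid _ ≫ᵥ assocHom _ _ _ =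
      assocHom _ _ _ ≫ᵥ hcomp (cid _) (cid _) _ ≫ᵥ cid _
    simp
  map_lunit m h := by
    funext i
    change hcomp (D := D) (cid _) (cid _) _ ≫ᵥ cid _ ≫ᵥ lunitHom _ = lunitHom _
    simp
  map_runit m h := by
    funext i
    change hcomp (D := D) (cid _) (cid _) _ ≫ᵥ cid _ ≫ᵥ runitHom _ = runitHom _
    simp

/-- A natural transformation between lax double functors. -/
@[ext]
structure DoubleNatTrans {D : Type u₁} [DoubleCategory.{u₁, v₁, p₁, c₁} D]
    {E : Type u₂} [DoubleCategory.{u₂, v₂, p₂, c₂} E] (F G : LaxDoubleFunctor D E) where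
  app : (x : D) → (F.obj x ⟶ G.obj x)
  cell : {x y : D} → (m : Pro x y) → Cell (F.mapPro m) (G.mapPro m)
  left_cell : ∀ {x y : D} (m : Pro x y), left (cell m) = app x
  right_cell : ∀ {x y : D} (m : Pro x y), right (cell m) = app y
  naturality : ∀ {x y : D} (f : x ⟶ y), F.map f ≫ app y = app x ≫ G.map f
  cell_naturality : ∀ {x y w z : D} {m : Pro x y} {n : Pro w z} (α : Cell m n),
    F.mapCell α ≫ᵥ cell n = cell m ≫ᵥ G.mapCell α
  comp_cell : ∀ {x y z : D} (m : Pro x y) (n : Pro y z) (h : right (cell m) = left (cell n)),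
    F.comp m n ≫ᵥ cell (m ⊙ n) = hcomp (cell m) (cell n) h ≫ᵥ G.comp m n
  idn_cell : ∀ x : D, F.idn x ≫ᵥ cell (unit x) = unitCell (app x) ≫ᵥ G.idn x

namespace DoubleNatTrans

attribute [simp] left_cell right_cell

end DoubleNatTrans

section LaxPs

variable {D : Type u₁} [DoubleCategory.{u₁, v₁, p₁, c₁} D]
  {E : Type u₂} [DoubleCategory.{u₂, v₂, p₂, c₂} E]

/-- Lax double functors and natural transformations form a category, with everything defined
componentwise. -/
instance laxDoubleFunctorCategory : Category (LaxDoubleFunctor D E) where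
  Hom F G := DoubleNatTrans F G
  id F :=
    { app x := 𝟙 (F.obj x)
      cell m := cid (F.mapPro m)
      left_cell m := by simp
      right_cell m := by simp
      naturality f := by simp
      cell_naturality α := by simp
      comp_cell m n h := by simp
      idn_cell x := by simp }
  comp α β :=
    { app x := α.app x ≫ β.app x
      cell m := α.cell m ≫ᵥ β.cell m
      left_cell m := by simp
      right_cell m := by simp
      naturality f := by
        rw [← Category.assoc, α.naturality, Category.assoc, β.naturality, Category.assoc]
      cell_naturality γ := by
        rw [← vcomp_assoc, α.cell_naturality, vcomp_assoc, β.cell_naturality, vcomp_assoc]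
      comp_cell m n h := by
        rw [← vcomp_assoc, α.comp_cell _ _ (by simp), vcomp_assoc, β.comp_cell _ _ (by simp),
          ← vcomp_assoc, hcomp_vcomp]
      idn_cell x := by
        rw [← vcomp_assoc, α.idn_cell, vcomp_assoc, β.idn_cell, ← vcomp_assoc, unitCell_comp] }
  id_comp α := by ext <;> simp
  comp_id α := by ext <;> simp
  assoc α β γ := by ext <;> simp

@[simp] theorem laxDoubleFunctor_id_app (F : LaxDoubleFunctor D E) (x : D) :
    DoubleNatTrans.app (𝟙 F) x = 𝟙 (F.obj x) := rfl

@[simp] theorem laxDoubleFunctor_id_cell (F : LaxDoubleFunctor D E) {x y : D} (m : Pro x y) :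
    DoubleNatTrans.cell (𝟙 F) m = cid (F.mapPro m) := rfl

@[simp] theorem laxDoubleFunctor_comp_app {F G H : LaxDoubleFunctor D E} (α : F ⟶ G) (β : G ⟶ H)
    (x : D) : DoubleNatTrans.app (α ≫ β) x = DoubleNatTrans.app α x ≫ DoubleNatTrans.app β x := rfl

@[simp] theorem laxDoubleFunctor_comp_cell {F G H : LaxDoubleFunctor D E} (α : F ⟶ G) (β : G ⟶ H)
    {x y : D} (m : Pro x y) :
    DoubleNatTrans.cell (α ≫ β) m = DoubleNatTrans.cell α m ≫ᵥ DoubleNatTrans.cell β m := rfl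

end LaxPs

section Bicategory

/-- The objects of a double category, regarded as the objects of its underlying bicategory. -/
structure UBicat (E : Type u) where
  obj : E

/-- A globular cell: a cell whose boundary arrows are identities. -/
@[ext]
structure GlobCell {E : Type u} [DoubleCategory.{u, v, p, c} E] {x y : E} (m n : Pro x y) where
  val : Cell m n
  left_val : left val = 𝟙 x
  right_val : right val = 𝟙 y

attribute [simp] GlobCell.left_val GlobCell.right_val

instance globCellCategory {E : Type u} [DoubleCategory.{u, v, p, c} E] (x y : E) :
    Category (Pro x y) where
  Hom m n := GlobCell m n
  id m := ⟨cid m, left_cid m, right_cid m⟩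
  comp α β := ⟨α.val ≫ᵥ β.val, by simp, by simp⟩
  id_comp α := GlobCell.ext (cid_vcomp _)
  comp_id α := GlobCell.ext (vcomp_cid _)
  assoc α β γ := GlobCell.ext (vcomp_assoc _ _ _)


section

variable {E : Type u} [DoubleCategory.{u, v, p, c} E]

/-- Left whiskering of a globular cell. -/
def whiskL {x y z : E} (m : Pro x y) {n n' : Pro y z} (α : n ⟶ n') : m ⊙ n ⟶ m ⊙ n' :=
  GlobCell.mk (hcomp (cid m) α.val (by simp)) (by simp) (by simp)

/-- Right whiskering of a globular cell. -/
def whiskR {x y z : E} {m m' : Pro x y} (α : m ⟶ m') (n : Pro y z) : m ⊙ n ⟶ m' ⊙ n :=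
  GlobCell.mk (hcomp α.val (cid n) (by simp)) (by simp) (by simp)

/-- The associator as an isomorphism of proarrows. -/
def assocIso {x y z t : E} (m : Pro x y) (n : Pro y z) (k : Pro z t) :
    (m ⊙ n) ⊙ k ≅ m ⊙ n ⊙ k where
  hom := GlobCell.mk (assocHom m n k) (by simp) (by simp)
  inv := GlobCell.mk (assocInv m n k) (by simp) (by simp)
  hom_inv_id := GlobCell.ext (assocHom_inv m n k)
  inv_hom_id := GlobCell.ext (assocInv_hom m n k)

/-- The left unitor as an isomorphism of proarrows. -/
def lunitIso {x y : E} (m : Pro x y) : unit x ⊙ m ≅ m where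
  hom := GlobCell.mk (lunitHom m) (by simp) (by simp)
  inv := GlobCell.mk (lunitInv m) (by simp) (by simp)
  hom_inv_id := GlobCell.ext (lunitHom_inv m)
  inv_hom_id := GlobCell.ext (lunitInv_hom m)

/-- The right unitor as an isomorphism of proarrows. -/
def runitIso {x y : E} (m : Pro x y) : m ⊙ unit y ≅ m where
  hom := GlobCell.mk (runitHom m) (by simp) (by simp)
  inv := GlobCell.mk (runitInv m) (by simp) (by simp)
  hom_inv_id := GlobCell.ext (runitHom_inv m)
  inv_hom_id := GlobCell.ext (runitInv_hom m)

end

/-- The underlying bicategory of a double category: objects, proarrows and globular cells. -/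
instance underlyingBicategory (E : Type u) [DoubleCategory.{u, v, p, c} E] :
    Bicategory.{c, p} (UBicat E) where
  Hom x y := Pro x.obj y.obj
  id x := unit x.obj
  comp m n := pcomp m n
  homCategory x y := globCellCategory x.obj y.obj
  whiskerLeft m _ _ η := whiskL m η
  whiskerRight η n := whiskR η n
  associator m n k := assocIso m n k
  leftUnitor m := lunitIso m
  rightUnitor m := runitIso m
  whiskerLeft_id m n := GlobCell.ext (hcomp_cid _ _ _)
  whiskerLeft_comp m _ _ _ η θ := GlobCell.ext (by
    change hcomp (cid m) (η.val ≫ᵥ θ.val) _ = hcomp _ _ _ ≫ᵥ hcomp _ _ _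
    rw [← hcomp_vcomp _ _ _ _ _ _ (by simp)]
    simp)
  id_whiskerLeft {x y m n} η := GlobCell.ext (by
    change hcomp (cid (unit x.obj)) η.val _ = lunitHom m ≫ᵥ η.val ≫ᵥ lunitInv n
    have := lunit_naturality η.val (by simp)
    simp only [η.left_val, unitCell_id] at this
    rw [← vcomp_assoc, ← this]
    simp)
  comp_whiskerLeft m n k k' η := GlobCell.ext (by
    have e := assoc_naturality (cid m) (cid n) η.val (by simp) (by simp) (by simp) (by simp)
    have e' := congrArg (fun t => t ≫ᵥ assocInv m n k') e
    simp only [vcomp_assoc, hcomp_cid, assocHom_inv, vcomp_cid] at e'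
    exact e')
  id_whiskerRight m n := GlobCell.ext (hcomp_cid _ _ _)
  comp_whiskerRight η θ n := GlobCell.ext (by
    change hcomp (η.val ≫ᵥ θ.val) (cid n) _ = hcomp _ _ _ ≫ᵥ hcomp _ _ _
    rw [← hcomp_vcomp _ _ _ _ _ _ (by simp)]
    simp)
  whiskerRight_id {x y m n} η := GlobCell.ext (by
    change hcomp η.val (cid (unit y.obj)) _ = runitHom m ≫ᵥ η.val ≫ᵥ runitInv n
    have := runit_naturality η.val (by simp)
    simp only [η.right_val, unitCell_id] at this
    rw [← vcomp_assoc, ← this]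
    simp)
  whiskerRight_comp {_ _ _ _ m m'} η n k := GlobCell.ext (by
    change hcomp η.val (cid (n ⊙ k)) _ = assocInv m n k ≫ᵥ
      hcomp (hcomp η.val (cid n) _) (cid k) _ ≫ᵥ assocHom m' n k
    rw [assoc_naturality _ _ _ (by simp) (by simp) (by simp) (by simp), ← vcomp_assoc]
    simp)
  whisker_assoc m n n' η k := GlobCell.ext (by
    have e := assoc_naturality (cid m) η.val (cid k) (by simp) (by simp) (by simp) (by simp)
    have e' := congrArg (fun t => t ≫ᵥ assocInv m n' k) e
    simp only [vcomp_assoc, assocHom_inv, vcomp_cid] at e'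
    exact e')
  whisker_exchange η θ := GlobCell.ext (by
    change hcomp _ _ _ ≫ᵥ hcomp _ _ _ = hcomp _ _ _ ≫ᵥ hcomp _ _ _
    rw [← hcomp_vcomp _ _ _ _ _ _ (by simp), ← hcomp_vcomp _ _ _ _ _ _ (by simp)]
    simp)
  pentagon m n k l := GlobCell.ext (pentagon m n k l _ _)
  triangle m n := GlobCell.ext (triangle m n _ _)

end Bicategory

section LaxPs

variable {D : Type u₁} [DoubleCategory.{u₁, v₁, p₁, c₁} D]
  {E : Type u₂} [DoubleCategory.{u₂, v₂, p₂, c₂} E]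

open Bicategory

/-- The lax functor between underlying bicategories given by a lax double functor. -/
def LaxDoubleFunctor.toLaxFunctor (F : LaxDoubleFunctor D E) :
    LaxFunctor (UBicat D) (UBicat E) where
  obj x := ⟨F.obj x.obj⟩
  map m := F.mapPro m
  map₂ α := GlobCell.mk (F.mapCell α.val) (by simp) (by simp)
  map₂_id m := GlobCell.ext (F.mapCell_cid m)
  map₂_comp α β := GlobCell.ext (F.mapCell_vcomp α.val β.val)
  mapId x := GlobCell.mk (F.idn x.obj) (by simp) (by simp)
  mapComp m n := GlobCell.mk (F.comp m n) (by simp) (by simp)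
  mapComp_naturality_left α n := GlobCell.ext (by
    have e := F.comp_naturality α.val (cid n) (by simp) (by simp)
    simp only [F.mapCell_cid] at e
    exact e.symm)
  mapComp_naturality_right m _ _ α := GlobCell.ext (by
    have e := F.comp_naturality (cid m) α.val (by simp) (by simp)
    simp only [F.mapCell_cid] at e
    exact e.symm)
  map₂_associator m n k := GlobCell.ext (F.map_assoc m n k (by simp) (by simp))
  map₂_leftUnitor {x y} m := GlobCell.ext (by
    have e := F.map_lunit m (by simp)
    have e' := congrArg (fun t => lunitInv (F.mapPro m) ≫ᵥ t ≫ᵥ F.mapCell (lunitInv m)) e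
    simp only [vcomp_assoc, ← F.mapCell_vcomp, lunitHom_inv, F.mapCell_cid, vcomp_cid] at e'
    rw [← vcomp_assoc _ _ (F.mapCell _), lunitInv_hom, cid_vcomp] at e'
    exact e'.symm)
  map₂_rightUnitor {x y} m := GlobCell.ext (by
    have e := F.map_runit m (by simp)
    have e' := congrArg (fun t => runitInv (F.mapPro m) ≫ᵥ t ≫ᵥ F.mapCell (runitInv m)) e
    simp only [vcomp_assoc, ← F.mapCell_vcomp, runitHom_inv, F.mapCell_cid, vcomp_cid] at e'
    rw [← vcomp_assoc _ _ (F.mapCell _), runitInv_hom, cid_vcomp] at e'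
    exact e'.symm)

/-- A (pseudo) protransformation between lax double functors: a lax protransformation whose
naturality comparisons `nat m` are invertible. -/
structure Protransformation (F G : LaxDoubleFunctor D E) where
  app : (x : D) → Pro (F.obj x) (G.obj x)
  map : {x y : D} → (f : x ⟶ y) → Cell (app x) (app y)
  left_map : ∀ {x y : D} (f : x ⟶ y), left (map f) = F.map f
  right_map : ∀ {x y : D} (f : x ⟶ y), right (map f) = G.map f
  map_id : ∀ x : D, map (𝟙 x) = cid (app x)
  map_comp : ∀ {x y z : D} (f : x ⟶ y) (g : y ⟶ z), map (f ≫ g) = map f ≫ᵥ map g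
  nat : {x y : D} → (m : Pro x y) → Cell (app x ⊙ G.mapPro m) (F.mapPro m ⊙ app y)
  left_nat : ∀ {x y : D} (m : Pro x y), left (nat m) = 𝟙 (F.obj x)
  right_nat : ∀ {x y : D} (m : Pro x y), right (nat m) = 𝟙 (G.obj y)
  nat_invertible : ∀ {x y : D} (m : Pro x y), IsInvertible (nat m)
  nat_cell : ∀ {x y w z : D} {m : Pro x y} {n : Pro w z} (α : Cell m n)
    (h : right (F.mapCell α) = left (map (right α))) (h' : right (map (left α)) = left (G.mapCell α)),
    nat m ≫ᵥ hcomp (F.mapCell α) (map (right α)) h = hcomp (map (left α)) (G.mapCell α) h' ≫ᵥ nat n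
  nat_comp : ∀ {x y z : D} (m : Pro x y) (n : Pro y z)
    (h₁ : right (cid (app x)) = left (G.comp m n))
    (h₂ : right (nat m) = left (cid (G.mapPro n))) (h₃ : right (cid (F.mapPro m)) = left (nat n))
    (h₄ : right (F.comp m n) = left (cid (app z))),
    hcomp (cid (app x)) (G.comp m n) h₁ ≫ᵥ nat (m ⊙ n) =
      assocInv (app x) (G.mapPro m) (G.mapPro n) ≫ᵥ hcomp (nat m) (cid (G.mapPro n)) h₂ ≫ᵥ
        assocHom (F.mapPro m) (app y) (G.mapPro n) ≫ᵥ hcomp (cid (F.mapPro m)) (nat n) h₃ ≫ᵥ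
          assocInv (F.mapPro m) (F.mapPro n) (app z) ≫ᵥ hcomp (F.comp m n) (cid (app z)) h₄
  nat_unit : ∀ (x : D) (h₁ : right (cid (app x)) = left (G.idn x))
    (h₂ : right (F.idn x) = left (cid (app x))),
    hcomp (cid (app x)) (G.idn x) h₁ ≫ᵥ nat (unit x) =
      runitHom (app x) ≫ᵥ lunitInv (app x) ≫ᵥ hcomp (F.idn x) (cid (app x)) h₂

namespace Protransformation

attribute [simp] left_map right_map map_id map_comp left_nat right_nat

variable {F G H K : LaxDoubleFunctor D E}

/-- The transformation between lax functors of bicategories given by a protransformation. -/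
def toLaxTrans (τ : Protransformation F G) :
    Lax.LaxTrans F.toLaxFunctor G.toLaxFunctor where
  app x := τ.app x.obj
  naturality m := GlobCell.mk (τ.nat m) (τ.left_nat m) (τ.right_nat m)
  naturality_naturality α := GlobCell.ext (by
    have e := τ.nat_cell α.val (by simp) (by simp)
    simp only [α.left_val, α.right_val, τ.map_id] at e
    exact e)
  naturality_id x := GlobCell.ext (τ.nat_unit x.obj (by simp) (by simp))
  naturality_comp m n := GlobCell.ext (τ.nat_comp m n (by simp) (by simp) (by simp) (by simp))

end Protransformation

theorem DoubleCategory.IsInvertible.vcomp {x y x' y' x'' y'' : E} {m : Pro x y} {n : Pro x' y'} {k : Pro x'' y''}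
    {α : Cell m n} {β : Cell n k} (hα : IsInvertible α) (hβ : IsInvertible β) :
    IsInvertible (α ≫ᵥ β) := by
  obtain ⟨α', h₁, h₂⟩ := hα
  obtain ⟨β', h₃, h₄⟩ := hβ
  refine ⟨β' ≫ᵥ α', ?_, ?_⟩
  · rw [vcomp_assoc, ← vcomp_assoc β, h₃, cid_vcomp, h₁]
  · rw [vcomp_assoc, ← vcomp_assoc α', h₂, cid_vcomp, h₄]

theorem DoubleCategory.IsInvertible.whiskL {x y z : E} (m : Pro x y) {n n' : Pro y z} {α : Cell n n'}
    (hα : IsInvertible α) (h : right (cid m) = left α) :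
    IsInvertible (hcomp (cid m) α h) := by
  obtain ⟨α', h₁, h₂⟩ := hα
  have h' : right (cid m) = left α' := by
    rw [left_eq_id_of_inv h₁ (by rw [← h]; simp)]; simp
  refine ⟨hcomp (cid m) α' h', ?_, ?_⟩
  · rw [← hcomp_vcomp _ _ _ _ _ _ (by simp [← h, ← h'])]
    simp [h₁]
  · rw [← hcomp_vcomp _ _ _ _ _ _ (by simp [← h, ← h'])]
    simp [h₂]

theorem DoubleCategory.IsInvertible.whiskR {x y z : E} {m m' : Pro x y} {α : Cell m m'} (n : Pro y z)
    (hα : IsInvertible α) (h : right α = left (cid n)) :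
    IsInvertible (hcomp α (cid n) h) := by
  obtain ⟨α', h₁, h₂⟩ := hα
  have h' : right α' = left (cid n) := by
    rw [right_eq_id_of_inv h₁ (by rw [h]; simp)]; simp
  refine ⟨hcomp α' (cid n) h', ?_, ?_⟩
  · rw [← hcomp_vcomp _ _ _ _ _ _ (by simp [h, h'])]
    simp [h₁]
  · rw [← hcomp_vcomp _ _ _ _ _ _ (by simp [h, h'])]
    simp [h₂]

theorem isInvertible_assocHom {x y z t : E} (m : Pro x y) (n : Pro y z) (k : Pro z t) :
    IsInvertible (assocHom m n k) := ⟨_, assocHom_inv m n k, assocInv_hom m n k⟩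

theorem isInvertible_assocInv {x y z t : E} (m : Pro x y) (n : Pro y z) (k : Pro z t) :
    IsInvertible (assocInv m n k) := ⟨_, assocInv_hom m n k, assocHom_inv m n k⟩

/-- Pasting of two squares of cells along their common side. -/
theorem paste_squares {x₁ x₂ x₃ y₁ y₂ y₃ w₁ w₂ w₃ z₁ z₂ z₃ : E}
    {f : Pro x₁ y₁} {g : Pro x₂ y₂} {k : Pro x₃ y₃} {q : Pro x₁ x₂} {r : Pro x₂ x₃}
    {q' : Pro y₁ y₂} {r' : Pro y₂ y₃}
    {F : Pro w₁ z₁} {G : Pro w₂ z₂} {K : Pro w₃ z₃} {Q : Pro w₁ w₂} {R : Pro w₂ w₃}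
    {Q' : Pro z₁ z₂} {R' : Pro z₂ z₃}
    {s : Cell (q ⊙ g) (f ⊙ q')} {S : Cell (Q ⊙ G) (F ⊙ Q')}
    {t : Cell (r ⊙ k) (g ⊙ r')} {T : Cell (R ⊙ K) (G ⊙ R')}
    {a : Cell f F} {b : Cell g G} {c : Cell k K} {μ : Cell q Q} {ν : Cell r R}
    {μ' : Cell q' Q'} {ν' : Cell r' R'}
    {h₁ : right a = left μ'} {h₂ : right μ = left b} {h₃ : right b = left ν'}
    {h₄ : right ν = left c}
    (hs : s ≫ᵥ hcomp a μ' h₁ = hcomp μ b h₂ ≫ᵥ S) (ht : t ≫ᵥ hcomp b ν' h₃ = hcomp ν c h₄ ≫ᵥ T)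
    (hμ : right μ = left ν) (hμ' : right μ' = left ν')
    (ls : right (cid q) = left t) (lS : right (cid Q) = left T)
    (rs : right s = left (cid r')) (rS : right S = left (cid R'))
    (e₁ : right a = left (hcomp μ' ν' hμ')) (e₂ : right (hcomp μ ν hμ) = left c)
    (e₃ : right (hcomp μ b h₂) = left ν') (e₄ : right μ = left (hcomp ν c h₄)) :
    (assocHom q r k ≫ᵥ hcomp (cid q) t ls ≫ᵥ assocInv q g r' ≫ᵥ hcomp s (cid r') rs ≫ᵥ
      assocHom f q' r') ≫ᵥ hcomp a (hcomp μ' ν' hμ') e₁ =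
    hcomp (hcomp μ ν hμ) c e₂ ≫ᵥ (assocHom Q R K ≫ᵥ hcomp (cid Q) T lS ≫ᵥ assocInv Q G R' ≫ᵥ
      hcomp S (cid R') rS ≫ᵥ assocHom F Q' R') := by
  have a₁ := assoc_naturality a μ' ν' h₁ hμ' (by simp [hμ']) e₁
  have a₂ := assoc_naturality μ b ν' h₂ h₃ e₃ (by simp [h₂])
  have a₃ := assoc_naturality μ ν c hμ h₄ e₂ e₄
  have b₁ := hcomp_vcomp s (cid r') (hcomp a μ' h₁) ν' rs (by simp [hμ'])
    (by simpa [rs] using hμ')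
  have b₂ := hcomp_vcomp (hcomp μ b h₂) ν' S (cid R') e₃ rS (by simp [h₃, rS])
  have b₃ := hcomp_vcomp (cid q) t μ (hcomp b ν' h₃) ls (by simp [h₂]) (by simp [← ls, h₂])
  have b₄ := hcomp_vcomp μ (hcomp ν c h₄) (cid Q) T e₄ lS (by simp [hμ, ← lS])
  have a₂' : assocInv _ _ _ ≫ᵥ hcomp (hcomp μ b h₂) ν' e₃ =
      hcomp μ (hcomp b ν' h₃) (by simp [h₂]) ≫ᵥ assocInv _ _ _ := by
    have := congrArg (fun t => assocInv _ _ _ ≫ᵥ t ≫ᵥ assocInv _ _ _) a₂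
    simp only [vcomp_assoc, assocHom_inv, vcomp_cid] at this
    rw [← vcomp_assoc (assocInv _ _ _) (assocHom _ _ _), assocInv_hom, cid_vcomp] at this
    exact this
  simp only [cid_vcomp, vcomp_cid, hs, ht] at b₁ b₂ b₃ b₄
  simp only [vcomp_assoc]
  rw [← a₁, ← vcomp_assoc _ _ (assocHom _ _ _), ← b₁, b₂, vcomp_assoc,
    ← vcomp_assoc (assocInv _ _ _), a₂', vcomp_assoc, ← vcomp_assoc _ _ (assocInv _ _ _ ≫ᵥ _),
    ← b₃, b₄, vcomp_assoc, ← vcomp_assoc, ← a₃, vcomp_assoc]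

namespace Protransformation

variable {F G H K : LaxDoubleFunctor D E}

/-- The identity protransformation. -/
def idn (F : LaxDoubleFunctor D E) : Protransformation F F where
  app x := unit (F.obj x)
  map f := unitCell (F.map f)
  left_map f := by simp
  right_map f := by simp
  map_id x := by simp
  map_comp f g := by simp [unitCell_comp]
  nat m := lunitHom (F.mapPro m) ≫ᵥ runitInv (F.mapPro m)
  left_nat m := by simp
  right_nat m := by simp
  nat_invertible m := IsInvertible.vcomp ⟨_, lunitHom_inv _, lunitInv_hom _⟩
    ⟨_, runitInv_hom _, runitHom_inv _⟩
  nat_cell {x y w z m n} α h h' := by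
    have e₁ := runit_naturality (F.mapCell α) (by simp)
    have e₂ := lunit_naturality (F.mapCell α) (by simp)
    have e₃ := congrArg (fun t => runitInv _ ≫ᵥ t ≫ᵥ runitInv _) e₁
    simp only [F.left_mapCell, F.right_mapCell] at e₁ e₂ e₃
    simp only [vcomp_assoc, runitHom_inv, vcomp_cid] at e₃
    rw [← vcomp_assoc (runitInv _) (runitHom _), runitInv_hom, cid_vcomp] at e₃
    rw [vcomp_assoc, e₃, ← vcomp_assoc, ← e₂, vcomp_assoc]
  nat_comp m n h₁ h₂ h₃ h₄ := congrArg GlobCell.val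
    ((Lax.LaxTrans.id F.toLaxFunctor).naturality_comp (a := ⟨_⟩) (b := ⟨_⟩) (c := ⟨_⟩) m n)
  nat_unit x h₁ h₂ := congrArg GlobCell.val
    ((Lax.LaxTrans.id F.toLaxFunctor).naturality_id ⟨x⟩)

/-- The composite of protransformations. -/
def comp (σ : Protransformation F G) (τ : Protransformation G H) : Protransformation F H where
  app x := σ.app x ⊙ τ.app x
  map f := hcomp (σ.map f) (τ.map f) (by simp)
  left_map f := by simp
  right_map f := by simp
  map_id x := by simp
  map_comp f g := by
    rw [← hcomp_vcomp _ _ _ _ _ _ (by simp)]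
    simp
  nat {x y} m := assocHom (σ.app x) (τ.app x) (H.mapPro m) ≫ᵥ
    hcomp (cid (σ.app x)) (τ.nat m) (by simp) ≫ᵥ
      assocInv (σ.app x) (G.mapPro m) (τ.app y) ≫ᵥ
        hcomp (σ.nat m) (cid (τ.app y)) (by simp) ≫ᵥ
          assocHom (F.mapPro m) (σ.app y) (τ.app y)
  left_nat m := by simp
  right_nat m := by simp
  nat_invertible {x y} m := (isInvertible_assocHom _ _ _).vcomp
    (((τ.nat_invertible m).whiskL _ _).vcomp ((isInvertible_assocInv _ _ _).vcomp
      (((σ.nat_invertible m).whiskR _ _).vcomp (isInvertible_assocHom _ _ _))))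
  nat_cell {x y w z m n} α h h' := (paste_squares (σ.nat_cell α (by simp) (by simp))
    (τ.nat_cell α (by simp) (by simp)) (by simp) (by simp) (by simp) (by simp) (by simp) (by simp)
    (by simp) (by simp) (by simp) (by simp))
  nat_comp m n h₁ h₂ h₃ h₄ := congrArg GlobCell.val
    ((σ.toLaxTrans.vComp τ.toLaxTrans).naturality_comp (a := ⟨_⟩) (b := ⟨_⟩) (c := ⟨_⟩) m n)
  nat_unit x h₁ h₂ := congrArg GlobCell.val
    ((σ.toLaxTrans.vComp τ.toLaxTrans).naturality_id ⟨x⟩)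

end Protransformation

end LaxPs

section BicategoryLemmas

open Bicategory

variable {B : Type u} [Bicategory.{p, v} B]

theorem bicat_assoc_lemma {x₁ x₂ x₃ x₄ y₁ y₂ y₃ y₄ : B} {f : x₁ ⟶ y₁} {g : x₂ ⟶ y₂} {h : x₃ ⟶ y₃}
    {k : x₄ ⟶ y₄} {q : x₁ ⟶ x₂} {r : x₂ ⟶ x₃} {t : x₃ ⟶ x₄} {q' : y₁ ⟶ y₂} {r' : y₂ ⟶ y₃}
    {t' : y₃ ⟶ y₄} (σ : q ≫ g ⟶ f ≫ q') (τ : r ≫ h ⟶ g ≫ r') (ρ : t ≫ k ⟶ h ≫ t') :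
    (α_ q r t).hom ▷ k ≫ (α_ q (r ≫ t) k).hom ≫
      q ◁ ((α_ r t k).hom ≫ r ◁ ρ ≫ (α_ r h t').inv ≫ τ ▷ t' ≫ (α_ g r' t').hom) ≫
      (α_ q g (r' ≫ t')).inv ≫ σ ▷ (r' ≫ t') ≫ (α_ f q' (r' ≫ t')).hom =
    ((α_ (q ≫ r) t k).hom ≫ (q ≫ r) ◁ ρ ≫ (α_ (q ≫ r) h t').inv ≫
      ((α_ q r h).hom ≫ q ◁ τ ≫ (α_ q g r').inv ≫ σ ▷ r' ≫ (α_ f q' r').hom) ▷ t' ≫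
      (α_ f (q' ≫ r') t').hom) ≫ f ◁ (α_ q' r' t').hom := by
  bicategory

theorem bicat_lunit_lemma {x₁ x₂ y₁ y₂ : B} {f : x₁ ⟶ y₁} {g : x₂ ⟶ y₂} {q : x₁ ⟶ x₂}
    {q' : y₁ ⟶ y₂} (σ : q ≫ g ⟶ f ≫ q') :
    (λ_ q).hom ▷ g ≫ σ =
      ((α_ (𝟙 x₁) q g).hom ≫ (𝟙 x₁) ◁ σ ≫ (α_ (𝟙 x₁) f q').inv ≫
        ((λ_ f).hom ≫ (ρ_ f).inv) ▷ q' ≫ (α_ f (𝟙 y₁) q').hom) ≫ f ◁ (λ_ q').hom := by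
  bicategory

theorem bicat_runit_lemma {x₁ x₂ y₁ y₂ : B} {f : x₁ ⟶ y₁} {g : x₂ ⟶ y₂} {q : x₁ ⟶ x₂}
    {q' : y₁ ⟶ y₂} (σ : q ≫ g ⟶ f ≫ q') :
    (ρ_ q).hom ▷ g ≫ σ =
      ((α_ q (𝟙 x₂) g).hom ≫ q ◁ ((λ_ g).hom ≫ (ρ_ g).inv) ≫ (α_ q g (𝟙 y₂)).inv ≫
        σ ▷ (𝟙 y₂) ≫ (α_ f q' (𝟙 y₂)).hom) ≫ f ◁ (ρ_ q').hom := by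
  bicategory

end BicategoryLemmas

section LaxPs

variable {D : Type u₁} [DoubleCategory.{u₁, v₁, p₁, c₁} D]
  {E : Type u₂} [DoubleCategory.{u₂, v₂, p₂, c₂} E]

/-- A modification between protransformations, bounded by natural transformations. -/
@[ext]
structure Modification {F G H K : LaxDoubleFunctor D E} (σ : Protransformation F G)
    (τ : Protransformation H K) where
  src : F ⟶ H
  tgt : G ⟶ K
  app : (x : D) → Cell (σ.app x) (τ.app x)
  left_app : ∀ x : D, left (app x) = DoubleNatTrans.app src x
  right_app : ∀ x : D, right (app x) = DoubleNatTrans.app tgt x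
  app_map : ∀ {x y : D} (f : x ⟶ y), app x ≫ᵥ τ.map f = σ.map f ≫ᵥ app y
  app_nat : ∀ {x y : D} (m : Pro x y) (h : right (app x) = left (DoubleNatTrans.cell tgt m))
    (h' : right (DoubleNatTrans.cell src m) = left (app y)),
    hcomp (app x) (DoubleNatTrans.cell tgt m) h ≫ᵥ τ.nat m =
      σ.nat m ≫ᵥ hcomp (DoubleNatTrans.cell src m) (app y) h'

namespace Modification

attribute [simp] left_app right_app

variable {F G H K : LaxDoubleFunctor D E}

/-- The inverse of a modification with identity boundaries and invertible components. -/
def inverse {σ τ : Protransformation F G} (μ : Modification σ τ) (hs : μ.src = 𝟙 F)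
    (ht : μ.tgt = 𝟙 G) (ν : ∀ x, Cell (τ.app x) (σ.app x)) (h₁ : ∀ x, μ.app x ≫ᵥ ν x = cid _)
    (h₂ : ∀ x, ν x ≫ᵥ μ.app x = cid _) : Modification τ σ where
  src := 𝟙 F
  tgt := 𝟙 G
  app := ν
  left_app x := left_eq_id_of_inv (h₁ x) (by rw [left_app, hs]; rfl)
  right_app x := right_eq_id_of_inv (h₁ x) (by rw [right_app, ht]; rfl)
  app_map {x y} f := by
    have := congrArg (fun t => ν x ≫ᵥ t ≫ᵥ ν y) (μ.app_map f)
    simp only [vcomp_assoc, h₁, vcomp_cid] at this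
    rw [← vcomp_assoc (ν x) (μ.app x), h₂, cid_vcomp] at this
    exact this.symm
  app_nat {x y} m h h' := by
    have e := μ.app_nat m (by simp) (by simp)
    have hx : right (μ.app x) = left (cid (G.mapPro m)) := by
      rw [right_app, ht, left_cid]; rfl
    have hy : right (cid (F.mapPro m)) = left (μ.app y) := by
      rw [left_app, hs, right_cid]; rfl
    have e' : hcomp (μ.app x) (cid (G.mapPro m)) hx ≫ᵥ τ.nat m =
        σ.nat m ≫ᵥ hcomp (cid (F.mapPro m)) (μ.app y) hy := by
      simpa only [hs, ht, laxDoubleFunctor_id_cell] using e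
    simp only [laxDoubleFunctor_id_cell] at h h' ⊢
    have i₁ := hcomp_vcomp (ν x) (cid (G.mapPro m)) (μ.app x) (cid (G.mapPro m)) h hx
      (by simp [h₂])
    have i₂ := hcomp_vcomp (cid (F.mapPro m)) (μ.app y) (cid (F.mapPro m)) (ν y) hy h'
      (by simp [h₁])
    simp only [h₁, h₂, cid_vcomp, hcomp_cid] at i₁ i₂
    have := congrArg (fun t => hcomp (ν x) (cid (G.mapPro m)) h ≫ᵥ t ≫ᵥ
      hcomp (cid (F.mapPro m)) (ν y) h') e'
    simp only [vcomp_assoc, ← i₂, vcomp_cid] at this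
    rw [← vcomp_assoc _ (hcomp (μ.app x) _ _), ← i₁, cid_vcomp] at this
    exact this.symm

/-- The identity modification. -/
def cid (σ : Protransformation F G) : Modification σ σ where
  src := 𝟙 F
  tgt := 𝟙 G
  app x := DoubleCategory.cid (σ.app x)
  left_app x := by simp
  right_app x := by simp
  app_map f := by simp
  app_nat m h h' := by simp

/-- The vertical composite of modifications. -/
def vcomp {F' G' F'' G'' : LaxDoubleFunctor D E} {σ : Protransformation F G}
    {τ : Protransformation F' G'} {ρ : Protransformation F'' G''} (μ : Modification σ τ)
    (ν : Modification τ ρ) : Modification σ ρ where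
  src := μ.src ≫ ν.src
  tgt := μ.tgt ≫ ν.tgt
  app x := μ.app x ≫ᵥ ν.app x
  left_app x := by simp
  right_app x := by simp
  app_map f := by
    rw [vcomp_assoc, ν.app_map, ← vcomp_assoc, μ.app_map, vcomp_assoc]
  app_nat m h h' := by
    have i₁ := hcomp_vcomp (μ.app _) (DoubleNatTrans.cell μ.tgt m) (ν.app _)
      (DoubleNatTrans.cell ν.tgt m) (by simp) (by simp) h
    have i₂ := hcomp_vcomp (DoubleNatTrans.cell μ.src m) (μ.app _)
      (DoubleNatTrans.cell ν.src m) (ν.app _) (by simp) (by simp) h'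
    simp only [laxDoubleFunctor_comp_cell]
    rw [i₁, i₂, vcomp_assoc, ν.app_nat, ← vcomp_assoc, μ.app_nat, vcomp_assoc]

/-- The external identity modification on a natural transformation. -/
def unitCell (α : F ⟶ G) : Modification (Protransformation.idn F) (Protransformation.idn G) where
  src := α
  tgt := α
  app x := DoubleCategory.unitCell (DoubleNatTrans.app α x)
  left_app x := left_unitCell _
  right_app x := right_unitCell _
  app_map f := by
    change DoubleCategory.unitCell _ ≫ᵥ DoubleCategory.unitCell _ =
      DoubleCategory.unitCell _ ≫ᵥ DoubleCategory.unitCell _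
    rw [← unitCell_comp, ← unitCell_comp, DoubleNatTrans.naturality α f]
  app_nat {x y} m h h' := by
    have e₁ := lunit_naturality (DoubleNatTrans.cell α m) (by simp)
    have e₂ := runit_naturality (DoubleNatTrans.cell α m) (by simp)
    have e₃ := congrArg (fun t => runitInv _ ≫ᵥ t ≫ᵥ runitInv _) e₂
    simp only [DoubleNatTrans.left_cell, DoubleNatTrans.right_cell] at e₁ e₃
    simp only [vcomp_assoc, runitHom_inv, vcomp_cid] at e₃
    rw [← vcomp_assoc (runitInv _) (runitHom _), runitInv_hom, cid_vcomp] at e₃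
    have e₄ := congrArg (fun t => t ≫ᵥ runitInv _) e₁
    have e₅ := congrArg (fun t => lunitHom _ ≫ᵥ t) e₃
    simp only [vcomp_assoc] at e₄ e₅
    exact (e₄.trans e₅.symm).trans (vcomp_assoc _ _ _).symm

/-- The horizontal composite of modifications. -/
def hcomp {H' F₁ G₁ : LaxDoubleFunctor D E} {σ : Protransformation F G}
    {τ : Protransformation G H} {σ' : Protransformation F₁ G₁} {τ' : Protransformation G₁ H'}
    (μ : Modification σ σ') (ν : Modification τ τ') (hμν : μ.tgt = ν.src) :
    Modification (σ.comp τ) (σ'.comp τ') where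
  src := μ.src
  tgt := ν.tgt
  app x := DoubleCategory.hcomp (μ.app x) (ν.app x) (by rw [μ.right_app, ν.left_app, hμν])
  left_app x := (left_hcomp _ _ _).trans (μ.left_app x)
  right_app x := (right_hcomp _ _ _).trans (ν.right_app x)
  app_map f := by
    have e : right (σ.map f ≫ᵥ μ.app _) = left (τ.map f ≫ᵥ ν.app _) := by
      simp [hμν]
    have i₁ := hcomp_vcomp (μ.app _) (ν.app _) (σ'.map f) (τ'.map f)
      (by rw [μ.right_app, ν.left_app, hμν]) (by simp) (by rw [μ.app_map, ν.app_map]; exact e)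
    have i₂ := hcomp_vcomp (σ.map f) (τ.map f) (μ.app _) (ν.app _) (by simp)
      (by rw [μ.right_app, ν.left_app, hμν]) e
    simp only [μ.app_map, ν.app_map] at i₁
    exact i₁.symm.trans i₂
  app_nat {x y} m h h' := by
    have e₁ := (μ.app_nat m (by simp) (by simp)).symm
    have e₂ := (ν.app_nat m (by simp) (by simp)).symm
    simp only [hμν] at e₁
    exact (paste_squares e₁ e₂ (by simp [hμν]) (by simp [hμν]) (by simp) (by simp) (by simp)
      (by simp) (by simp) (by simp) (by simp) (by simp [hμν])).symm

/-- The associator modification. -/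
def assoc (σ : Protransformation F G) (τ : Protransformation G H) (ρ : Protransformation H K) :
    Modification ((σ.comp τ).comp ρ) (σ.comp (τ.comp ρ)) where
  src := 𝟙 F
  tgt := 𝟙 K
  app _ := assocHom _ _ _
  left_app _ := left_assocHom _ _ _
  right_app _ := right_assocHom _ _ _
  app_map _ := (assoc_naturality _ _ _ _ _ _ _).symm
  app_nat {x y} m _ _ := congrArg GlobCell.val
    ((bicat_assoc_lemma (B := UBicat E)
      (σ.toLaxTrans.naturality (a := ⟨x⟩) (b := ⟨y⟩) m)
      (τ.toLaxTrans.naturality (a := ⟨x⟩) (b := ⟨y⟩) m)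
      (ρ.toLaxTrans.naturality (a := ⟨x⟩) (b := ⟨y⟩) m)))

/-- The left unitor modification. -/
def lunit (σ : Protransformation F G) : Modification ((Protransformation.idn F).comp σ) σ where
  src := 𝟙 F
  tgt := 𝟙 G
  app x := lunitHom (σ.app x)
  left_app x := left_lunitHom _
  right_app x := right_lunitHom _
  app_map {x y} f := by
    have := lunit_naturality (σ.map f) (by simp)
    simp only [σ.left_map] at this
    exact this.symm
  app_nat {x y} m h h' := congrArg GlobCell.val
    (bicat_lunit_lemma (B := UBicat E) (σ.toLaxTrans.naturality (a := ⟨x⟩) (b := ⟨y⟩) m))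

/-- The right unitor modification. -/
def runit (σ : Protransformation F G) : Modification (σ.comp (Protransformation.idn G)) σ where
  src := 𝟙 F
  tgt := 𝟙 G
  app x := runitHom (σ.app x)
  left_app x := left_runitHom _
  right_app x := right_runitHom _
  app_map {x y} f := by
    have := runit_naturality (σ.map f) (by simp)
    simp only [σ.right_map] at this
    exact this.symm
  app_nat {x y} m h h' := congrArg GlobCell.val
    (bicat_runit_lemma (B := UBicat E) (σ.toLaxTrans.naturality (a := ⟨x⟩) (b := ⟨y⟩) m))

end Modification

/-- The double category of lax double functors, natural transformations, (pseudo)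
protransformations and modifications. -/
instance laxPs : DoubleCategory (LaxDoubleFunctor D E) where
  toCategory := laxDoubleFunctorCategory
  Pro F G := Protransformation F G
  Cell σ τ := Modification σ τ
  left μ := μ.src
  right μ := μ.tgt
  cid σ := Modification.cid σ
  vcomp μ ν := Modification.vcomp μ ν
  left_cid _ := rfl
  right_cid _ := rfl
  left_vcomp _ _ := rfl
  right_vcomp _ _ := rfl
  cid_vcomp μ := Modification.ext (Category.id_comp _) (Category.id_comp _)
    (funext fun _ => cid_vcomp _)
  vcomp_cid μ := Modification.ext (Category.comp_id _) (Category.comp_id _)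
    (funext fun _ => vcomp_cid _)
  vcomp_assoc μ ν ξ := Modification.ext (Category.assoc _ _ _) (Category.assoc _ _ _)
    (funext fun _ => vcomp_assoc _ _ _)
  unit F := Protransformation.idn F
  unitCell α := Modification.unitCell α
  left_unitCell _ := rfl
  right_unitCell _ := rfl
  unitCell_id F := Modification.ext rfl rfl (funext fun _ => unitCell_id _)
  unitCell_comp α β := Modification.ext rfl rfl (funext fun _ => unitCell_comp _ _)
  pcomp σ τ := σ.comp τ
  hcomp μ ν h := Modification.hcomp μ ν h
  left_hcomp _ _ _ := rfl
  right_hcomp _ _ _ := rfl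
  hcomp_cid σ τ h := Modification.ext rfl rfl (funext fun _ => hcomp_cid _ _ _)
  hcomp_vcomp _ _ _ _ _ _ _ := Modification.ext rfl rfl
    (funext fun _ => hcomp_vcomp _ _ _ _ _ _ _)
  assocHom σ τ ρ := Modification.assoc σ τ ρ
  assocInv σ τ ρ := (Modification.assoc σ τ ρ).inverse rfl rfl (fun _ => assocInv _ _ _)
    (fun _ => assocHom_inv _ _ _) (fun _ => assocInv_hom _ _ _)
  left_assocHom _ _ _ := rfl
  right_assocHom _ _ _ := rfl
  assocHom_inv _ _ _ := Modification.ext (Category.id_comp _) (Category.id_comp _)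
    (funext fun _ => assocHom_inv _ _ _)
  assocInv_hom _ _ _ := Modification.ext (Category.id_comp _) (Category.id_comp _)
    (funext fun _ => assocInv_hom _ _ _)
  assoc_naturality μ ν ξ h h' h₁ h₂ := Modification.ext
    ((Category.comp_id _).trans (Category.id_comp _).symm)
    ((Category.comp_id _).trans (Category.id_comp _).symm)
    (funext fun _ => assoc_naturality _ _ _ _ _ _ _)
  lunitHom σ := Modification.lunit σ
  lunitInv σ := (Modification.lunit σ).inverse rfl rfl (fun _ => lunitInv _)
    (fun _ => lunitHom_inv _) (fun _ => lunitInv_hom _)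
  left_lunitHom _ := rfl
  right_lunitHom _ := rfl
  lunitHom_inv _ := Modification.ext (Category.id_comp _) (Category.id_comp _)
    (funext fun _ => lunitHom_inv _)
  lunitInv_hom _ := Modification.ext (Category.id_comp _) (Category.id_comp _)
    (funext fun _ => lunitInv_hom _)
  lunit_naturality μ h := Modification.ext
    ((Category.comp_id _).trans (Category.id_comp _).symm)
    ((Category.comp_id _).trans (Category.id_comp _).symm)
    (funext fun x => by
      have := lunit_naturality (μ.app x) (by simp)
      simp only [μ.left_app] at this
      exact this)
  runitHom σ := Modification.runit σ
  runitInv σ := (Modification.runit σ).inverse rfl rfl (fun _ => runitInv _)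
    (fun _ => runitHom_inv _) (fun _ => runitInv_hom _)
  left_runitHom _ := rfl
  right_runitHom _ := rfl
  runitHom_inv _ := Modification.ext (Category.id_comp _) (Category.id_comp _)
    (funext fun _ => runitHom_inv _)
  runitInv_hom _ := Modification.ext (Category.id_comp _) (Category.id_comp _)
    (funext fun _ => runitInv_hom _)
  runit_naturality μ h := Modification.ext
    ((Category.comp_id _).trans (Category.id_comp _).symm)
    ((Category.comp_id _).trans (Category.id_comp _).symm)
    (funext fun x => by
      have := runit_naturality (μ.app x) (by simp)
      simp only [μ.right_app] at this
      exact this)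
  pentagon _ _ _ _ _ _ := Modification.ext
    (by change 𝟙 _ ≫ 𝟙 _ ≫ 𝟙 _ = 𝟙 _ ≫ 𝟙 _; simp) (by change 𝟙 _ ≫ 𝟙 _ ≫ 𝟙 _ = 𝟙 _ ≫ 𝟙 _; simp)
    (funext fun _ => pentagon _ _ _ _ _ _)
  triangle _ _ _ _ := Modification.ext (Category.id_comp _) (Category.id_comp _)
    (funext fun _ => triangle _ _ _ _)

end LaxPs

section Coproducts

/-- The two kinds of index sets: finite sets, or arbitrary (small) sets. -/
inductive IndexSize
  | finite
  | small

/-- `s.Admits I`: the set `I` is allowed as an index set. -/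
class IndexSize.Admits (s : IndexSize) (I : Type w) : Prop where
  finite_of_eq : s = IndexSize.finite → Finite I

instance IndexSize.admits_prod (s : IndexSize) (I J : Type w) [s.Admits I] [s.Admits J] :
    s.Admits (I × J) where
  finite_of_eq h := by
    have := IndexSize.Admits.finite_of_eq (I := I) h
    have := IndexSize.Admits.finite_of_eq (I := J) h
    infer_instance

instance IndexSize.admits_subtype (s : IndexSize) (I : Type w) [s.Admits I] (P : I → Prop) :
    s.Admits {i // P i} where
  finite_of_eq h := by
    have := IndexSize.Admits.finite_of_eq (I := I) h
    infer_instance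

variable {D : Type u} [DoubleCategory.{u, v, p, c} D]

/-- A family of proarrows `m_a : x_{l a} ⇸ y_{r a}` indexed by a span `I ← A → J`, where `x` and
`y` are families of objects indexed by `I` and `J`. -/
structure SpanFamily {I J : Type w} (x : I → D) (y : J → D) where
  apex : Type w
  l : apex → I
  r : apex → J
  pro : ∀ a, Pro (x (l a)) (y (r a))

/-- The family `m : x ⇸ y` of proarrows over a common index set, indexed by the identity span. -/
@[reducible]
def SpanFamily.parallel {I : Type w} {x y : I → D} (m : ∀ i, Pro (x i) (y i)) : SpanFamily x y where
  apex := I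
  l := id
  r := id
  pro := m

/-- The family of identity proarrows, indexed by the identity span. -/
@[reducible]
def SpanFamily.unit {I : Type w} (x : I → D) : SpanFamily x x :=
  SpanFamily.parallel fun i => DoubleCategory.unit (x i)

/-- Transport of a proarrow along an equality of source objects. -/
def castSrc {y y' z : D} (h : y = y') (n : Pro y z) : Pro y' z := h ▸ n

/-- Transport of a cell along an equality of source objects of its top proarrow. -/
def castSrcCell {y y' z w t : D} (h : y = y') {n : Pro y z} {k : Pro w t} (α : Cell n k) :
    Cell (castSrc h n) k :=
  Eq.rec (motive := fun _ h => Cell (castSrc h n) k) α h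

theorem left_castSrcCell {y y' z w t : D} (h : y = y') {n : Pro y z} {k : Pro w t}
    (α : Cell n k) : left (castSrcCell h α) = eqToHom h.symm ≫ left α := by
  subst h; simp [castSrcCell]; rfl

theorem right_castSrcCell {y y' z w t : D} (h : y = y') {n : Pro y z} {k : Pro w t}
    (α : Cell n k) : right (castSrcCell h α) = right α := by
  subst h; rfl

/-- The composite of span-indexed families of proarrows: the family of composites `m_a ⊙ n_b`,
indexed by the composite span, whose apex is the pullback. -/
@[reducible]
def SpanFamily.comp {I J K : Type w} {x : I → D} {y : J → D} {z : K → D} (m : SpanFamily x y)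
    (n : SpanFamily y z) : SpanFamily x z where
  apex := {q : m.apex × n.apex // m.r q.1 = n.l q.2}
  l q := m.l q.1.1
  r q := n.r q.1.2
  pro q := m.pro q.1.1 ⊙ castSrc (congrArg y q.2.symm) (n.pro q.1.2)

/-- A cell from a span-indexed family of proarrows to a single proarrow `n : t ⇸ t'`: arrows out of
the source and target families together with compatible cells `m_a → n`. -/
structure SpanCocone {I J : Type w} {x : I → D} {y : J → D} (m : SpanFamily x y) {t t' : D}
    (n : Pro t t') where
  fst : ∀ i, x i ⟶ t
  snd : ∀ j, y j ⟶ t'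
  cell : ∀ a, Cell (m.pro a) n
  left_cell : ∀ a, left (cell a) = fst (m.l a)
  right_cell : ∀ a, right (cell a) = snd (m.r a)

/-- (Colax) coproducts in a double category: chosen coproducts of families of objects and of
span-indexed families of proarrows, with their universal properties. This is a choice of universal
arrows from the families of objects and from the span-indexed families of proarrows (the objects
and proarrows of the double category of families in `D`) to the diagonal `D → DblFam D`, compatible
with sources and targets; that is, a (colax) left adjoint of the diagonal. -/
structure DoubleCoproducts (s : IndexSize) (D : Type u) [DoubleCategory.{u, v, p, c} D] where
  obj : {I : Type w} → [s.Admits I] → (I → D) → D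
  ι : {I : Type w} → [s.Admits I] → (x : I → D) → (i : I) → (x i ⟶ obj x)
  desc : {I : Type w} → [s.Admits I] → {x : I → D} → {t : D} → (∀ i, x i ⟶ t) → (obj x ⟶ t)
  ι_desc : ∀ {I : Type w} [s.Admits I] {x : I → D} {t : D} (f : ∀ i, x i ⟶ t) (i : I),
    ι x i ≫ desc f = f i
  hom_ext : ∀ {I : Type w} [s.Admits I] {x : I → D} {t : D} (f g : obj x ⟶ t),
    (∀ i, ι x i ≫ f = ι x i ≫ g) → f = g
  pro : {I J : Type w} → [s.Admits I] → [s.Admits J] → {x : I → D} → {y : J → D} →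
    (m : SpanFamily x y) → [s.Admits m.apex] → Pro (obj x) (obj y)
  ιCell : {I J : Type w} → [s.Admits I] → [s.Admits J] → {x : I → D} → {y : J → D} →
    (m : SpanFamily x y) → [s.Admits m.apex] → (a : m.apex) → Cell (m.pro a) (pro m)
  left_ιCell : ∀ {I J : Type w} [s.Admits I] [s.Admits J] {x : I → D} {y : J → D}
    (m : SpanFamily x y) [s.Admits m.apex] (a : m.apex), left (ιCell m a) = ι x (m.l a)
  right_ιCell : ∀ {I J : Type w} [s.Admits I] [s.Admits J] {x : I → D} {y : J → D}
    (m : SpanFamily x y) [s.Admits m.apex] (a : m.apex), right (ιCell m a) = ι y (m.r a)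
  descCell : {I J : Type w} → [s.Admits I] → [s.Admits J] → {x : I → D} → {y : J → D} →
    {m : SpanFamily x y} → [s.Admits m.apex] → {t t' : D} → {n : Pro t t'} →
    SpanCocone m n → Cell (pro m) n
  left_descCell : ∀ {I J : Type w} [s.Admits I] [s.Admits J] {x : I → D} {y : J → D}
    {m : SpanFamily x y} [s.Admits m.apex] {t t' : D} {n : Pro t t'} (γ : SpanCocone m n),
    left (descCell γ) = desc γ.fst
  right_descCell : ∀ {I J : Type w} [s.Admits I] [s.Admits J] {x : I → D} {y : J → D}
    {m : SpanFamily x y} [s.Admits m.apex] {t t' : D} {n : Pro t t'} (γ : SpanCocone m n),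
    right (descCell γ) = desc γ.snd
  ιCell_descCell : ∀ {I J : Type w} [s.Admits I] [s.Admits J] {x : I → D} {y : J → D}
    {m : SpanFamily x y} [s.Admits m.apex] {t t' : D} {n : Pro t t'} (γ : SpanCocone m n)
    (a : m.apex), ιCell m a ≫ᵥ descCell γ = γ.cell a
  cell_ext : ∀ {I J : Type w} [s.Admits I] [s.Admits J] {x : I → D} {y : J → D}
    {m : SpanFamily x y} [s.Admits m.apex] {t t' : D} {n : Pro t t'} (α β : Cell (pro m) n),
    left α = left β → right α = right β → (∀ a, ιCell m a ≫ᵥ α = ιCell m a ≫ᵥ β) → α = β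

namespace DoubleCoproducts

attribute [simp] ι_desc left_ιCell right_ιCell left_descCell right_descCell ιCell_descCell

variable {s : IndexSize} (S : DoubleCoproducts.{w} s D)

theorem desc_ι {I : Type w} [s.Admits I] (x : I → D) : S.desc (S.ι x) = 𝟙 (S.obj x) :=
  S.hom_ext _ _ fun i => by simp

theorem eqToHom_ι {I : Type w} [s.Admits I] (x : I → D) {i i' : I} (h : i = i') :
    eqToHom (congrArg x h) ≫ S.ι x i' = S.ι x i := by
  subst h; simp

section

variable {I J K : Type w} [s.Admits I] [s.Admits J] [s.Admits K] {x : I → D} {y : J → D}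
  {z : K → D}

/-- The comparison cell `Σ (m ⊙ n) → Σ m ⊙ Σ n` induced by the universal property. -/
def compComparison (m : SpanFamily x y) (n : SpanFamily y z) [s.Admits m.apex]
    [s.Admits n.apex] : Cell (S.pro (m.comp n)) (S.pro m ⊙ S.pro n) :=
  S.descCell
    { fst := S.ι x
      snd := S.ι z
      cell q := hcomp (S.ιCell m q.1.1)
        (castSrcCell (congrArg y q.2.symm) (S.ιCell n q.1.2)) (by
          refine (S.right_ιCell m q.1.1).trans (Eq.trans ?_ (left_castSrcCell _ _).symm)
          rw [S.left_ιCell]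
          exact (S.eqToHom_ι y q.2).symm)
      left_cell q := by rw [left_hcomp, S.left_ιCell]
      right_cell q := by rw [right_hcomp, right_castSrcCell, S.right_ιCell] }

theorem ι_compComparison (m : SpanFamily x y) (n : SpanFamily y z) [s.Admits m.apex]
    [s.Admits n.apex] (q : (m.comp n).apex) :
    S.ιCell (m.comp n) q ≫ᵥ S.compComparison m n = hcomp (S.ιCell m q.1.1)
      (castSrcCell (congrArg y q.2.symm) (S.ιCell n q.1.2)) (by
        refine (S.right_ιCell m q.1.1).trans (Eq.trans ?_ (left_castSrcCell _ _).symm)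
        rw [S.left_ιCell]
        exact (S.eqToHom_ι y q.2).symm) := by
  rw [compComparison, ιCell_descCell]

/-- The comparison cell `Σ id_x → id_{Σ x}` induced by the universal property. -/
def unitComparison (x : I → D) : Cell (S.pro (SpanFamily.unit x)) (unit (S.obj x)) :=
  S.descCell
    { fst := S.ι x
      snd := S.ι x
      cell i := unitCell (S.ι x i)
      left_cell _ := left_unitCell _
      right_cell _ := right_unitCell _ }

end

end DoubleCoproducts

/-- Strong coproducts in a double category: coproducts that commute with external composition and
external identities, in that all comparison cells are invertible. Equivalently, the left adjoint
of the diagonal is a (pseudo) double functor. For `s = IndexSize.finite`, the index sets and the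
apexes of the spans are finite. -/
structure StrongCoproducts (s : IndexSize) (D : Type u) [DoubleCategory.{u, v, p, c} D] extends
    DoubleCoproducts.{w} s D where
  comp_invertible : ∀ {I J K : Type w} [s.Admits I] [s.Admits J] [s.Admits K] {x : I → D}
    {y : J → D} {z : K → D} (m : SpanFamily x y) (n : SpanFamily y z) [s.Admits m.apex]
    [s.Admits n.apex], IsInvertible (toDoubleCoproducts.compComparison m n)
  unit_invertible : ∀ {I : Type w} [s.Admits I] (x : I → D),
    IsInvertible (toDoubleCoproducts.unitComparison x)

/-- The inverse of an invertible cell. -/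
noncomputable def DoubleCategory.IsInvertible.inv {x y x' y' : D} {m : Pro x y} {n : Pro x' y'}
    {α : Cell m n} (h : IsInvertible α) : Cell n m := h.choose

theorem DoubleCategory.IsInvertible.hom_inv {x y x' y' : D} {m : Pro x y} {n : Pro x' y'}
    {α : Cell m n} (h : IsInvertible α) : α ≫ᵥ h.inv = cid m := h.choose_spec.1

theorem DoubleCategory.IsInvertible.inv_hom {x y x' y' : D} {m : Pro x y} {n : Pro x' y'}
    {α : Cell m n} (h : IsInvertible α) : h.inv ≫ᵥ α = cid n := h.choose_spec.2

namespace DoubleCoproducts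

variable {s : IndexSize} (S : DoubleCoproducts.{w} s D) {I J : Type w} [s.Admits I] [s.Admits J]

/-- The coproduct of a family of arrows. -/
def sigmaMap {x y : I → D} (f : ∀ i, x i ⟶ y i) : S.obj x ⟶ S.obj y :=
  S.desc fun i => f i ≫ S.ι y i

/-- The coproduct of a family of cells. -/
def sigmaCell {x y x' y' : I → D} {m : ∀ i, Pro (x i) (y i)} {n : ∀ i, Pro (x' i) (y' i)}
    (α : ∀ i, Cell (m i) (n i)) :
    Cell (S.pro (SpanFamily.parallel m)) (S.pro (SpanFamily.parallel n)) :=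
  S.descCell
    { fst i := left (α i) ≫ S.ι x' i
      snd i := right (α i) ≫ S.ι y' i
      cell i := α i ≫ᵥ S.ιCell (SpanFamily.parallel n) i
      left_cell i := by simp
      right_cell i := by simp }

/-- The comparison `Σ (m ⊙ n) → Σ m ⊙ Σ n` for parallel families of proarrows. -/
def sigmaDelta {x y z : I → D} (m : ∀ i, Pro (x i) (y i)) (n : ∀ i, Pro (y i) (z i)) :
    Cell (S.pro (SpanFamily.parallel fun i => m i ⊙ n i))
      (S.pro (SpanFamily.parallel m) ⊙ S.pro (SpanFamily.parallel n)) :=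
  S.descCell
    { fst := S.ι x
      snd := S.ι z
      cell i := hcomp (S.ιCell (SpanFamily.parallel m) i) (S.ιCell (SpanFamily.parallel n) i)
        (by simp)
      left_cell i := by simp
      right_cell i := by simp }

@[simp] theorem ι_sigmaMap {x y : I → D} (f : ∀ i, x i ⟶ y i) (i : I) :
    S.ι x i ≫ S.sigmaMap f = f i ≫ S.ι y i := S.ι_desc _ i

@[simp] theorem left_sigmaCell {x y x' y' : I → D} {m : ∀ i, Pro (x i) (y i)}
    {n : ∀ i, Pro (x' i) (y' i)} (α : ∀ i, Cell (m i) (n i)) :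
    left (S.sigmaCell α) = S.sigmaMap fun i => left (α i) := S.left_descCell _

@[simp] theorem right_sigmaCell {x y x' y' : I → D} {m : ∀ i, Pro (x i) (y i)}
    {n : ∀ i, Pro (x' i) (y' i)} (α : ∀ i, Cell (m i) (n i)) :
    right (S.sigmaCell α) = S.sigmaMap fun i => right (α i) := S.right_descCell _

@[simp] theorem ι_sigmaCell {x y x' y' : I → D} {m : ∀ i, Pro (x i) (y i)}
    {n : ∀ i, Pro (x' i) (y' i)} (α : ∀ i, Cell (m i) (n i)) (i : I) :
    S.ιCell (SpanFamily.parallel m) i ≫ᵥ S.sigmaCell α =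
      α i ≫ᵥ S.ιCell (SpanFamily.parallel n) i := by
  rw [sigmaCell, ιCell_descCell]

@[simp] theorem left_sigmaDelta {x y z : I → D} (m : ∀ i, Pro (x i) (y i))
    (n : ∀ i, Pro (y i) (z i)) : left (S.sigmaDelta m n) = 𝟙 (S.obj x) :=
  (S.left_descCell _).trans (S.desc_ι x)

@[simp] theorem right_sigmaDelta {x y z : I → D} (m : ∀ i, Pro (x i) (y i))
    (n : ∀ i, Pro (y i) (z i)) : right (S.sigmaDelta m n) = 𝟙 (S.obj z) :=
  (S.right_descCell _).trans (S.desc_ι z)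

theorem ι_sigmaDelta {x y z : I → D} (m : ∀ i, Pro (x i) (y i)) (n : ∀ i, Pro (y i) (z i))
    (i : I) : S.ιCell (SpanFamily.parallel fun i => m i ⊙ n i) i ≫ᵥ S.sigmaDelta m n =
      hcomp (S.ιCell (SpanFamily.parallel m) i) (S.ιCell (SpanFamily.parallel n) i) (by simp) := by
  rw [sigmaDelta, ιCell_descCell]

@[simp] theorem left_unitComparison (x : I → D) : left (S.unitComparison x) = 𝟙 (S.obj x) :=
  (S.left_descCell _).trans (S.desc_ι x)

@[simp] theorem right_unitComparison (x : I → D) : right (S.unitComparison x) = 𝟙 (S.obj x) :=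
  (S.right_descCell _).trans (S.desc_ι x)

theorem ι_unitComparison (x : I → D) (i : I) :
    S.ιCell (SpanFamily.unit x) i ≫ᵥ S.unitComparison x = unitCell (S.ι x i) := by
  rw [unitComparison, ιCell_descCell]

/-- A cell out of a parallel coproduct is determined by its boundary and its components. -/
theorem parallel_ext {x y : I → D} {m : ∀ i, Pro (x i) (y i)} {t t' : D} {n : Pro t t'}
    {α β : Cell (S.pro (SpanFamily.parallel m)) n} (h : ∀ i, S.ιCell (SpanFamily.parallel m) i ≫ᵥ α =
      S.ιCell (SpanFamily.parallel m) i ≫ᵥ β) : α = β := by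
  refine S.cell_ext _ _ (S.hom_ext _ _ fun i => ?_) (S.hom_ext _ _ fun i => ?_) h
  · simpa using congrArg left (h i)
  · simpa using congrArg right (h i)

theorem sigmaCell_cid {x y : I → D} (m : ∀ i, Pro (x i) (y i)) :
    (S.sigmaCell fun i => cid (m i)) = cid (S.pro (SpanFamily.parallel m)) :=
  S.parallel_ext fun i => by rw [ι_sigmaCell, vcomp_cid, cid_vcomp]

theorem sigmaDelta_naturality {x y z x' y' z' : I → D} {m : ∀ i, Pro (x i) (y i)}
    {n : ∀ i, Pro (y i) (z i)} {m' : ∀ i, Pro (x' i) (y' i)} {n' : ∀ i, Pro (y' i) (z' i)}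
    (α : ∀ i, Cell (m i) (m' i)) (β : ∀ i, Cell (n i) (n' i))
    (h : ∀ i, right (α i) = left (β i)) (h' : right (S.sigmaCell α) = left (S.sigmaCell β)) :
    (S.sigmaCell fun i => hcomp (α i) (β i) (h i)) ≫ᵥ S.sigmaDelta m' n' =
      S.sigmaDelta m n ≫ᵥ hcomp (S.sigmaCell α) (S.sigmaCell β) h' := by
  refine S.parallel_ext fun i => ?_
  rw [← vcomp_assoc, ι_sigmaCell, ← vcomp_assoc, ι_sigmaDelta, vcomp_assoc, ι_sigmaDelta,
    ← hcomp_vcomp _ _ _ _ _ _ (by simp [h]), ← hcomp_vcomp _ _ _ _ _ _ (by simp [h])]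
  simp only [ι_sigmaCell]

theorem sigmaDelta_assoc {x y z t : I → D} (m : ∀ i, Pro (x i) (y i)) (n : ∀ i, Pro (y i) (z i))
    (k : ∀ i, Pro (z i) (t i)) :
    S.sigmaDelta (fun i => m i ⊙ n i) k ≫ᵥ
      hcomp (S.sigmaDelta m n) (cid (S.pro (SpanFamily.parallel k))) (by simp) ≫ᵥ
        assocHom _ _ _ =
    (S.sigmaCell fun i => assocHom (m i) (n i) (k i)) ≫ᵥ S.sigmaDelta m (fun i => n i ⊙ k i) ≫ᵥ
      hcomp (cid (S.pro (SpanFamily.parallel m))) (S.sigmaDelta n k) (by simp) := by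
  refine S.parallel_ext fun i => ?_
  have a := assoc_naturality (S.ιCell (SpanFamily.parallel m) i) (S.ιCell (SpanFamily.parallel n) i)
    (S.ιCell (SpanFamily.parallel k) i) (by simp) (by simp) (by simp) (by simp)
  have b₁ := hcomp_vcomp (S.ιCell (SpanFamily.parallel fun i => m i ⊙ n i) i)
    (S.ιCell (SpanFamily.parallel k) i) (S.sigmaDelta m n) (cid _) (by simp) (by simp) (by simp)
  have b₂ := hcomp_vcomp (S.ιCell (SpanFamily.parallel m) i)
    (S.ιCell (SpanFamily.parallel fun i => n i ⊙ k i) i)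
    (cid _) (S.sigmaDelta n k) (by simp) (by simp) (by simp)
  simp only [ι_sigmaDelta, vcomp_cid] at b₁ b₂
  rw [← vcomp_assoc, ι_sigmaDelta, ← vcomp_assoc, ← b₁, a, ← vcomp_assoc (S.ιCell _ i),
    ι_sigmaCell, vcomp_assoc,
    ← vcomp_assoc (S.ιCell (SpanFamily.parallel fun i => m i ⊙ n i ⊙ k i) i), ι_sigmaDelta, ← b₂]

theorem sigmaDelta_lunit {x y : I → D} (m : ∀ i, Pro (x i) (y i)) :
    S.sigmaDelta (fun i => unit (x i)) m ≫ᵥ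
      hcomp (S.unitComparison x) (cid (S.pro (SpanFamily.parallel m))) (by simp) ≫ᵥ
        lunitHom _ = S.sigmaCell fun i => lunitHom (m i) := by
  refine S.parallel_ext fun i => ?_
  have a := lunit_naturality (S.ιCell (SpanFamily.parallel m) i) (by simp)
  have b := hcomp_vcomp (S.ιCell (SpanFamily.unit x) i) (S.ιCell (SpanFamily.parallel m) i)
    (S.unitComparison x) (cid _) (by simp) (by simp) (by simp)
  simp only [ι_unitComparison, vcomp_cid] at b
  simp only [S.left_ιCell] at a
  rw [← vcomp_assoc, ι_sigmaDelta, ← vcomp_assoc, ← b, ι_sigmaCell]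
  exact a

theorem sigmaDelta_runit {x y : I → D} (m : ∀ i, Pro (x i) (y i)) :
    S.sigmaDelta m (fun i => unit (y i)) ≫ᵥ
      hcomp (cid (S.pro (SpanFamily.parallel m))) (S.unitComparison y) (by simp) ≫ᵥ
        runitHom _ = S.sigmaCell fun i => runitHom (m i) := by
  refine S.parallel_ext fun i => ?_
  have a := runit_naturality (S.ιCell (SpanFamily.parallel m) i) (by simp)
  have b := hcomp_vcomp (S.ιCell (SpanFamily.parallel m) i) (S.ιCell (SpanFamily.unit y) i)
    (cid _) (S.unitComparison y) (by simp) (by simp) (by simp)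
  simp only [ι_unitComparison, vcomp_cid] at b
  simp only [S.right_ιCell] at a
  rw [← vcomp_assoc, ι_sigmaDelta, ← vcomp_assoc, ← b, ι_sigmaCell]
  exact a

/-- The structure arrow `Σ_{i : I} x_{f i} → Σ_{j : J} x_j` whose `i`-th component is the coprojection
at `f i`. -/
def structArrow (f : I → J) (x : J → D) : S.obj (fun i => x (f i)) ⟶ S.obj x :=
  S.desc fun i => S.ι x (f i)

/-- The structure cell `Σ_{i : I} m_{f i} → Σ_{j : J} m_j` whose `i`-th component is the coprojection
at `f i`. -/
def structCell (f : I → J) {x y : J → D} (m : ∀ j, Pro (x j) (y j)) :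
    Cell (S.pro (SpanFamily.parallel fun i => m (f i))) (S.pro (SpanFamily.parallel m)) :=
  S.descCell
    { fst i := S.ι x (f i)
      snd i := S.ι y (f i)
      cell i := S.ιCell (SpanFamily.parallel m) (f i)
      left_cell i := S.left_ιCell (SpanFamily.parallel m) (f i)
      right_cell i := S.right_ιCell (SpanFamily.parallel m) (f i) }

@[simp] theorem ι_structArrow (f : I → J) (x : J → D) (i : I) :
    S.ι (fun i => x (f i)) i ≫ S.structArrow f x = S.ι x (f i) := S.ι_desc _ i

@[simp] theorem left_structCell (f : I → J) {x y : J → D} (m : ∀ j, Pro (x j) (y j)) :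
    left (S.structCell f m) = S.structArrow f x := S.left_descCell _

@[simp] theorem right_structCell (f : I → J) {x y : J → D} (m : ∀ j, Pro (x j) (y j)) :
    right (S.structCell f m) = S.structArrow f y := S.right_descCell _

@[simp] theorem ι_structCell (f : I → J) {x y : J → D} (m : ∀ j, Pro (x j) (y j)) (i : I) :
    S.ιCell (SpanFamily.parallel fun i => m (f i)) i ≫ᵥ S.structCell f m =
      S.ιCell (SpanFamily.parallel m) (f i) := by
  rw [structCell, ιCell_descCell]

theorem structCell_sigmaDelta (f : I → J) {x y z : J → D} (m : ∀ j, Pro (x j) (y j))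
    (n : ∀ j, Pro (y j) (z j)) :
    (S.structCell f fun j => m j ⊙ n j) ≫ᵥ S.sigmaDelta m n =
      S.sigmaDelta (fun i => m (f i)) (fun i => n (f i)) ≫ᵥ
        hcomp (S.structCell f m) (S.structCell f n) (by simp) := by
  refine S.parallel_ext fun i => ?_
  have e := S.ι_structCell f (fun j => m j ⊙ n j) i
  rw [← vcomp_assoc, e, ι_sigmaDelta, ← vcomp_assoc, ι_sigmaDelta,
    ← hcomp_vcomp _ _ _ _ _ _ (by simp)]
  simp only [ι_structCell]

theorem structCell_unitComparison (f : I → J) (x : J → D) :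
    (S.structCell f fun j => unit (x j)) ≫ᵥ S.unitComparison x =
      S.unitComparison (fun i => x (f i)) ≫ᵥ unitCell (S.structArrow f x) := by
  refine S.parallel_ext fun i => ?_
  have e := S.ι_structCell f (fun j => unit (x j)) i
  rw [← vcomp_assoc, e, ι_unitComparison, ← vcomp_assoc, ι_unitComparison,
    ← unitCell_comp, ι_structArrow]

end DoubleCoproducts

theorem conj_eq {x₁ y₁ x₂ y₂ x₃ y₃ x₄ y₄ x₅ y₅ x₆ y₆ : D} {a : Pro x₁ y₁} {b : Pro x₂ y₂}
    {c : Pro x₃ y₃} {d : Pro x₄ y₄} {e : Pro x₅ y₅} {g : Pro x₆ y₆} {f₁ : Cell a b} {f₂ : Cell b c}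
    {α : Cell c d} {σ : Cell a e} {g₁ : Cell e g} {g₂ : Cell g d}
    {f₁' : Cell b a} {f₂' : Cell c b} {g₁' : Cell g e} {g₂' : Cell d g}
    (h : f₁ ≫ᵥ f₂ ≫ᵥ α = σ ≫ᵥ g₁ ≫ᵥ g₂) (i₁ : f₂' ≫ᵥ f₂ = cid c) (i₂ : f₁' ≫ᵥ f₁ = cid b)
    (i₃ : g₂ ≫ᵥ g₂' = cid g) (i₄ : g₁ ≫ᵥ g₁' = cid e) :
    f₂' ≫ᵥ f₁' ≫ᵥ σ = α ≫ᵥ g₂' ≫ᵥ g₁' := by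
  have := congrArg (fun t => f₂' ≫ᵥ f₁' ≫ᵥ t ≫ᵥ g₂' ≫ᵥ g₁') h
  simp only [vcomp_assoc] at this
  rw [← vcomp_assoc f₁' f₁, i₂, cid_vcomp, ← vcomp_assoc f₂' f₂, i₁, cid_vcomp,
    ← vcomp_assoc g₂ g₂', i₃, cid_vcomp, i₄, vcomp_cid] at this
  exact this.symm

theorem swap_inv {x₁ y₁ x₂ y₂ x₃ y₃ x₄ y₄ : D} {a : Pro x₁ y₁} {b : Pro x₂ y₂}
    {c : Pro x₃ y₃} {d : Pro x₄ y₄} {σ : Cell a b} {δ : Cell b d} {δ' : Cell a c} {τ : Cell c d}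
    {μ : Cell d b} {μ' : Cell c a} (h : σ ≫ᵥ δ = δ' ≫ᵥ τ) (i₁ : μ' ≫ᵥ δ' = cid c)
    (i₂ : δ ≫ᵥ μ = cid b) : μ' ≫ᵥ σ = τ ≫ᵥ μ := by
  have := congrArg (fun t => μ' ≫ᵥ t ≫ᵥ μ) h
  simp only [vcomp_assoc] at this
  rwa [i₂, vcomp_cid, ← vcomp_assoc μ' δ', i₁, cid_vcomp] at this

theorem conj_eq' {x₁ y₁ x₂ y₂ x₃ y₃ x₄ y₄ : D} {a : Pro x₁ y₁} {b : Pro x₂ y₂}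
    {c : Pro x₃ y₃} {d : Pro x₄ y₄} {f₁ : Cell a b} {f₂ : Cell b c}
    {α : Cell c d} {σ : Cell a d} {f₁' : Cell b a} {f₂' : Cell c b}
    (h : f₁ ≫ᵥ f₂ ≫ᵥ α = σ) (i₁ : f₂' ≫ᵥ f₂ = cid c) (i₂ : f₁' ≫ᵥ f₁ = cid b) :
    f₂' ≫ᵥ f₁' ≫ᵥ σ = α := by
  rw [← h, ← vcomp_assoc f₁' f₁, i₂, cid_vcomp, ← vcomp_assoc f₂' f₂, i₁, cid_vcomp]

namespace StrongCoproducts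

variable {s : IndexSize} (S : StrongCoproducts.{w} s D) {I J : Type w} [s.Admits I] [s.Admits J]

theorem sigmaDelta_invertible {x y z : I → D} (m : ∀ i, Pro (x i) (y i))
    (n : ∀ i, Pro (y i) (z i)) : IsInvertible (S.sigmaDelta m n) := by
  let c₁ : SpanCocone (SpanFamily.parallel fun i => m i ⊙ n i) (S.pro ((SpanFamily.parallel m).comp (SpanFamily.parallel n))) :=
    { fst := S.ι x
      snd := S.ι z
      cell i := S.ιCell ((SpanFamily.parallel m).comp (SpanFamily.parallel n)) ⟨(i, i), rfl⟩
      left_cell i := S.left_ιCell ((SpanFamily.parallel m).comp (SpanFamily.parallel n)) ⟨(i, i), rfl⟩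
      right_cell i := S.right_ιCell ((SpanFamily.parallel m).comp (SpanFamily.parallel n)) ⟨(i, i), rfl⟩ }
  let P := S.pro (SpanFamily.parallel fun i => m i ⊙ n i)
  let γ : ∀ q : ((SpanFamily.parallel m).comp (SpanFamily.parallel n)).apex, { α : Cell (((SpanFamily.parallel m).comp (SpanFamily.parallel n)).pro q) P //
      left α = S.ι x (((SpanFamily.parallel m).comp (SpanFamily.parallel n)).l q) ∧ right α = S.ι z (((SpanFamily.parallel m).comp (SpanFamily.parallel n)).r q) } := fun q =>
    match q with
    | ⟨(i, j), h⟩ => by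
      change i = j at h
      subst h
      exact ⟨S.ιCell (SpanFamily.parallel fun i => m i ⊙ n i) i,
        S.left_ιCell (SpanFamily.parallel fun i => m i ⊙ n i) i,
        S.right_ιCell (SpanFamily.parallel fun i => m i ⊙ n i) i⟩
  let c₂ : SpanCocone ((SpanFamily.parallel m).comp (SpanFamily.parallel n)) P :=
    { fst := S.ι x
      snd := S.ι z
      cell q := (γ q).1
      left_cell q := (γ q).2.1
      right_cell q := (γ q).2.2 }
  have hγ : ∀ i, (γ ⟨(i, i), rfl⟩).1 = S.ιCell (SpanFamily.parallel fun i => m i ⊙ n i) i :=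
    fun i => rfl
  have e₁ : S.descCell c₁ ≫ᵥ S.descCell c₂ = cid _ := S.parallel_ext fun i => by
    rw [← vcomp_assoc, S.ιCell_descCell, vcomp_cid]
    exact (S.ιCell_descCell c₂ ⟨(i, i), rfl⟩).trans (hγ i)
  have e₂ : S.descCell c₂ ≫ᵥ S.descCell c₁ = cid _ := by
    refine S.cell_ext _ _ ?_ ?_ fun q => ?_
    · rw [left_vcomp, S.left_descCell, S.left_descCell, left_cid]
      change S.desc (S.ι x) ≫ S.desc (S.ι x) = _
      simp [S.desc_ι]
    · rw [right_vcomp, S.right_descCell, S.right_descCell, right_cid]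
      change S.desc (S.ι z) ≫ S.desc (S.ι z) = _
      simp [S.desc_ι]
    · rw [← vcomp_assoc, S.ιCell_descCell, vcomp_cid]
      obtain ⟨⟨i, j⟩, h⟩ := q
      change i = j at h
      subst h
      exact S.ιCell_descCell c₁ i
  have e₃ : S.sigmaDelta m n = S.descCell c₁ ≫ᵥ S.compComparison (SpanFamily.parallel m) (SpanFamily.parallel n) :=
    S.parallel_ext fun i => by
      rw [S.ι_sigmaDelta, ← vcomp_assoc, S.ιCell_descCell]
      exact (S.ι_compComparison (SpanFamily.parallel m) (SpanFamily.parallel n)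
        ⟨(i, i), rfl⟩).symm
  rw [e₃]
  exact IsInvertible.vcomp ⟨_, e₁, e₂⟩ (S.comp_invertible (SpanFamily.parallel m) (SpanFamily.parallel n))

/-- The coproduct double functor `Σ : D^I → D`, given by coproducts of families of objects, arrows,
proarrows and cells over the index set `I`, with comparison cells inverse to the ones induced by
the universal property. -/
noncomputable def sigma (I : Type w) [s.Admits I] : LaxDoubleFunctor (I → D) D where
  obj x := S.obj x
  map f := S.sigmaMap f
  map_id x := S.hom_ext _ _ fun i => by
    rw [S.ι_sigmaMap, Category.comp_id]
    exact Category.id_comp _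
  map_comp {x y z} f g := S.hom_ext _ _ fun i => by
    rw [S.ι_sigmaMap, ← Category.assoc, S.ι_sigmaMap, Category.assoc, S.ι_sigmaMap]
    exact Category.assoc _ _ _
  mapPro m := S.pro (SpanFamily.parallel m)
  mapCell α := S.sigmaCell α
  left_mapCell α := S.left_sigmaCell α
  right_mapCell α := S.right_sigmaCell α
  mapCell_cid m := S.parallel_ext fun i => by
    rw [S.ι_sigmaCell, vcomp_cid]
    exact cid_vcomp _
  mapCell_vcomp α β := S.parallel_ext fun i => by
    rw [S.ι_sigmaCell, ← vcomp_assoc, S.ι_sigmaCell, vcomp_assoc, S.ι_sigmaCell]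
    exact vcomp_assoc _ _ _
  comp m n := (S.sigmaDelta_invertible m n).inv
  left_comp m n := left_eq_id_of_inv (S.sigmaDelta_invertible m n).hom_inv (S.left_sigmaDelta m n)
  right_comp m n :=
    right_eq_id_of_inv (S.sigmaDelta_invertible m n).hom_inv (S.right_sigmaDelta m n)
  comp_naturality {x y z x' y' z' m n m' n'} α β h h' := by
    have e := S.sigmaDelta_naturality α β (fun i => congrFun h i) h'
    have := congrArg (fun t => (S.sigmaDelta_invertible m n).inv ≫ᵥ t ≫ᵥ
      (S.sigmaDelta_invertible m' n').inv) e
    simp only [vcomp_assoc, IsInvertible.hom_inv, vcomp_cid] at this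
    rw [← vcomp_assoc _ (S.sigmaDelta m n), IsInvertible.inv_hom, cid_vcomp] at this
    exact this.symm
  idn x := (S.unit_invertible x).inv
  left_idn x := left_eq_id_of_inv (S.unit_invertible x).hom_inv (S.left_unitComparison x)
  right_idn x := right_eq_id_of_inv (S.unit_invertible x).hom_inv (S.right_unitComparison x)
  idn_naturality {x y} f := by
    have e : S.unitComparison x ≫ᵥ unitCell (S.sigmaMap f) =
        (S.sigmaCell fun i => unitCell (f i)) ≫ᵥ S.unitComparison y := by
      refine S.parallel_ext fun i => ?_
      rw [← vcomp_assoc, S.ι_unitComparison, ← vcomp_assoc, S.ι_sigmaCell, vcomp_assoc,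
        S.ι_unitComparison, ← unitCell_comp, ← unitCell_comp, S.ι_sigmaMap]
    have := congrArg (fun t => (S.unit_invertible x).inv ≫ᵥ t ≫ᵥ (S.unit_invertible y).inv) e
    simp only [vcomp_assoc, IsInvertible.hom_inv, vcomp_cid] at this
    rw [← vcomp_assoc _ (S.unitComparison x), IsInvertible.inv_hom, cid_vcomp] at this
    exact this
  map_assoc {x y z t} m n k h h' := by
    have e := S.sigmaDelta_assoc m n k
    have c₁ := hcomp_vcomp (S.sigmaDelta_invertible m n).inv (cid (S.pro (SpanFamily.parallel k)))
      (S.sigmaDelta m n) (cid _) h (by simp) (by simp [IsInvertible.inv_hom])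
    have c₂ := hcomp_vcomp (cid (S.pro (SpanFamily.parallel m))) (S.sigmaDelta n k) (cid _)
      (S.sigmaDelta_invertible n k).inv (by simp) h' (by simp [IsInvertible.hom_inv])
    simp only [IsInvertible.inv_hom, IsInvertible.hom_inv, cid_vcomp, hcomp_cid] at c₁ c₂
    have c₃ := (S.sigmaDelta_invertible (fun i => m i ⊙ n i) k).inv_hom
    have c₄ := (S.sigmaDelta_invertible m (fun i => n i ⊙ k i)).hom_inv
    exact conj_eq e c₁.symm c₃ c₂.symm c₄
  map_lunit m h := by
    have e := S.sigmaDelta_lunit m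
    have c₁ := hcomp_vcomp (S.unit_invertible _).inv (cid (S.pro (SpanFamily.parallel m)))
      (S.unitComparison _) (cid _) h (by simp) (by simp [IsInvertible.inv_hom])
    simp only [IsInvertible.inv_hom, cid_vcomp, hcomp_cid] at c₁
    exact conj_eq' e c₁.symm (S.sigmaDelta_invertible _ m).inv_hom
  map_runit m h := by
    have e := S.sigmaDelta_runit m
    have c₁ := hcomp_vcomp (cid (S.pro (SpanFamily.parallel m))) (S.unit_invertible _).inv (cid _)
      (S.unitComparison _) h (by simp) (by simp [IsInvertible.inv_hom])
    simp only [IsInvertible.inv_hom, cid_vcomp, hcomp_cid] at c₁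
    exact conj_eq' e c₁.symm (S.sigmaDelta_invertible m _).inv_hom

/-- The natural transformation `Σ(f) : Σ ∘ D^f ⇒ Σ` induced by a function `f : I → J` through the
universal property of coproducts; its components are the structure arrows and structure cells. -/
noncomputable def sigmaTrans (f : I → J) : (reindex (D := D) f).compose (S.sigma I) ⟶ S.sigma J :=
  DoubleNatTrans.mk (F := (reindex (D := D) f).compose (S.sigma I)) (G := S.sigma J)
    (fun x => S.structArrow f x)
    (fun m => S.structCell f m)
    (fun m => S.left_structCell f m)
    (fun m => S.right_structCell f m)
    (fun {x y} g => S.hom_ext _ _ fun i => by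
      change S.ι (fun i => x (f i)) i ≫ S.sigmaMap (fun i => g (f i)) ≫ S.structArrow f y =
        S.ι (fun i => x (f i)) i ≫ S.structArrow f x ≫ S.sigmaMap g
      rw [← Category.assoc, S.ι_sigmaMap, Category.assoc, S.ι_structArrow, ← Category.assoc,
        S.ι_structArrow, S.ι_sigmaMap])
    (fun {x y w z m n} α => by
      change (S.sigmaCell fun i => α (f i)) ≫ᵥ S.structCell f n =
        S.structCell f m ≫ᵥ S.sigmaCell α
      refine S.parallel_ext fun i => ?_
      rw [← vcomp_assoc, S.ι_sigmaCell, vcomp_assoc, S.ι_structCell, ← vcomp_assoc,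
        S.ι_structCell, S.ι_sigmaCell])
    (fun {x y z} m n h => by
      change ((S.sigmaDelta_invertible (fun i => m (f i)) (fun i => n (f i))).inv ≫ᵥ
        S.sigmaCell (fun i => cid (m (f i) ⊙ n (f i)))) ≫ᵥ S.structCell f (fun j => m j ⊙ n j) =
        hcomp (S.structCell f m) (S.structCell f n) _ ≫ᵥ (S.sigmaDelta_invertible m n).inv
      rw [S.sigmaCell_cid, vcomp_cid]
      exact swap_inv (S.structCell_sigmaDelta f m n) (IsInvertible.inv_hom _)
        (IsInvertible.hom_inv _))
    (fun x => by
      change ((S.unit_invertible (fun i => x (f i))).inv ≫ᵥ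
        S.sigmaCell (fun i => cid (unit (x (f i))))) ≫ᵥ S.structCell f (fun j => unit (x j)) =
        unitCell (S.structArrow f x) ≫ᵥ (S.unit_invertible x).inv
      rw [S.sigmaCell_cid, vcomp_cid]
      exact swap_inv (S.structCell_unitComparison f x) (IsInvertible.inv_hom _)
        (IsInvertible.hom_inv _))

end StrongCoproducts

end Coproducts

/-! Everything reduces to one observation: in the presence of strong coproducts, a span of index
sets acts like a matrix of identity proarrows. The companion of the structure arrow at x is the
coproduct of the identities on x (f i) over the span I = I → J, and its conjoint is the coproduct of
the same identities over the reversed span. Invertibility of the comparison from Σ id to the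
identity on the coproduct provides the units, and the companion and conjoint equations are checked
on coprojections (`structCompanion`, `structConjoint`).

For a parallel family m, the two composites to be compared, Σ m_{f i} ⊙ f_! and f_! ⊙ Σ m_j, are
coproducts over the composite spans, because comparison cells for composition are invertible. Both
composite spans are I = I → J, and up to unitors both families are m_{f i}. Uniqueness of coproducts
therefore gives an invertible globular cell between them, and this cell is the one obtained by
sliding the structure cell along companions. The cocommuter statement uses the reversed spans
(`isCommuter_structCell`, `isCocommuter_structCell`).

The passage to lax functors is formal. A natural transformation whose components have companions and
whose component cells are commuters has a companion: the components assemble into a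
protransformation whose comparisons are the inverses of the slid cells
(`nonempty_companion_of_isCommuter`). Its axioms say that sliding is natural, respects external
composition and respects external identities. To make these provable without manipulating the
defining pasting, a slid cell is characterised in `IsReshape` by its composite with m ⊙ η. A cell
out of m ⊙ g_! is determined by that composite and its right boundary (`Companion.pcomp_ext`), so
each law becomes a comparison of two cells out of m ⊙ id.

Conjoints are companions in the horizontal opposite `HOp D`, which transports the calculus of
sliding. For the conjoint protransformation the slid cells already have the direction of the
comparisons, so they are used without inversion. -/

namespace DoubleCategory

/-! ### Rewriting rules for pastings of cells -/

section Calculus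

variable {D : Type u} [DoubleCategory.{u, v, p, c} D]

/-- The boundary condition is an argument of `hcomp` that mentions both cells, so neither can be
rewritten alone in general. Both factors are replaced here at once and the condition is carried
along. -/
theorem hcomp_congr {x y z x' y' z' : D} {m : Pro x y} {n : Pro y z} {m' : Pro x' y'}
    {n' : Pro y' z'} {α α' : Cell m m'} {β β' : Cell n n'} (hα : α = α') (hβ : β = β')
    (h : right α = left β) : hcomp α β h = hcomp α' β' (by rw [← hα, ← hβ, h]) := by
  subst hα hβ; rfl

theorem hcomp_vcomp_hcomp {x y z x' y' z' x'' y'' z'' : D} {m : Pro x y} {n : Pro y z}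
    {m' : Pro x' y'} {n' : Pro y' z'} {m'' : Pro x'' y''} {n'' : Pro y'' z''} (α : Cell m m')
    (β : Cell n n') (α' : Cell m' m'') (β' : Cell n' n'') (h : right α = left β)
    (h' : right α' = left β') :
    hcomp α β h ≫ᵥ hcomp α' β' h' = hcomp (α ≫ᵥ α') (β ≫ᵥ β') (by simp [h, h']) :=
  (hcomp_vcomp _ _ _ _ _ _ _).symm

theorem hcomp_vcomp_hcomp_assoc {x y z x' y' z' x'' y'' z'' s t : D} {m : Pro x y} {n : Pro y z}
    {m' : Pro x' y'} {n' : Pro y' z'} {m'' : Pro x'' y''} {n'' : Pro y'' z''} {k : Pro s t}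
    (α : Cell m m') (β : Cell n n') (α' : Cell m' m'') (β' : Cell n' n'') (h : right α = left β)
    (h' : right α' = left β') (γ : Cell (m'' ⊙ n'') k) :
    hcomp α β h ≫ᵥ hcomp α' β' h' ≫ᵥ γ = hcomp (α ≫ᵥ α') (β ≫ᵥ β') (by simp [h, h']) ≫ᵥ γ := by
  rw [← vcomp_assoc, hcomp_vcomp_hcomp]

/-- Vertical composites are normalised to the right. An equation for a composite of two cells then
has to be applied in front of an arbitrary tail, which this lemma and its relatives supply. -/
theorem vcomp_eq_assoc {x₁ y₁ x₂ y₂ x₃ y₃ x₄ y₄ : D} {m₁ : Pro x₁ y₁} {m₂ : Pro x₂ y₂}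
    {m₃ : Pro x₃ y₃} {m₄ : Pro x₄ y₄} {α : Cell m₁ m₂} {β : Cell m₂ m₃} {γ : Cell m₁ m₃}
    (h : α ≫ᵥ β = γ) (δ : Cell m₃ m₄) : α ≫ᵥ β ≫ᵥ δ = γ ≫ᵥ δ := by
  rw [← vcomp_assoc, h]

theorem vcomp_eq_vcomp_assoc {x₁ y₁ x₂ y₂ x₃ y₃ x₄ y₄ x₅ y₅ : D} {m₁ : Pro x₁ y₁}
    {m₂ : Pro x₂ y₂} {m₃ : Pro x₃ y₃} {m₄ : Pro x₄ y₄} {m₅ : Pro x₅ y₅} {α : Cell m₁ m₂}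
    {β : Cell m₂ m₃} {α' : Cell m₁ m₅} {β' : Cell m₅ m₃} (h : α ≫ᵥ β = α' ≫ᵥ β')
    (δ : Cell m₃ m₄) : α ≫ᵥ β ≫ᵥ δ = α' ≫ᵥ β' ≫ᵥ δ := by
  rw [vcomp_eq_assoc h, vcomp_assoc]

@[simp] theorem assocHom_inv_assoc {x y z t s s' : D} (m : Pro x y) (n : Pro y z) (k : Pro z t)
    {l : Pro s s'} (δ : Cell _ l) : assocHom m n k ≫ᵥ assocInv m n k ≫ᵥ δ = δ := by
  rw [vcomp_eq_assoc (assocHom_inv _ _ _), cid_vcomp]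

@[simp] theorem assocInv_hom_assoc {x y z t s s' : D} (m : Pro x y) (n : Pro y z) (k : Pro z t)
    {l : Pro s s'} (δ : Cell _ l) : assocInv m n k ≫ᵥ assocHom m n k ≫ᵥ δ = δ := by
  rw [vcomp_eq_assoc (assocInv_hom _ _ _), cid_vcomp]

@[simp] theorem lunitHom_inv_assoc {x y s s' : D} (m : Pro x y)
    {l : Pro s s'} (δ : Cell _ l) : lunitHom m ≫ᵥ lunitInv m ≫ᵥ δ = δ := by
  rw [vcomp_eq_assoc (lunitHom_inv _), cid_vcomp]

@[simp] theorem lunitInv_hom_assoc {x y s s' : D} (m : Pro x y)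
    {l : Pro s s'} (δ : Cell _ l) : lunitInv m ≫ᵥ lunitHom m ≫ᵥ δ = δ := by
  rw [vcomp_eq_assoc (lunitInv_hom _), cid_vcomp]

@[simp] theorem runitHom_inv_assoc {x y s s' : D} (m : Pro x y)
    {l : Pro s s'} (δ : Cell _ l) : runitHom m ≫ᵥ runitInv m ≫ᵥ δ = δ := by
  rw [vcomp_eq_assoc (runitHom_inv _), cid_vcomp]

@[simp] theorem runitInv_hom_assoc {x y s s' : D} (m : Pro x y)
    {l : Pro s s'} (δ : Cell _ l) : runitInv m ≫ᵥ runitHom m ≫ᵥ δ = δ := by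
  rw [vcomp_eq_assoc (runitInv_hom _), cid_vcomp]

/-- The left boundary is a separate variable `f` with an equation, so that a known value such as an
identity or a coprojection can be used without rewriting inside `unitCell (left α)`. -/
theorem lunitHom_natural {x y x' y' : D} {m : Pro x y} {m' : Pro x' y'} (α : Cell m m')
    {f : x ⟶ x'} (h : left α = f) :
    lunitHom m ≫ᵥ α = hcomp (unitCell f) α (by simp [h]) ≫ᵥ lunitHom m' := by
  subst h; exact (lunit_naturality α (by simp)).symm

theorem runitHom_natural {x y x' y' : D} {m : Pro x y} {m' : Pro x' y'} (α : Cell m m')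
    {f : y ⟶ y'} (h : right α = f) :
    runitHom m ≫ᵥ α = hcomp α (unitCell f) (by simp [h]) ≫ᵥ runitHom m' := by
  subst h; exact (runit_naturality α (by simp)).symm

theorem lunitInv_natural {x y x' y' : D} {m : Pro x y} {m' : Pro x' y'} (α : Cell m m')
    {f : x ⟶ x'} (h : left α = f) :
    α ≫ᵥ lunitInv m' = lunitInv m ≫ᵥ hcomp (unitCell f) α (by simp [h]) := by
  have := congrArg (fun t => lunitInv m ≫ᵥ t ≫ᵥ lunitInv m') (lunitHom_natural α h)
  simpa using this

theorem runitInv_natural {x y x' y' : D} {m : Pro x y} {m' : Pro x' y'} (α : Cell m m')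
    {f : y ⟶ y'} (h : right α = f) :
    α ≫ᵥ runitInv m' = runitInv m ≫ᵥ hcomp α (unitCell f) (by simp [h]) := by
  have := congrArg (fun t => runitInv m ≫ᵥ t ≫ᵥ runitInv m') (runitHom_natural α h)
  simpa using this

theorem assocHom_natural {x y z t x' y' z' t' : D} {m : Pro x y} {n : Pro y z} {k : Pro z t}
    {m' : Pro x' y'} {n' : Pro y' z'} {k' : Pro z' t'} (α : Cell m m') (β : Cell n n')
    (γ : Cell k k') (h : right α = left β) (h' : right β = left γ) :
    hcomp (hcomp α β h) γ (by simp [h']) ≫ᵥ assocHom m' n' k' =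
      assocHom m n k ≫ᵥ hcomp α (hcomp β γ h') (by simp [h]) :=
  assoc_naturality _ _ _ _ _ _ _

theorem assocInv_natural {x y z t x' y' z' t' : D} {m : Pro x y} {n : Pro y z} {k : Pro z t}
    {m' : Pro x' y'} {n' : Pro y' z'} {k' : Pro z' t'} (α : Cell m m') (β : Cell n n')
    (γ : Cell k k') (h : right α = left β) (h' : right β = left γ) :
    hcomp α (hcomp β γ h') (by simp [h]) ≫ᵥ assocInv m' n' k' =
      assocInv m n k ≫ᵥ hcomp (hcomp α β h) γ (by simp [h']) := by
  have := congrArg (fun t => assocInv m n k ≫ᵥ t ≫ᵥ assocInv m' n' k')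
    (assocHom_natural α β γ h h')
  simpa using this.symm

/-- Coherence for globular cells is inherited from the underlying bicategory, whose structure cells
are those of `D` by definition. -/
theorem lunitHom_unit (x : D) : lunitHom (unit x) = runitHom (unit x) :=
  congrArg GlobCell.val (Bicategory.unitors_equal (B := UBicat D) (a := ⟨x⟩))

theorem lunitInv_unit (x : D) : lunitInv (unit x) = runitInv (unit x) :=
  congrArg GlobCell.val (Bicategory.unitors_inv_equal (B := UBicat D) (a := ⟨x⟩))

theorem runitHom_pcomp {x y z : D} (m : Pro x y) (n : Pro y z) :
    runitHom (m ⊙ n) = assocHom m n (unit z) ≫ᵥ hcomp (cid m) (runitHom n) (by simp) :=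
  congrArg GlobCell.val (Bicategory.rightUnitor_comp (B := UBicat D) (a := ⟨x⟩) (b := ⟨y⟩)
    (c := ⟨z⟩) m n)

end Calculus

/-! ### Companions and their universal property -/

section Companions

variable {D : Type u} [DoubleCategory.{u, v, p, c} D]

namespace Companion

attribute [simp] left_η right_η left_ε right_ε

/-- This is the horizontal companion equation with its unitors moved to the other side, so that η ⊙
ε can be replaced inside larger pastings. -/
theorem hcomp_η_ε {x y : D} {f : x ⟶ y} (F : Companion f) :
    hcomp F.η F.ε (by simp) = lunitHom F.pro ≫ᵥ runitInv F.pro := by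
  have := congrArg (fun t => lunitHom F.pro ≫ᵥ t ≫ᵥ runitInv F.pro) F.hcomp_eq
  simpa using this

/-- A cell out of a companion is determined by its right boundary and its composite with the
unit. -/
theorem ext_of_η {x y s t : D} {f : x ⟶ y} (F : Companion f) {k : Pro s t} {α β : Cell F.pro k}
    (hr : right α = right β) (h : F.η ≫ᵥ α = F.η ≫ᵥ β) : α = β := by
  -- Any `γ` can be rebuilt from `F.η ≫ᵥ γ` and its right boundary: precompose `γ` with the identity
  -- written as η ⊙ ε, and pull `γ` back through the right unitor.
  have key : ∀ γ : Cell F.pro k, γ = lunitInv F.pro ≫ᵥ hcomp (F.η ≫ᵥ γ)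
      (F.ε ≫ᵥ unitCell (right γ)) (by simp) ≫ᵥ runitHom k := fun γ => by
    rw [← hcomp_vcomp_hcomp _ _ _ _ (by simp) (by simp), vcomp_assoc, ← runitHom_natural γ rfl,
      ← vcomp_assoc, ← vcomp_assoc, vcomp_assoc (lunitInv F.pro), F.hcomp_eq, cid_vcomp]
  rw [key α, key β]
  simp only [h, hr]

/-- The cell between companions induced by a commutative square of arrows. -/
def lift {x y x' y' : D} {f : x ⟶ y} {f' : x' ⟶ y'} (F : Companion f) (F' : Companion f')
    (a : x ⟶ x') (b : y ⟶ y') (h : a ≫ f' = f ≫ b) : Cell F.pro F'.pro :=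
  lunitInv F.pro ≫ᵥ hcomp (unitCell a ≫ᵥ F'.η) (F.ε ≫ᵥ unitCell b) (by simp [h]) ≫ᵥ
    runitHom F'.pro

section

variable {x y x' y' : D} {f : x ⟶ y} {f' : x' ⟶ y'} (F : Companion f) (F' : Companion f')
    (a : x ⟶ x') (b : y ⟶ y') (h : a ≫ f' = f ≫ b)

@[simp] theorem left_lift : left (F.lift F' a b h) = a := by simp [lift]

@[simp] theorem right_lift : right (F.lift F' a b h) = b := by simp [lift]

/-- Sliding η through the left unitor makes it meet ε, which leaves the identity cell on f ≫ b = a ≫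
f', and the right unitor absorbs it. Together with `ext_of_η` this equation pins down `lift`, and
all later facts about `lift` are derived from it. -/
theorem η_lift : F.η ≫ᵥ F.lift F' a b h = unitCell a ≫ᵥ F'.η := by
  rw [lift, ← vcomp_assoc, lunitInv_natural F.η F.left_η, vcomp_assoc, hcomp_vcomp_hcomp_assoc]
  have e : F.η ≫ᵥ F.ε ≫ᵥ unitCell b = unitCell (a ≫ f') := by
    rw [← vcomp_assoc, F.vcomp_eq, ← unitCell_comp, h]
  simp only [e, unitCell_id, cid_vcomp]
  -- One unitor was inserted on the left and one removed on the right. They cancel because the two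
  -- unitors of an identity proarrow coincide.
  rw [← runitHom_natural (unitCell a ≫ᵥ F'.η) (by simp), lunitInv_unit, runitInv_hom_assoc]

theorem lift_ε : F.lift F' a b h ≫ᵥ F'.ε = F.ε ≫ᵥ unitCell b := by
  refine F.ext_of_η (by simp) ?_
  rw [vcomp_eq_assoc (F.η_lift F' a b h), vcomp_eq_assoc F.vcomp_eq, vcomp_assoc, F'.vcomp_eq,
    ← unitCell_comp, ← unitCell_comp, h]

theorem lift_eq {α : Cell F.pro F'.pro} (hr : right α = b)
    (hη : F.η ≫ᵥ α = unitCell a ≫ᵥ F'.η) : F.lift F' a b h = α :=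
  F.ext_of_η (by simp [hr]) (by rw [η_lift, hη])

theorem lift_id : F.lift F (𝟙 x) (𝟙 y) (by simp) = cid F.pro :=
  F.lift_eq F _ _ _ (by simp) (by simp)

theorem lift_comp {x'' y'' : D} {f'' : x'' ⟶ y''} (F'' : Companion f'') (a' : x' ⟶ x'')
    (b' : y' ⟶ y'') (h' : a' ≫ f'' = f' ≫ b') :
    F.lift F' a b h ≫ᵥ F'.lift F'' a' b' h' =
      F.lift F'' (a ≫ a') (b ≫ b') (by rw [Category.assoc, h', ← Category.assoc, h,
        Category.assoc]) :=
  (F.lift_eq F'' _ _ _ (by simp) (by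
    rw [← vcomp_assoc, F.η_lift, vcomp_assoc, F'.η_lift, ← vcomp_assoc, unitCell_comp])).symm

/-- Companions of one arrow are canonically isomorphic. This makes the notion of commuter
independent of the choice of companions. -/
theorem lift_invertible (F F' : Companion f) :
    IsInvertible (F.lift F' (𝟙 x) (𝟙 y) (by simp)) :=
  ⟨F'.lift F (𝟙 x) (𝟙 y) (by simp), by rw [lift_comp]; simpa using F.lift_id,
    by rw [lift_comp]; simpa using F'.lift_id⟩

end

/-- A cell out of a composite with a companion is determined by its right boundary and its
composite with the unit. -/
theorem pcomp_ext {x y z s t : D} {g : y ⟶ z} (G : Companion g) {m : Pro x y} {k : Pro s t}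
    {α β : Cell (m ⊙ G.pro) k} (hr : right α = right β)
    (h : hcomp (cid m) G.η (by simp) ≫ᵥ α = hcomp (cid m) G.η (by simp) ≫ᵥ β) : α = β := by
  -- This is the companion equation of `G` whiskered by `m`. The triangle axiom and the description
  -- of the right unitor of a composite turn the unitors of `G.pro` into those of `m` and `m ⊙
  -- G.pro`.
  have e : hcomp (runitInv m) (cid G.pro) (by simp) ≫ᵥ
      hcomp (hcomp (cid m) G.η (by simp)) G.ε (by simp) ≫ᵥ runitHom (m ⊙ G.pro) = cid _ := by
    have e₁ := congrArg (· ≫ᵥ assocInv _ _ _) (assocHom_natural (cid m) G.η G.ε (by simp) (by simp))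
    have e₂ := triangle m G.pro (by simp) (by simp)
    have e₃ : hcomp (cid m) (hcomp G.η G.ε (by simp)) (by simp) =
        hcomp (cid m) (lunitHom G.pro) (by simp) ≫ᵥ hcomp (cid m) (runitInv G.pro) (by simp) := by
      rw [hcomp_vcomp_hcomp]
      exact hcomp_congr (by simp) G.hcomp_η_ε _
    simp only [vcomp_assoc, assocHom_inv, vcomp_cid] at e₁
    rw [e₁, e₃]
    simp only [vcomp_assoc]
    rw [vcomp_eq_assoc e₂, hcomp_vcomp_hcomp_assoc, runitHom_pcomp, assocInv_hom_assoc,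
      hcomp_vcomp_hcomp, hcomp_vcomp_hcomp]
    simp
  -- The same reconstruction as for a cell out of a bare companion, with η replaced by m ⊙ η.
  have key : ∀ γ : Cell (m ⊙ G.pro) k, γ = hcomp (runitInv m) (cid G.pro) (by simp) ≫ᵥ
      hcomp (hcomp (cid m) G.η (by simp) ≫ᵥ γ) (G.ε ≫ᵥ unitCell (right γ)) (by simp) ≫ᵥ
        runitHom k := fun γ => by
    rw [← hcomp_vcomp_hcomp _ _ _ _ (by simp) (by simp), vcomp_assoc, ← runitHom_natural γ rfl,
      ← vcomp_assoc, ← vcomp_assoc, vcomp_assoc (hcomp _ _ _), e, cid_vcomp]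
  rw [key α, key β]
  simp only [h, hr]

end Companion

/-! ### Sliding the boundaries of a cell along companions -/

/-- `Φ : m ⊙ g_! → f_! ⊙ n` is obtained from `α : m → n` by sliding its boundaries `f` and `g`
along companions. -/
structure IsReshape {x y w z : D} {f : x ⟶ w} {g : y ⟶ z} (F : Companion f) (G : Companion g)
    {m : Pro x y} {n : Pro w z} (α : Cell m n) (Φ : Cell (m ⊙ G.pro) (F.pro ⊙ n)) : Prop where
  left_cell : left α = f
  right_cell : right α = g
  right_eq : right Φ = 𝟙 z
  hcomp_η : hcomp (cid m) G.η (by simp) ≫ᵥ Φ =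
    runitHom m ≫ᵥ lunitInv m ≫ᵥ hcomp F.η α (by simp [left_cell])

namespace IsReshape

variable {x y w z : D} {f : x ⟶ w} {g : y ⟶ z} {F : Companion f} {G : Companion g}
    {m : Pro x y} {n : Pro w z} {α : Cell m n} {Φ : Cell (m ⊙ G.pro) (F.pro ⊙ n)}

/-- The left boundary can be read off `hcomp_η`, since m ⊙ η has identity left boundary. On the
right the equation only gives g ≫ right Φ = g, which is why `right_eq` is a separate field. -/
theorem left_eq (h : IsReshape F G α Φ) : left Φ = 𝟙 x := by
  simpa using congrArg left h.hcomp_η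

/-- Tested against m ⊙ η, both counits become identity cells on f and g and both sides become `α`
conjugated by unitors. This equation later makes the counits of pointwise companions into a
modification. -/
theorem hcomp_ε (h : IsReshape F G α Φ) :
    Φ ≫ᵥ hcomp F.ε (cid n) (by simp) =
      hcomp α G.ε (by simp [h.right_cell]) ≫ᵥ runitHom n ≫ᵥ lunitInv n := by
  refine G.pcomp_ext (by simp [h.right_eq]) ?_
  rw [vcomp_eq_assoc h.hcomp_η]
  simp only [vcomp_assoc]
  rw [hcomp_vcomp_hcomp, hcomp_vcomp_hcomp_assoc]
  simp only [F.vcomp_eq, G.vcomp_eq, vcomp_cid, cid_vcomp]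
  rw [← vcomp_eq_vcomp_assoc (runitHom_natural α h.right_cell), lunitInv_natural α h.left_cell]

/-- Reshaping is natural. -/
theorem natural {x' y' w' z' : D} {f' : x' ⟶ w'} {g' : y' ⟶ z'} {F' : Companion f'}
    {G' : Companion g'} {m' : Pro x' y'} {n' : Pro w' z'} {α' : Cell m' n'}
    {Φ' : Cell (m' ⊙ G'.pro) (F'.pro ⊙ n')} (h : IsReshape F G α Φ) (h' : IsReshape F' G' α' Φ')
    (σ : Cell m m') (τ : Cell n n') (φ : Cell F.pro F'.pro) (ψ : Cell G.pro G'.pro)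
    (e : σ ≫ᵥ α' = α ≫ᵥ τ) (hφ : F.η ≫ᵥ φ = unitCell (left σ) ≫ᵥ F'.η)
    (hψ : G.η ≫ᵥ ψ = unitCell (right σ) ≫ᵥ G'.η) (hφτ : right φ = left τ)
    (hψτ : right ψ = right τ) (hσψ : right σ = left ψ) :
    hcomp σ ψ hσψ ≫ᵥ Φ' = Φ ≫ᵥ hcomp φ τ hφτ := by
  -- Restricting along m ⊙ η replaces `Φ` and `Φ'` by η beside `α` and `α'`. What remains is `e`
  -- placed beside the compatibility of `φ` with the units, together with naturality of the unitors.
  refine G.pcomp_ext (by simp [h.right_eq, h'.right_eq, hψτ]) ?_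
  have e₁ : hcomp (cid m ≫ᵥ σ) (G.η ≫ᵥ ψ) (by simp [hσψ]) =
      hcomp σ (unitCell (right σ)) (by simp) ≫ᵥ hcomp (cid m') G'.η (by simp) := by
    rw [hcomp_vcomp_hcomp]
    exact hcomp_congr (by simp) hψ _
  have e₂ : hcomp (F.η ≫ᵥ φ) (α ≫ᵥ τ) (by simp [h.left_cell, hφτ]) =
      hcomp (unitCell (left σ)) σ (by simp) ≫ᵥ hcomp F'.η α' (by simp [h'.left_cell]) := by
    rw [hcomp_vcomp_hcomp]
    exact hcomp_congr hφ e.symm _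
  rw [hcomp_vcomp_hcomp_assoc, e₁, vcomp_assoc, h'.hcomp_η, vcomp_eq_assoc h.hcomp_η]
  simp only [vcomp_assoc]
  rw [hcomp_vcomp_hcomp, e₂, ← vcomp_eq_vcomp_assoc (runitHom_natural σ rfl),
    vcomp_eq_vcomp_assoc (lunitInv_natural σ rfl)]

/-- The reshape of the external identity on an arrow. -/
theorem of_unitCell (F : Companion f) :
    IsReshape F F (unitCell f) (lunitHom F.pro ≫ᵥ runitInv F.pro) where
  left_cell := by simp
  right_cell := by simp
  right_eq := by simp
  hcomp_η := by
    have e := lunitHom_natural F.η F.left_η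
    simp only [unitCell_id] at e
    rw [← vcomp_eq_vcomp_assoc e, runitInv_natural F.η F.right_η, lunitInv_unit,
      lunitHom_unit]

end IsReshape

/-- Pasting two slid cells leaves behind one exchange of unitors for each factor. This coherence
identity collects them into the exchange for the composite proarrow. -/
theorem runit_lunit_pcomp {x y z : D} (m : Pro x y) (n : Pro y z) :
    runitHom (m ⊙ n) ≫ᵥ lunitInv (m ⊙ n) = assocHom m n (unit z) ≫ᵥ
      hcomp (cid m) (runitHom n ≫ᵥ lunitInv n) (by simp) ≫ᵥ assocInv m (unit y) n ≫ᵥ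
        hcomp (runitHom m ≫ᵥ lunitInv m) (cid n) (by simp) ≫ᵥ assocHom (unit x) m n := by
  -- The identity is proved in an arbitrary bicategory, where the `bicategory` tactic recognises all
  -- structure cells, and then specialised to `UBicat D`.
  have : ∀ {B : Type u} [Bicategory.{c, p} B] {x y z : B} (m : x ⟶ y) (n : y ⟶ z),
      (Bicategory.rightUnitor (m ≫ n)).hom ≫ (Bicategory.leftUnitor (m ≫ n)).inv =
      (Bicategory.associator m n (𝟙 z)).hom ≫ Bicategory.whiskerLeft m
        ((Bicategory.rightUnitor n).hom ≫ (Bicategory.leftUnitor n).inv) ≫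
        (Bicategory.associator m (𝟙 y) n).inv ≫ Bicategory.whiskerRight
        ((Bicategory.rightUnitor m).hom ≫ (Bicategory.leftUnitor m).inv) n ≫
        (Bicategory.associator (𝟙 x) m n).hom := by
    intros; bicategory
  exact congrArg GlobCell.val (this (B := UBicat D) (x := ⟨x⟩) (y := ⟨y⟩) (z := ⟨z⟩) m n)

/-- The reshape of an external composite of cells. -/
theorem IsReshape.of_hcomp {x y z x' y' z' : D} {f : x ⟶ x'} {g : y ⟶ y'} {k : z ⟶ z'}
    {F : Companion f} {G : Companion g} {K : Companion k} {m : Pro x y} {n : Pro y z}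
    {m' : Pro x' y'} {n' : Pro y' z'} {α : Cell m m'} {β : Cell n n'}
    {Φ : Cell (m ⊙ G.pro) (F.pro ⊙ m')} {Ψ : Cell (n ⊙ K.pro) (G.pro ⊙ n')}
    (hΦ : IsReshape F G α Φ) (hΨ : IsReshape G K β Ψ) :
    IsReshape F K (hcomp α β (by rw [hΦ.right_cell, hΨ.left_cell]))
      (assocHom m n K.pro ≫ᵥ hcomp (cid m) Ψ (by simp [hΨ.left_eq]) ≫ᵥ
        assocInv m G.pro n' ≫ᵥ
        hcomp Φ (cid n') (by simp [hΦ.right_eq]) ≫ᵥ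
          assocHom F.pro m' n') where
  left_cell := by simp [hΦ.left_cell]
  right_cell := by simp [hΨ.right_cell]
  right_eq := by simp [hΨ.right_eq]
  hcomp_η := by
    have e₁ := assocHom_natural (cid m) (cid n) K.η (by simp)
      (by simp)
    have e₂ := assocInv_natural (cid m) G.η β (by simp) (by simp [hΨ.left_cell])
    have e₃ := assocHom_natural F.η α β (by simp [hΦ.left_cell])
      (by rw [hΦ.right_cell, hΨ.left_cell])
    simp only [hcomp_cid] at e₁
    have e₄ := hcomp_vcomp_hcomp (cid m)
      (hcomp (cid n) K.η (by simp)) (cid m) Ψ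
      (by simp) (by simp [hΨ.left_eq])
    have e₄' := e₄.trans (hcomp_congr (α' := cid m ≫ᵥ cid m)
      (β' := (runitHom n ≫ᵥ lunitInv n) ≫ᵥ hcomp G.η β (by simp [hΨ.left_cell]))
      rfl (hΨ.hcomp_η.trans (vcomp_assoc _ _ _).symm) _)
    have e₅ := hcomp_vcomp_hcomp
      (hcomp (cid m) G.η (by simp)) β Φ (cid n')
      (by simp [hΨ.left_cell]) (by simp [hΦ.right_eq])
    have e₅' := e₅.trans (hcomp_congr (β' := cid n ≫ᵥ β)
      (α' := (runitHom m ≫ᵥ lunitInv m) ≫ᵥ hcomp F.η α (by simp [hΦ.left_cell]))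
      (hΦ.hcomp_η.trans (vcomp_assoc _ _ _).symm) (by simp) _)
    rw [← hcomp_vcomp_hcomp _ _ _ _ (by simp) (by simp)] at e₄'
    rw [← hcomp_vcomp_hcomp _ _ _ _ (by simp) (by simp [hΦ.right_cell, hΨ.left_cell])] at e₅'
    -- The unit of `K` is pushed through `Ψ`, where it becomes the unit of `G` beside `β`. That unit
    -- is in turn pushed through `Φ` and becomes the unit of `F` beside `α` and `β`.
    rw [vcomp_eq_assoc e₁, vcomp_assoc, vcomp_eq_assoc e₄', vcomp_assoc, vcomp_eq_assoc e₂,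
      vcomp_assoc, vcomp_eq_assoc e₅', vcomp_assoc, e₃, ← vcomp_assoc (runitHom (m ⊙ n)),
      runit_lunit_pcomp]
    simp only [vcomp_assoc]

/-- Precomposing the defining pasting with m ⊙ η brings η and ε of the right companion together.
They compose to an identity cell, which the right unitor absorbs. -/
theorem isReshape_companionReshape {x y w z : D} {m : Pro x y} {n : Pro w z} (α : Cell m n)
    (F : Companion (left α)) (G : Companion (right α)) :
    IsReshape F G α (companionReshape α F G) where
  left_cell := rfl
  right_cell := rfl
  right_eq := by simp [companionReshape]
  hcomp_η := by
    have e : runitHom m ≫ᵥ lunitInv m = hcomp (lunitInv m) (cid (unit y)) (by simp) ≫ᵥ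
        runitHom _ := by
      simpa using runitHom_natural (lunitInv m) (right_lunitInv m)
    rw [companionReshape, hcomp_vcomp_hcomp_assoc, vcomp_eq_assoc e, vcomp_assoc,
      runitHom_natural (hcomp F.η α F.right_η) (right_hcomp _ _ _), hcomp_vcomp_hcomp_assoc,
      hcomp_vcomp_hcomp_assoc]
    refine congrArg (· ≫ᵥ _) (hcomp_congr (by simp) ?_ _)
    simp [G.vcomp_eq]

/-- Naturality of sliding along the canonical isomorphisms between companions expresses `Φ'` as `Φ`
composed on both sides with whiskered isomorphisms. Hence a single invertible slid cell settles the
matter for all choices of companions. -/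
theorem IsReshape.invertible_of {x y w z : D} {f : x ⟶ w} {g : y ⟶ z} {F F' : Companion f}
    {G G' : Companion g} {m : Pro x y} {n : Pro w z} {α : Cell m n}
    {Φ : Cell (m ⊙ G.pro) (F.pro ⊙ n)} {Φ' : Cell (m ⊙ G'.pro) (F'.pro ⊙ n)}
    (h : IsReshape F G α Φ) (h' : IsReshape F' G' α Φ') (hΦ : IsInvertible Φ) :
    IsInvertible Φ' := by
  have e := h'.natural h (cid m) (cid n) (F'.lift F (𝟙 _) (𝟙 _) (by simp))
    (G'.lift G (𝟙 _) (𝟙 _) (by simp)) (by simp) (by rw [F'.η_lift]; simp)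
    (by rw [G'.η_lift]; simp) (by simp) (by simp) (by simp)
  have e' := h.natural h' (cid m) (cid n) (F.lift F' (𝟙 _) (𝟙 _) (by simp))
    (G.lift G' (𝟙 _) (𝟙 _) (by simp)) (by simp) (by rw [F.η_lift]; simp)
    (by rw [G.η_lift]; simp) (by simp) (by simp) (by simp)
  have e'' : Φ' = hcomp (cid m) (G'.lift G (𝟙 _) (𝟙 _) (by simp)) (by simp) ≫ᵥ Φ ≫ᵥ
      hcomp (F.lift F' (𝟙 _) (𝟙 _) (by simp)) (cid n) (by simp) := by
    rw [← e', hcomp_vcomp_hcomp_assoc]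
    have : hcomp (cid m ≫ᵥ cid m) (G'.lift G (𝟙 _) (𝟙 _) (by simp) ≫ᵥ
        G.lift G' (𝟙 _) (𝟙 _) (by simp)) (by simp) = cid _ := by
      refine (hcomp_congr (cid_vcomp _) ?_ _).trans (hcomp_cid m G'.pro (by simp))
      rw [Companion.lift_comp]; simpa using G'.lift_id
    rw [this, cid_vcomp]
  rw [e'']
  exact ((G'.lift_invertible G).whiskL _ _).vcomp (hΦ.vcomp ((F.lift_invertible F').whiskR _ _))

/-- A cell is a commuter as soon as some reshape of it is invertible. -/
theorem IsReshape.isCommuter {x y w z : D} {f : x ⟶ w} {g : y ⟶ z} {F : Companion f}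
    {G : Companion g} {m : Pro x y} {n : Pro w z} {α : Cell m n}
    {Φ : Cell (m ⊙ G.pro) (F.pro ⊙ n)} (h : IsReshape F G α Φ) (hΦ : IsInvertible Φ) :
    IsCommuter α := by
  obtain rfl := h.left_cell
  obtain rfl := h.right_cell
  exact ⟨⟨F⟩, ⟨G⟩, fun F' G' => h.invertible_of (isReshape_companionReshape α F' G') hΦ⟩

end Companions

/-! ### Horizontal duality -/

/-- The horizontal opposite of a double category: the same arrows and cells, with reversed
proarrows. -/
def HOp (D : Type u) : Type u := D

/-- Vertical composition is unchanged, associators are inverted and the two unitors trade places.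
Since all data are those of `D` up to order, statements in `HOp D` unfold definitionally to mirrored
statements in `D`. -/
instance hOpDoubleCategory (D : Type u) [DoubleCategory.{u, v, p, c} D] :
    DoubleCategory.{u, v, p, c} (HOp D) where
  toCategory := inferInstanceAs (Category D)
  Pro x y := Pro (D := D) y x
  Cell m n := Cell (D := D) m n
  left α := right (D := D) α
  right α := left (D := D) α
  cid m := cid (D := D) m
  vcomp α β := vcomp (D := D) α β
  left_cid m := right_cid (D := D) m
  right_cid m := left_cid (D := D) m
  left_vcomp α β := right_vcomp (D := D) α β
  right_vcomp α β := left_vcomp (D := D) α β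
  cid_vcomp α := cid_vcomp (D := D) α
  vcomp_cid α := vcomp_cid (D := D) α
  vcomp_assoc α β γ := vcomp_assoc (D := D) α β γ
  unit x := unit (D := D) x
  unitCell f := unitCell (D := D) f
  left_unitCell f := right_unitCell (D := D) f
  right_unitCell f := left_unitCell (D := D) f
  unitCell_id x := unitCell_id (D := D) x
  unitCell_comp f g := unitCell_comp (D := D) f g
  pcomp m n := pcomp (D := D) n m
  hcomp α β h := hcomp (D := D) β α h.symm
  left_hcomp α β h := right_hcomp (D := D) β α h.symm
  right_hcomp α β h := left_hcomp (D := D) β α h.symm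
  hcomp_cid m n h := hcomp_cid (D := D) n m h.symm
  hcomp_vcomp α β α' β' h h' h'' :=
    hcomp_vcomp (D := D) β α β' α' h.symm h'.symm h''.symm
  assocHom m n k := assocInv (D := D) k n m
  assocInv m n k := assocHom (D := D) k n m
  left_assocHom m n k := right_assocInv (D := D) k n m
  right_assocHom m n k := left_assocInv (D := D) k n m
  assocHom_inv m n k := assocInv_hom (D := D) k n m
  assocInv_hom m n k := assocHom_inv (D := D) k n m
  assoc_naturality α β γ h h' _ _ := assocInv_natural (D := D) γ β α h'.symm h.symm
  lunitHom m := runitHom (D := D) m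
  lunitInv m := runitInv (D := D) m
  left_lunitHom m := right_runitHom (D := D) m
  right_lunitHom m := left_runitHom (D := D) m
  lunitHom_inv m := runitHom_inv (D := D) m
  lunitInv_hom m := runitInv_hom (D := D) m
  lunit_naturality α h := runit_naturality (D := D) α h.symm
  runitHom m := lunitHom (D := D) m
  runitInv m := lunitInv (D := D) m
  left_runitHom m := right_lunitHom (D := D) m
  right_runitHom m := left_lunitHom (D := D) m
  runitHom_inv m := lunitHom_inv (D := D) m
  runitInv_hom m := lunitInv_hom (D := D) m
  runit_naturality α h := lunit_naturality (D := D) α h.symm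
  pentagon {x y z t s} m n k l _ _ := by
    -- With inverted associators and reversed order of composition, the axiom becomes the pentagon
    -- for inverse associators.
    have := congrArg GlobCell.val (Bicategory.pentagon_inv (B := UBicat D) (a := ⟨s⟩) (b := ⟨t⟩)
      (c := ⟨z⟩) (d := ⟨y⟩) (e := ⟨x⟩) l k n m)
    exact this
  triangle {x y z} m n _ _ := congrArg GlobCell.val
    (Bicategory.triangle_assoc_comp_right (B := UBicat D) (a := ⟨z⟩) (b := ⟨y⟩) (c := ⟨x⟩) n m)

/-! ### Conjoints and sliding along them -/

section Conjoints

variable {D : Type u} [DoubleCategory.{u, v, p, c} D]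

namespace Conjoint

attribute [simp] left_η right_η left_ε right_ε

/-- A conjoint of an arrow is a companion of it in the horizontal opposite. -/
def toHOp {x y : D} {f : x ⟶ y} (F : Conjoint f) :
    Companion (D := HOp D) (x := x) (y := y) f where
  pro := F.pro
  η := F.η
  ε := F.ε
  left_η := F.right_η
  right_η := F.left_η
  left_ε := F.right_ε
  right_ε := F.left_ε
  hcomp_eq := F.hcomp_eq
  vcomp_eq := F.vcomp_eq

section

variable {x y x' y' : D} {f : x ⟶ y} {f' : x' ⟶ y'} (F : Conjoint f) (F' : Conjoint f')
    (a : x ⟶ x') (b : y ⟶ y') (h : a ≫ f' = f ≫ b)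

/-- The cell between conjoints induced by a commutative square of arrows. -/
def lift : Cell F.pro F'.pro := F.toHOp.lift F'.toHOp a b h

@[simp] theorem left_lift : left (F.lift F' a b h) = b := F.toHOp.right_lift F'.toHOp a b h

@[simp] theorem right_lift : right (F.lift F' a b h) = a := F.toHOp.left_lift F'.toHOp a b h

theorem η_lift : F.η ≫ᵥ F.lift F' a b h = unitCell a ≫ᵥ F'.η := F.toHOp.η_lift F'.toHOp a b h

theorem lift_ε : F.lift F' a b h ≫ᵥ F'.ε = F.ε ≫ᵥ unitCell b := F.toHOp.lift_ε F'.toHOp a b h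

theorem lift_id : F.lift F (𝟙 x) (𝟙 y) (by simp) = cid F.pro := F.toHOp.lift_id

theorem lift_comp {x'' y'' : D} {f'' : x'' ⟶ y''} (F'' : Conjoint f'') (a' : x' ⟶ x'')
    (b' : y' ⟶ y'') (h' : a' ≫ f'' = f' ≫ b') :
    F.lift F' a b h ≫ᵥ F'.lift F'' a' b' h' =
      F.lift F'' (a ≫ a') (b ≫ b') (by rw [Category.assoc, h', ← Category.assoc, h,
        Category.assoc]) :=
  F.toHOp.lift_comp F'.toHOp a b h F''.toHOp a' b' h'

end

end Conjoint

/-- `Φ : f^* ⊙ m → n ⊙ g^*` is obtained from `α : m → n` by sliding its boundaries `f` and `g`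
along conjoints. -/
structure IsCoreshape {x y w z : D} {f : x ⟶ w} {g : y ⟶ z} (F : Conjoint f) (G : Conjoint g)
    {m : Pro x y} {n : Pro w z} (α : Cell m n) (Φ : Cell (F.pro ⊙ m) (n ⊙ G.pro)) : Prop where
  left_cell : left α = f
  right_cell : right α = g
  left_eq : left Φ = 𝟙 w
  hcomp_η : hcomp F.η (cid m) (by simp) ≫ᵥ Φ =
    lunitHom m ≫ᵥ runitInv m ≫ᵥ hcomp α G.η (by simp [right_cell])

namespace IsCoreshape

variable {x y w z : D} {f : x ⟶ w} {g : y ⟶ z} {F : Conjoint f} {G : Conjoint g}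
    {m : Pro x y} {n : Pro w z} {α : Cell m n} {Φ : Cell (F.pro ⊙ m) (n ⊙ G.pro)}

/-- Reversal exchanges the left and right boundaries of `α`, so `F` and `G` swap roles. -/
theorem toHOp (h : IsCoreshape F G α Φ) :
    IsReshape (D := HOp D) G.toHOp F.toHOp (m := m) (n := n) α Φ where
  left_cell := h.right_cell
  right_cell := h.left_cell
  right_eq := h.left_eq
  hcomp_η := h.hcomp_η

theorem of_hOp (h : IsReshape (D := HOp D) G.toHOp F.toHOp (m := m) (n := n) α Φ) :
    IsCoreshape F G α Φ where
  left_cell := h.right_cell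
  right_cell := h.left_cell
  left_eq := h.right_eq
  hcomp_η := h.hcomp_η

theorem right_eq (h : IsCoreshape F G α Φ) : right Φ = 𝟙 y := h.toHOp.left_eq

theorem hcomp_ε (h : IsCoreshape F G α Φ) :
    Φ ≫ᵥ hcomp (cid n) G.ε (by simp) =
      hcomp F.ε α (by simp [h.left_cell]) ≫ᵥ lunitHom n ≫ᵥ runitInv n :=
  h.toHOp.hcomp_ε

/-- Reshaping is natural. -/
theorem natural {x' y' w' z' : D} {f' : x' ⟶ w'} {g' : y' ⟶ z'} {F' : Conjoint f'}
    {G' : Conjoint g'} {m' : Pro x' y'} {n' : Pro w' z'} {α' : Cell m' n'}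
    {Φ' : Cell (F'.pro ⊙ m') (n' ⊙ G'.pro)} (h : IsCoreshape F G α Φ)
    (h' : IsCoreshape F' G' α' Φ')
    (σ : Cell m m') (τ : Cell n n') (φ : Cell F.pro F'.pro) (ψ : Cell G.pro G'.pro)
    (e : σ ≫ᵥ α' = α ≫ᵥ τ) (hφ : F.η ≫ᵥ φ = unitCell (left σ) ≫ᵥ F'.η)
    (hψ : G.η ≫ᵥ ψ = unitCell (right σ) ≫ᵥ G'.η) (hφτ : left φ = left τ)
    (hψτ : right τ = left ψ) (hσφ : right φ = left σ) :
    hcomp φ σ hσφ ≫ᵥ Φ' = Φ ≫ᵥ hcomp τ ψ hψτ :=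
  h.toHOp.natural h'.toHOp σ τ ψ φ e hψ hφ hψτ.symm hφτ hσφ.symm

/-- The reshape of the external identity on an arrow. -/
theorem of_unitCell (F : Conjoint f) :
    IsCoreshape F F (unitCell f) (runitHom F.pro ≫ᵥ lunitInv F.pro) :=
  of_hOp (IsReshape.of_unitCell F.toHOp)

/-- The reshape of an external composite of cells. -/
theorem of_hcomp {x y z x' y' z' : D} {f : x ⟶ x'} {g : y ⟶ y'} {k : z ⟶ z'}
    {F : Conjoint f} {G : Conjoint g} {K : Conjoint k} {m : Pro x y} {n : Pro y z}
    {m' : Pro x' y'} {n' : Pro y' z'} {α : Cell m m'} {β : Cell n n'}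
    {Φ : Cell (F.pro ⊙ m) (m' ⊙ G.pro)} {Ψ : Cell (G.pro ⊙ n) (n' ⊙ K.pro)}
    (hΦ : IsCoreshape F G α Φ) (hΨ : IsCoreshape G K β Ψ) :
    IsCoreshape F K (hcomp α β (by rw [hΦ.right_cell, hΨ.left_cell]))
      (assocInv F.pro m n ≫ᵥ hcomp Φ (cid n) (by simp [hΦ.right_eq]) ≫ᵥ
        assocHom m' G.pro n ≫ᵥ hcomp (cid m') Ψ (by simp [hΨ.left_eq]) ≫ᵥ
          assocInv m' n' K.pro) :=
  of_hOp (IsReshape.of_hcomp hΨ.toHOp hΦ.toHOp)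

end IsCoreshape

/-- The pasting that defines `conjointReshape` brackets its factors and places its unitors
differently from the mirror image of `companionReshape`, so duality does not apply literally. The
computation again makes η and ε of the left conjoint cancel. -/
theorem isCoreshape_conjointReshape {x y w z : D} {m : Pro x y} {n : Pro w z} (α : Cell m n)
    (F : Conjoint (left α)) (G : Conjoint (right α)) :
    IsCoreshape F G α (conjointReshape α F G) where
  left_cell := rfl
  right_cell := rfl
  left_eq := by simp [conjointReshape]
  hcomp_η := by
    have e := runitInv_natural (hcomp F.η (cid m) (by simp)) (right_hcomp _ _ _)
    have e₁ : runitInv (unit x ⊙ m) ≫ᵥ hcomp (lunitHom m) (cid (unit y)) (by simp) =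
        lunitHom m ≫ᵥ runitInv m := by
      simpa using (runitInv_natural (lunitHom m) (right_lunitHom m)).symm
    have e₂ : hcomp F.η (cid m) (by simp) ≫ᵥ hcomp F.ε α F.right_ε =
        hcomp (unitCell (left α)) α (by simp) := by
      rw [hcomp_vcomp_hcomp]
      exact hcomp_congr F.vcomp_eq (cid_vcomp _) _
    rw [conjointReshape, vcomp_eq_vcomp_assoc e, hcomp_vcomp_hcomp_assoc, hcomp_vcomp_hcomp,
      ← vcomp_eq_vcomp_assoc e₁]
    refine congrArg (_ ≫ᵥ ·) ((hcomp_congr (α' := lunitHom m ≫ᵥ α)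
      (β' := cid (unit y) ≫ᵥ G.η) ?_ (by simp) _).trans
      (hcomp_vcomp_hcomp _ _ _ _ (by simp) (by simp)).symm)
    rw [e₂, lunitHom_natural α rfl]

/-- A cell is a cocommuter as soon as some reshape of it is invertible. -/
theorem IsCoreshape.isCocommuter {x y w z : D} {f : x ⟶ w} {g : y ⟶ z} {F : Conjoint f}
    {G : Conjoint g} {m : Pro x y} {n : Pro w z} {α : Cell m n}
    {Φ : Cell (F.pro ⊙ m) (n ⊙ G.pro)} (h : IsCoreshape F G α Φ) (hΦ : IsInvertible Φ) :
    IsCocommuter α := by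
  obtain rfl := h.left_cell
  obtain rfl := h.right_cell
  exact ⟨⟨F⟩, ⟨G⟩, fun F' G' => h.toHOp.invertible_of
    (isCoreshape_conjointReshape α F' G').toHOp hΦ⟩

end Conjoints

end DoubleCategory
-- Companions and conjoints of natural transformations from pointwise ones
section LaxPsCompanions

variable {D : Type u₁} [DoubleCategory.{u₁, v₁, p₁, c₁} D]
  {E : Type u₂} [DoubleCategory.{u₂, v₂, p₂, c₂} E] {F G : LaxDoubleFunctor D E}

theorem DoubleCategory.hcomp_eq_cid {x y z : E} {m : Pro x y} {n : Pro y z} {α : Cell m m}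
    {β : Cell n n} (hα : α = cid m) (hβ : β = cid n) (h : right α = left β) :
    hcomp α β h = cid (m ⊙ n) :=
  (hcomp_congr hα hβ h).trans (hcomp_cid m n _)

/-- The protransformation whose components are companions of the components of a natural
transformation, and whose comparisons are inverse to the reshapes of its component cells. -/
def companionProtransformation (α : F ⟶ G) (C : ∀ x, Companion (DoubleNatTrans.app α x))
    (Φ : ∀ {x y : D} (m : Pro x y),
      Cell (F.mapPro m ⊙ (C y).pro) ((C x).pro ⊙ G.mapPro m))
    (Ψ : ∀ {x y : D} (m : Pro x y),
      Cell ((C x).pro ⊙ G.mapPro m) (F.mapPro m ⊙ (C y).pro))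
    (hΦ : ∀ {x y : D} (m : Pro x y), IsReshape (C x) (C y) (DoubleNatTrans.cell α m) (Φ m))
    (h₁ : ∀ {x y : D} (m : Pro x y), Φ m ≫ᵥ Ψ m = cid _)
    (h₂ : ∀ {x y : D} (m : Pro x y), Ψ m ≫ᵥ Φ m = cid _) : Protransformation F G where
  app x := (C x).pro
  map {x y} f := (C x).lift (C y) (F.map f) (G.map f) (DoubleNatTrans.naturality α f)
  left_map f := by simp
  right_map f := by simp
  map_id x := by
    simp only [CategoryTheory.Functor.map_id]
    exact (C x).lift_id
  map_comp f g := by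
    rw [Companion.lift_comp]
    simp only [CategoryTheory.Functor.map_comp]
  nat m := Ψ m
  left_nat m := left_eq_id_of_inv (h₁ m) (hΦ m).left_eq
  right_nat m := right_eq_id_of_inv (h₁ m) (hΦ m).right_eq
  nat_invertible m := ⟨Φ m, h₂ m, h₁ m⟩
  nat_cell {x y w z m n} a h h' := by
    -- Naturality of sliding concerns `Φ`. Moving the inverses `Ψ` to the opposite sides of the
    -- square gives the same law for the comparisons.
    refine swap_inv (IsReshape.natural (hΦ m) (hΦ n) (F.mapCell a) (G.mapCell a) _ _
      (DoubleNatTrans.cell_naturality α a) ?_ ?_ h' (by simp) h) (h₂ m) (h₁ n)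
    · rw [Companion.η_lift, F.left_mapCell]
    · rw [Companion.η_lift, F.right_mapCell]
  nat_comp {x y z} m n k₁ k₂ k₃ k₄ := by
    -- The pasting of `Φ m` and `Φ n` slides the external composite of the two component cells. By
    -- `comp_cell` the laxity cells of `F` and `G` relate that composite to the component at `m ⊙
    -- n`, and naturality of sliding transfers this relation.
    have e := (IsReshape.of_hcomp (hΦ m) (hΦ n)).natural (hΦ (m ⊙ n)) (F.comp m n) (G.comp m n)
      (cid _) (cid _) (DoubleNatTrans.comp_cell α m n (by simp)) (by simp) (by simp) k₁ (by simp)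
      k₄
    -- The chosen `μ'` is the inverse of that pasting, factor by factor in reverse order. It is the
    -- composite that the protransformation axiom prescribes.
    refine (swap_inv e (c := (C x).pro ⊙ G.mapPro m ⊙ G.mapPro n)
      (μ' := assocInv _ _ _ ≫ᵥ hcomp (Ψ m) (cid _) k₂ ≫ᵥ assocHom _ _ _ ≫ᵥ
        hcomp (cid _) (Ψ n) k₃ ≫ᵥ assocInv _ _ _) ?_ (h₁ (m ⊙ n))).symm.trans ?_
    · simp only [vcomp_assoc, assocInv_hom_assoc]
      rw [hcomp_vcomp_hcomp_assoc, hcomp_eq_cid (cid_vcomp _) (h₂ n), cid_vcomp,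
        assocHom_inv_assoc, hcomp_vcomp_hcomp_assoc, hcomp_eq_cid (h₂ m) (cid_vcomp _), cid_vcomp,
        assocInv_hom]
    · simp only [vcomp_assoc]
  nat_unit x k₁ k₂ := by
    -- The same argument as for composites, starting from the external identity on the component
    -- arrow, whose slid cell consists of unitors only.
    have e := (IsReshape.of_unitCell (C x)).natural (hΦ (unit x)) (F.idn x) (G.idn x)
      (cid _) (cid _) (DoubleNatTrans.idn_cell α x) (by simp) (by simp) k₁ (by simp) k₂
    refine (swap_inv e (μ' := runitHom _ ≫ᵥ lunitInv _) ?_ (h₁ (unit x))).symm.trans ?_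
    · simp
    · simp

/-- A natural transformation between lax double functors has a companion as soon as its component
cells are commuters. -/
theorem nonempty_companion_of_isCommuter (α : F ⟶ G)
    (C : ∀ x, Nonempty (Companion (DoubleNatTrans.app α x)))
    (hα : ∀ {x y : D} (m : Pro x y), IsCommuter (DoubleNatTrans.cell α m)) :
    Nonempty (Companion (D := LaxDoubleFunctor D E) α) := by
  have C x := (C x).some
  have key : ∀ {x y : D} (m : Pro x y), ∃ Φ : Cell (F.mapPro m ⊙ (C y).pro)
      ((C x).pro ⊙ G.mapPro m), IsReshape (C x) (C y) (DoubleNatTrans.cell α m) Φ ∧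
      IsInvertible Φ := fun {x y} m => by
    obtain ⟨-, -, hm⟩ := hα m
    -- The commuter hypothesis is about companions of the boundaries of the component cell, whereas
    -- `C` chooses companions of the component arrows. These arrows are equal only propositionally,
    -- so the cell and arrows are made variables before the equations are substituted.
    generalize C x = A, C y = B, hβ : DoubleNatTrans.cell α m = β at *
    have hl : left β = DoubleNatTrans.app α x := by rw [← hβ]; simp
    have hr : right β = DoubleNatTrans.app α y := by rw [← hβ]; simp
    clear hβ
    generalize DoubleNatTrans.app α x = f, DoubleNatTrans.app α y = g at *
    subst hl hr
    exact ⟨_, isReshape_companionReshape β A B, hm A B⟩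
  choose Φ hΦ hi using @key
  choose Ψ h₁ h₂ using @hi
  let P := companionProtransformation α C (fun m => Φ m) (fun m => Ψ m) (fun m => hΦ m)
    (fun m => h₁ m) (fun m => h₂ m)
  let η : Modification (Protransformation.idn F) P :=
    { src := 𝟙 F
      tgt := α
      app x := (C x).η
      left_app x := (C x).left_η
      right_app x := (C x).right_η
      app_map f := (C _).η_lift (C _) _ _ (DoubleNatTrans.naturality α f)
      app_nat {x y} m h h' := by
        -- Compatibility of the units with the comparisons is the characterisation of `Φ m` by η,
        -- solved for its inverse `Ψ m`.
        have := congrArg (fun t => lunitHom (F.mapPro m) ≫ᵥ runitInv (F.mapPro m) ≫ᵥ t ≫ᵥ Ψ m)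
          (hΦ m).hcomp_η
        simp only [vcomp_assoc, h₁, vcomp_cid, runitInv_hom_assoc, lunitHom_inv_assoc] at this
        exact this.symm.trans (vcomp_assoc _ _ _).symm }
  let ε : Modification P (Protransformation.idn G) :=
    { src := α
      tgt := 𝟙 G
      app x := (C x).ε
      left_app x := (C x).left_ε
      right_app x := (C x).right_ε
      app_map f := ((C _).lift_ε (C _) _ _ (DoubleNatTrans.naturality α f)).symm
      app_nat {x y} m h h' := by
        -- Likewise for the counits, using the equation with ε.
        have := congrArg (fun t => Ψ m ≫ᵥ t ≫ᵥ lunitHom (G.mapPro m) ≫ᵥ runitInv (G.mapPro m))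
          (hΦ m).hcomp_ε
        simp only [vcomp_assoc, lunitInv_hom_assoc, runitHom_inv, vcomp_cid] at this
        rw [vcomp_eq_assoc (h₂ m), cid_vcomp] at this
        exact this }
  exact ⟨{
    pro := P
    η := η
    ε := ε
    left_η := rfl
    right_η := rfl
    left_ε := rfl
    right_ε := rfl
    hcomp_eq := Modification.ext ((Category.id_comp _).trans (Category.id_comp _))
      ((Category.id_comp _).trans (Category.id_comp _)) (funext fun x => (C x).hcomp_eq)
    vcomp_eq := Modification.ext (Category.id_comp _) (Category.comp_id _)
      (funext fun x => (C x).vcomp_eq) }⟩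

/-- The protransformation whose components are conjoints of the components of a natural
transformation, and whose comparisons are the reshapes of its component cells. -/
def conjointProtransformation (α : F ⟶ G) (C : ∀ x, Conjoint (DoubleNatTrans.app α x))
    (Φ : ∀ {x y : D} (m : Pro x y),
      Cell ((C x).pro ⊙ F.mapPro m) (G.mapPro m ⊙ (C y).pro))
    (hΦ : ∀ {x y : D} (m : Pro x y), IsCoreshape (C x) (C y) (DoubleNatTrans.cell α m) (Φ m))
    (hi : ∀ {x y : D} (m : Pro x y), IsInvertible (Φ m)) : Protransformation G F where
  app x := (C x).pro
  map {x y} f := (C x).lift (C y) (F.map f) (G.map f) (DoubleNatTrans.naturality α f)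
  left_map f := by simp
  right_map f := by simp
  map_id x := by
    simp only [CategoryTheory.Functor.map_id]
    exact (C x).lift_id
  map_comp f g := by
    rw [Conjoint.lift_comp]
    simp only [CategoryTheory.Functor.map_comp]
  -- Sliding along conjoints already points in the direction required of a comparison. Invertibility
  -- enters only to make the protransformation pseudo.
  nat m := Φ m
  left_nat m := (hΦ m).left_eq
  right_nat m := (hΦ m).right_eq
  nat_invertible m := hi m
  nat_cell {x y w z m n} a h h' := by
    refine (IsCoreshape.natural (hΦ m) (hΦ n) (F.mapCell a) (G.mapCell a) _ _
      (DoubleNatTrans.cell_naturality α a) ?_ ?_ (by simp) h h').symm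
    · rw [Conjoint.η_lift, F.left_mapCell]
    · rw [Conjoint.η_lift, F.right_mapCell]
  nat_comp {x y z} m n k₁ k₂ k₃ k₄ := by
    -- The pasting produced by `of_hcomp` is the right-hand composite of the axiom up to bracketing,
    -- so nothing has to be inverted.
    have e := (IsCoreshape.of_hcomp (hΦ m) (hΦ n)).natural (hΦ (m ⊙ n)) (F.comp m n) (G.comp m n)
      (cid _) (cid _) (DoubleNatTrans.comp_cell α m n (by simp)) (by simp) (by simp) (by simp) k₄
      k₁
    simpa only [vcomp_assoc] using e
  nat_unit x k₁ k₂ := by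
    have e := (IsCoreshape.of_unitCell (C x)).natural (hΦ (unit x)) (F.idn x) (G.idn x)
      (cid _) (cid _) (DoubleNatTrans.idn_cell α x) (by simp) (by simp) (by simp) k₂ k₁
    simpa only [vcomp_assoc] using e

/-- A natural transformation between lax double functors has a conjoint as soon as its component
cells are cocommuters. -/
theorem nonempty_conjoint_of_isCocommuter (α : F ⟶ G)
    (C : ∀ x, Nonempty (Conjoint (DoubleNatTrans.app α x)))
    (hα : ∀ {x y : D} (m : Pro x y), IsCocommuter (DoubleNatTrans.cell α m)) :
    Nonempty (Conjoint (D := LaxDoubleFunctor D E) α) := by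
  have C x := (C x).some
  have key : ∀ {x y : D} (m : Pro x y), ∃ Φ : Cell ((C x).pro ⊙ F.mapPro m)
      (G.mapPro m ⊙ (C y).pro), IsCoreshape (C x) (C y) (DoubleNatTrans.cell α m) Φ ∧
      IsInvertible Φ := fun {x y} m => by
    obtain ⟨-, -, hm⟩ := hα m
    generalize C x = A, C y = B, hβ : DoubleNatTrans.cell α m = β at *
    have hl : left β = DoubleNatTrans.app α x := by rw [← hβ]; simp
    have hr : right β = DoubleNatTrans.app α y := by rw [← hβ]; simp
    clear hβ
    generalize DoubleNatTrans.app α x = f, DoubleNatTrans.app α y = g at *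
    subst hl hr
    exact ⟨_, isCoreshape_conjointReshape β A B, hm A B⟩
  choose Φ hΦ hi using @key
  let P := conjointProtransformation α C (fun m => Φ m) (fun m => hΦ m) (fun m => hi m)
  let η : Modification (Protransformation.idn F) P :=
    { src := α
      tgt := 𝟙 F
      app x := (C x).η
      left_app x := (C x).left_η
      right_app x := (C x).right_η
      app_map f := (C _).η_lift (C _) _ _ (DoubleNatTrans.naturality α f)
      app_nat {x y} m h h' := (hΦ m).hcomp_η.trans (vcomp_assoc _ _ _).symm }
  let ε : Modification P (Protransformation.idn G) :=
    { src := 𝟙 G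
      tgt := α
      app x := (C x).ε
      left_app x := (C x).left_ε
      right_app x := (C x).right_ε
      app_map f := ((C _).lift_ε (C _) _ _ (DoubleNatTrans.naturality α f)).symm
      app_nat {x y} m h h' := (hΦ m).hcomp_ε.symm }
  exact ⟨{
    pro := P
    η := η
    ε := ε
    left_η := rfl
    right_η := rfl
    left_ε := rfl
    right_ε := rfl
    hcomp_eq := Modification.ext ((Category.id_comp _).trans (Category.id_comp _))
      ((Category.id_comp _).trans (Category.id_comp _)) (funext fun x => (C x).hcomp_eq)
    vcomp_eq := Modification.ext (Category.comp_id _) (Category.id_comp _)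
      (funext fun x => (C x).vcomp_eq) }⟩

end LaxPsCompanions

/-! ### Recognising coproducts of span-indexed families -/

section SigmaCompanions

variable {D : Type u} [DoubleCategory.{u, v, p, c} D] {s : IndexSize}

namespace StrongCoproducts

variable (S : StrongCoproducts.{w} s D) {I J K : Type w} [s.Admits I] [s.Admits J] [s.Admits K]

/-- The coprojection cells of the coproduct of a family of proarrows. -/
def coproj {A : Type w} [s.Admits A] {x : I → D} {y : J → D} (l : A → I) (r : A → J)
    (m : ∀ a, Pro (x (l a)) (y (r a))) (a : A) :
    Cell (m a) (S.pro (SpanFamily.mk (x := x) (y := y) A l r m)) :=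
  S.ιCell (SpanFamily.mk (x := x) (y := y) A l r m) a

/-- The coprojection cells of the coproduct of a parallel family of proarrows. -/
def parallelCoproj {x y : I → D} (m : ∀ i, Pro (x i) (y i)) (i : I) :
    Cell (m i) (S.pro (SpanFamily.parallel m)) :=
  S.ιCell (SpanFamily.parallel m) i

section

variable {A : Type w} {x : I → D} {y : J → D} {z : K → D}

@[simp] theorem left_coproj [s.Admits A] (l : A → I) (r : A → J) (m : ∀ a, Pro (x (l a)) (y (r a)))
    (a : A) : left (S.coproj l r m a) = S.ι x (l a) :=
  S.left_ιCell (SpanFamily.mk A l r m) a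

@[simp] theorem right_coproj [s.Admits A] (l : A → I) (r : A → J) (m : ∀ a, Pro (x (l a)) (y (r a)))
    (a : A) : right (S.coproj l r m a) = S.ι y (r a) :=
  S.right_ιCell (SpanFamily.mk A l r m) a

@[simp] theorem left_parallelCoproj {x y : I → D} (m : ∀ i, Pro (x i) (y i)) (i : I) :
    left (S.parallelCoproj m i) = S.ι x i := S.left_ιCell (SpanFamily.parallel m) i

@[simp] theorem right_parallelCoproj {x y : I → D} (m : ∀ i, Pro (x i) (y i)) (i : I) :
    right (S.parallelCoproj m i) = S.ι y i := S.right_ιCell (SpanFamily.parallel m) i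

theorem parallelCoproj_structCell (f : I → J) {x y : J → D} (m : ∀ j, Pro (x j) (y j)) (i : I) :
    S.parallelCoproj (fun i => m (f i)) i ≫ᵥ S.structCell f m = S.parallelCoproj m (f i) :=
  S.ι_structCell f m i

/-- The cells `κ` exhibit `W` as a coproduct of the family of proarrows `k`. -/
structure IsCoproduct (l : A → I) (r : A → J) (k : ∀ a, Pro (x (l a)) (y (r a)))
    (W : Pro (S.obj x) (S.obj y)) (κ : ∀ a, Cell (k a) W) : Prop where
  left_cell : ∀ a, left (κ a) = S.ι x (l a)
  right_cell : ∀ a, right (κ a) = S.ι y (r a)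
  exists_desc : ∀ {t t' : D} {n : Pro t t'} (g : ∀ i, x i ⟶ t) (h : ∀ j, y j ⟶ t')
    (c : ∀ a, Cell (k a) n), (∀ a, left (c a) = g (l a)) → (∀ a, right (c a) = h (r a)) →
      ∃ δ : Cell W n, left δ = S.desc g ∧ right δ = S.desc h ∧ ∀ a, κ a ≫ᵥ δ = c a
  ext : ∀ {t t' : D} {n : Pro t t'} {α β : Cell W n}, left α = left β → right α = right β →
    (∀ a, κ a ≫ᵥ α = κ a ≫ᵥ β) → α = β

/-- This carries the universal property from the coproduct of a composite family to the composite of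
coproducts, along the comparison cell. -/
theorem IsCoproduct.of_invertible {S : StrongCoproducts.{w} s D} {l : A → I} {r : A → J}
    {k : ∀ a, Pro (x (l a)) (y (r a))} {W : Pro (S.obj x) (S.obj y)} {κ : ∀ a, Cell (k a) W}
    (hκ : S.IsCoproduct l r k W κ) {W' : Pro (S.obj x) (S.obj y)} {Ω : Cell W W'}
    (hΩ : IsInvertible Ω) (hl : left Ω = 𝟙 _) (hr : right Ω = 𝟙 _) :
    S.IsCoproduct l r k W' fun a => κ a ≫ᵥ Ω where
  left_cell a := by rw [left_vcomp, hκ.left_cell, hl, Category.comp_id]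
  right_cell a := by rw [right_vcomp, hκ.right_cell, hr, Category.comp_id]
  exists_desc g h c hcl hcr := by
    obtain ⟨δ, h₁, h₂, h₃⟩ := hκ.exists_desc g h c hcl hcr
    refine ⟨hΩ.inv ≫ᵥ δ, ?_, ?_, fun a => ?_⟩
    · rw [left_vcomp, left_eq_id_of_inv hΩ.hom_inv hl, Category.id_comp, h₁]
    · rw [right_vcomp, right_eq_id_of_inv hΩ.hom_inv hr, Category.id_comp, h₂]
    · rw [vcomp_assoc, vcomp_eq_assoc hΩ.hom_inv, cid_vcomp, h₃]
  ext {t t' n α β} hαl hαr h := by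
    have := hκ.ext (α := Ω ≫ᵥ α) (β := Ω ≫ᵥ β) (by simp [hαl]) (by simp [hαr])
      fun a => by simpa only [vcomp_assoc] using h a
    have := congrArg (hΩ.inv ≫ᵥ ·) this
    simpa only [vcomp_eq_assoc hΩ.inv_hom, cid_vcomp] using this

/-- The family may be replaced by an isomorphic one. It is used with unitors, to discard identity
factors from m ⊙ id and id ⊙ m. -/
theorem IsCoproduct.precomp {S : StrongCoproducts.{w} s D} {l : A → I} {r : A → J}
    {k k' : ∀ a, Pro (x (l a)) (y (r a))} {W : Pro (S.obj x) (S.obj y)} {κ : ∀ a, Cell (k a) W}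
    (hκ : S.IsCoproduct l r k W κ) (θ : ∀ a, Cell (k' a) (k a)) (hθ : ∀ a, IsInvertible (θ a))
    (hl : ∀ a, left (θ a) = 𝟙 _) (hr : ∀ a, right (θ a) = 𝟙 _) :
    S.IsCoproduct l r k' W fun a => θ a ≫ᵥ κ a where
  left_cell a := by rw [left_vcomp, hκ.left_cell, hl, Category.id_comp]
  right_cell a := by rw [right_vcomp, hκ.right_cell, hr, Category.id_comp]
  exists_desc g h c hcl hcr := by
    obtain ⟨δ, h₁, h₂, h₃⟩ := hκ.exists_desc g h (fun a => (hθ a).inv ≫ᵥ c a)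
      (fun a => by rw [left_vcomp, left_eq_id_of_inv (hθ a).hom_inv (hl a), Category.id_comp, hcl])
      (fun a => by
        rw [right_vcomp, right_eq_id_of_inv (hθ a).hom_inv (hr a), Category.id_comp, hcr])
    refine ⟨δ, h₁, h₂, fun a => ?_⟩
    rw [vcomp_assoc, h₃, vcomp_eq_assoc (hθ a).hom_inv, cid_vcomp]
  ext hαl hαr h := hκ.ext hαl hαr fun a => by
    have := congrArg ((hθ a).inv ≫ᵥ ·) (h a)
    simpa only [vcomp_assoc, vcomp_eq_assoc (hθ a).inv_hom, cid_vcomp] using this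

/-- The usual uniqueness of universal objects. The boundaries are identities because both coproducts
induce the coprojections of objects. This is the source of every invertible slid cell below. -/
theorem IsCoproduct.exists_invertible {S : StrongCoproducts.{w} s D} {l : A → I} {r : A → J}
    {k : ∀ a, Pro (x (l a)) (y (r a))} {W W' : Pro (S.obj x) (S.obj y)}
    {κ : ∀ a, Cell (k a) W} {κ' : ∀ a, Cell (k a) W'} (hκ : S.IsCoproduct l r k W κ)
    (hκ' : S.IsCoproduct l r k W' κ') :
    ∃ Φ : Cell W W', IsInvertible Φ ∧ left Φ = 𝟙 _ ∧ right Φ = 𝟙 _ ∧ ∀ a, κ a ≫ᵥ Φ = κ' a := by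
  obtain ⟨Φ, h₁, h₂, h₃⟩ := hκ.exists_desc _ _ κ' hκ'.left_cell hκ'.right_cell
  obtain ⟨Ψ, h₁', h₂', h₃'⟩ := hκ'.exists_desc _ _ κ hκ.left_cell hκ.right_cell
  rw [S.desc_ι] at h₁ h₂ h₁' h₂'
  refine ⟨Φ, ⟨Ψ, ?_, ?_⟩, h₁, h₂, h₃⟩
  · exact hκ.ext (by simp [h₁, h₁']) (by simp [h₂, h₂']) fun a => by
      rw [vcomp_eq_assoc (h₃ a), h₃', vcomp_cid]
  · exact hκ'.ext (by simp [h₁, h₁']) (by simp [h₂, h₂']) fun a => by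
      rw [vcomp_eq_assoc (h₃' a), h₃, vcomp_cid]

/-- Coproducts of families commute with composition, when the left leg of the second span is an
identity. -/
theorem isCoproduct_pcomp_right [s.Admits A] (l : A → I) (r : A → J)
    (m : ∀ a, Pro (x (l a)) (y (r a))) (q : J → K) (n : ∀ j, Pro (y j) (z (q j))) :
    S.IsCoproduct l (fun a => q (r a)) (fun a => m a ⊙ n (r a))
      (S.pro (SpanFamily.mk A l r m) ⊙ S.pro (SpanFamily.mk J (fun j => j) q n))
      fun a => hcomp (S.coproj l r m a) (S.coproj (fun j => j) q n (r a)) (by simp) := by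
  let M : SpanFamily x y := ⟨A, l, r, m⟩
  let N : SpanFamily y z := ⟨J, fun j => j, q, n⟩
  -- The left leg of `N` is an identity, so every point of the pullback has the form (a, r a) and
  -- the composite family can be indexed by `A`.
  let κ : ∀ a, Cell (m a ⊙ n (r a)) (S.pro (M.comp N)) :=
    fun a => S.ιCell (M.comp N) ⟨(a, r a), rfl⟩
  have hκ : S.IsCoproduct l (fun a => q (r a)) (fun a => m a ⊙ n (r a)) (S.pro (M.comp N)) κ :=
    { left_cell a := S.left_ιCell (M.comp N) ⟨(a, r a), rfl⟩
      right_cell a := S.right_ιCell (M.comp N) ⟨(a, r a), rfl⟩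
      exists_desc {t t' k} g h c hl hr := by
        -- After the pullback equation is substituted, the transport in the composite family becomes
        -- trivial. The boundary equations are bundled with the cell so that they survive the case
        -- split.
        let γ : ∀ b : (M.comp N).apex, { α : Cell ((M.comp N).pro b) k //
            left α = g ((M.comp N).l b) ∧ right α = h ((M.comp N).r b) } := fun b =>
          match b with
          | ⟨(a, j), e⟩ => by
            change r a = j at e
            subst e
            exact ⟨c a, hl a, hr a⟩
        exact ⟨S.descCell (m := M.comp N) ⟨g, h, fun b => (γ b).1, fun b => (γ b).2.1,
          fun b => (γ b).2.2⟩, S.left_descCell _, S.right_descCell _,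
          fun a => S.ιCell_descCell (m := M.comp N) _ ⟨(a, r a), rfl⟩⟩
      ext hl hr h := S.cell_ext _ _ hl hr fun b => by
        obtain ⟨⟨a, j⟩, e⟩ := b
        change r a = j at e
        subst e
        exact h a }
  have e a : κ a ≫ᵥ S.compComparison M N =
      hcomp (S.coproj l r m a) (S.coproj (fun j => j) q n (r a)) (by simp) :=
    S.ι_compComparison M N ⟨(a, r a), rfl⟩
  simp only [← e]
  exact hκ.of_invertible (S.comp_invertible M N) ((S.left_descCell _).trans (S.desc_ι x))
    ((S.right_descCell _).trans (S.desc_ι z))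

/-- Coproducts of families commute with composition, when the right leg of the first span is an
identity. -/
theorem isCoproduct_pcomp_left [s.Admits A] (q : J → I) (m : ∀ j, Pro (x (q j)) (y j))
    (l : A → J) (r : A → K) (n : ∀ a, Pro (y (l a)) (z (r a))) :
    S.IsCoproduct (fun a => q (l a)) r (fun a => m (l a) ⊙ n a)
      (S.pro (SpanFamily.mk J q (fun j => j) m) ⊙ S.pro (SpanFamily.mk A l r n))
      fun a => hcomp (S.coproj q (fun j => j) m (l a)) (S.coproj l r n a) (by simp) := by
  let M : SpanFamily x y := ⟨J, q, fun j => j, m⟩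
  let N : SpanFamily y z := ⟨A, l, r, n⟩
  -- Now the right leg of `M` is an identity and the points of the pullback are (l a, a).
  let κ : ∀ a, Cell (m (l a) ⊙ n a) (S.pro (M.comp N)) :=
    fun a => S.ιCell (M.comp N) ⟨(l a, a), rfl⟩
  have hκ : S.IsCoproduct (fun a => q (l a)) r (fun a => m (l a) ⊙ n a) (S.pro (M.comp N)) κ :=
    { left_cell a := S.left_ιCell (M.comp N) ⟨(l a, a), rfl⟩
      right_cell a := S.right_ιCell (M.comp N) ⟨(l a, a), rfl⟩
      exists_desc {t t' k} g h c hl hr := by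
        let γ : ∀ b : (M.comp N).apex, { α : Cell ((M.comp N).pro b) k //
            left α = g ((M.comp N).l b) ∧ right α = h ((M.comp N).r b) } := fun b =>
          match b with
          | ⟨(j, a), e⟩ => by
            change j = l a at e
            subst e
            exact ⟨c a, hl a, hr a⟩
        exact ⟨S.descCell (m := M.comp N) ⟨g, h, fun b => (γ b).1, fun b => (γ b).2.1,
          fun b => (γ b).2.2⟩, S.left_descCell _, S.right_descCell _,
          fun a => S.ιCell_descCell (m := M.comp N) _ ⟨(l a, a), rfl⟩⟩
      ext hl hr h := S.cell_ext _ _ hl hr fun b => by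
        obtain ⟨⟨j, a⟩, e⟩ := b
        change j = l a at e
        subst e
        exact h a }
  have e a : κ a ≫ᵥ S.compComparison M N =
      hcomp (S.coproj q (fun j => j) m (l a)) (S.coproj l r n a) (by simp) :=
    S.ι_compComparison M N ⟨(l a, a), rfl⟩
  simp only [← e]
  exact hκ.of_invertible (S.comp_invertible M N) ((S.left_descCell _).trans (S.desc_ι x))
    ((S.right_descCell _).trans (S.desc_ι z))

end

/-! ### Companions of structure arrows and commuters -/

variable (f : I → J)

/-- Through the unit comparison, the identity on a coproduct is itself the coproduct of the
identities, with `unitCell` of the coprojections as its coprojections. This allows cells out of it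
to be built and compared componentwise. -/
theorem unitCell_ι_unit_inv {x : I → D} (i : I) : unitCell (S.ι x i) ≫ᵥ (S.unit_invertible x).inv =
    S.parallelCoproj (fun i => unit (x i)) i := by
  have e : S.parallelCoproj (fun i => unit (x i)) i ≫ᵥ S.unitComparison x = unitCell (S.ι x i) :=
    S.ι_unitComparison x i
  rw [← e, vcomp_assoc, (S.unit_invertible x).hom_inv, vcomp_cid]

theorem left_unit_inv (x : I → D) : left (S.unit_invertible x).inv = 𝟙 _ :=
  left_eq_id_of_inv (S.unit_invertible x).hom_inv (S.left_unitComparison x)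

theorem right_unit_inv (x : I → D) : right (S.unit_invertible x).inv = 𝟙 _ :=
  right_eq_id_of_inv (S.unit_invertible x).hom_inv (S.right_unitComparison x)

/-- Cells out of an external identity of a coproduct are determined by their restrictions along
the coprojections. -/
theorem unit_ext {x : I → D} {t t' : D} {n : Pro t t'} {α β : Cell (unit (S.obj x)) n}
    (h : ∀ i, unitCell (S.ι x i) ≫ᵥ α = unitCell (S.ι x i) ≫ᵥ β) : α = β := by
  have : S.unitComparison x ≫ᵥ α = S.unitComparison x ≫ᵥ β := S.parallel_ext fun i => by
    rw [← vcomp_assoc, S.ι_unitComparison, ← vcomp_assoc, S.ι_unitComparison, h]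
  have := congrArg ((S.unit_invertible x).inv ≫ᵥ ·) this
  simpa only [← vcomp_assoc, IsInvertible.inv_hom, cid_vcomp] using this

/-- The family of external identities whose coproduct is the companion of a structure arrow. -/
@[reducible]
def companionFamily (x : J → D) : SpanFamily (fun i => x (f i)) x :=
  SpanFamily.mk I (fun i => i) f fun i => unit (x (f i))

/-- The companion of a structure arrow, as a proarrow. -/
def companionPro (x : J → D) : Pro (S.obj fun i => x (f i)) (S.obj x) :=
  S.pro (companionFamily f x)

/-- The coprojections of the companion of a structure arrow. -/
def companionCoproj (x : J → D) (i : I) : Cell (unit (x (f i))) (S.companionPro f x) :=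
  S.ιCell (companionFamily f x) i

@[simp] theorem left_companionCoproj (x : J → D) (i : I) :
    left (S.companionCoproj f x i) = S.ι (fun i => x (f i)) i :=
  S.left_ιCell (companionFamily f x) i

@[simp] theorem right_companionCoproj (x : J → D) (i : I) :
    right (S.companionCoproj f x i) = S.ι x (f i) :=
  S.right_ιCell (companionFamily f x) i

/-- The unit of the companion of a structure arrow. -/
noncomputable def companionη (x : J → D) :
    Cell (unit (S.obj fun i => x (f i))) (S.companionPro f x) :=
  -- The universal property only describes cells out of Σ id, so the identity on the coproduct is
  -- first replaced by Σ id. Inverting the unit comparison is indispensable here.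
  (S.unit_invertible fun i => x (f i)).inv ≫ᵥ
    S.descCell (m := SpanFamily.unit fun i => x (f i))
      { fst := S.ι fun i => x (f i)
        snd i := S.ι x (f i)
        cell i := S.companionCoproj f x i
        left_cell i := S.left_companionCoproj f x i
        right_cell i := S.right_companionCoproj f x i }

/-- The counit of the companion of a structure arrow. -/
def companionε (x : J → D) : Cell (S.companionPro f x) (unit (S.obj x)) :=
  S.descCell
    { fst i := S.ι x (f i)
      snd := S.ι x
      cell i := unitCell (S.ι x (f i))
      left_cell _ := left_unitCell _
      right_cell _ := right_unitCell _ }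

theorem unitCell_ι_companionη (x : J → D) (i : I) :
    unitCell (S.ι (fun i => x (f i)) i) ≫ᵥ S.companionη f x = S.companionCoproj f x i := by
  rw [companionη, vcomp_eq_assoc (S.unitCell_ι_unit_inv i)]
  exact S.ιCell_descCell (m := SpanFamily.unit fun i => x (f i)) _ i

theorem companionCoproj_companionε (x : J → D) (i : I) :
    S.companionCoproj f x i ≫ᵥ S.companionε f x = unitCell (S.ι x (f i)) :=
  S.ιCell_descCell (m := (companionFamily f x)) _ i

theorem left_companionη (x : J → D) : left (S.companionη f x) = 𝟙 _ := by
  rw [companionη, left_vcomp, S.left_unit_inv, Category.id_comp]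
  exact (S.left_descCell _).trans (S.desc_ι _)

theorem right_companionη (x : J → D) : right (S.companionη f x) = S.structArrow f x := by
  rw [companionη, right_vcomp, S.right_unit_inv, Category.id_comp]
  exact S.right_descCell _

theorem left_companionε (x : J → D) : left (S.companionε f x) = S.structArrow f x :=
  S.left_descCell _

theorem right_companionε (x : J → D) : right (S.companionε f x) = 𝟙 _ :=
  (S.right_descCell _).trans (S.desc_ι _)

/-- Cells out of the companion of a structure arrow are determined by their boundaries and their
restrictions along the coprojections. -/
theorem companionPro_ext {x : J → D} {t t' : D} {n : Pro t t'} {α β : Cell (S.companionPro f x) n}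
    (hl : left α = left β) (hr : right α = right β)
    (h : ∀ i, S.companionCoproj f x i ≫ᵥ α = S.companionCoproj f x i ≫ᵥ β) : α = β :=
  S.cell_ext _ _ hl hr h

/-- The companion of a structure arrow. -/
noncomputable def structCompanion (x : J → D) : Companion (S.structArrow f x) where
  pro := S.companionPro f x
  η := S.companionη f x
  ε := S.companionε f x
  left_η := S.left_companionη f x
  right_η := S.right_companionη f x
  left_ε := S.left_companionε f x
  right_ε := S.right_companionε f x
  hcomp_eq := by
    -- On the i-th coprojection, η restricts to that coprojection and ε to an identity cell.
    -- Naturality pushes the unitors onto an identity proarrow, where they cancel.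
    refine S.companionPro_ext f (by simp [left_companionη]) (by simp [right_companionε])
      fun i => ?_
    have h₁ := lunitInv_natural (S.companionCoproj f x i) (S.left_companionCoproj f x i)
    have h₂ := runitHom_natural (S.companionCoproj f x i) (S.right_companionCoproj f x i)
    rw [vcomp_eq_vcomp_assoc h₁, hcomp_vcomp_hcomp_assoc,
      hcomp_congr (S.unitCell_ι_companionη f x i) (S.companionCoproj_companionε f x i), ← h₂,
      lunitInv_unit, runitInv_hom_assoc, vcomp_cid]
  vcomp_eq := S.unit_ext fun i => by
    rw [vcomp_eq_assoc (S.unitCell_ι_companionη f x i), S.companionCoproj_companionε,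
      ← unitCell_comp, S.ι_structArrow]

/-- Both sides of the slid cell are coproducts of the family m (f i) over the span I = I → J: the
left one from m (f i) ⊙ id, the right one from id ⊙ m (f i). The comparison between them is
therefore invertible, and it remains to recognise it as the slid structure cell. -/
theorem isCommuter_structCell {x y : J → D} (m : ∀ j, Pro (x j) (y j)) :
    IsCommuter (S.structCell f m) := by
  have h₁ : S.IsCoproduct (x := fun i => x (f i)) (y := y) (fun i => i) f (fun i => m (f i))
      (S.pro (SpanFamily.parallel fun i => m (f i)) ⊙ S.companionPro f y)
      fun i => runitInv (m (f i)) ≫ᵥ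
        hcomp (S.parallelCoproj (fun i => m (f i)) i) (S.companionCoproj f y i) (by simp) :=
    IsCoproduct.precomp
      (S.isCoproduct_pcomp_right (x := fun i => x (f i)) (fun i => i) (fun i => i)
        (fun i => m (f i)) f
        (fun i => unit (y (f i))))
      (fun i => runitInv (m (f i))) (fun i => ⟨_, runitInv_hom _, runitHom_inv _⟩)
      (fun _ => left_runitInv _) (fun _ => right_runitInv _)
  have h₂ : S.IsCoproduct (x := fun i => x (f i)) (y := y) (fun i => i) f (fun i => m (f i))
      (S.companionPro f x ⊙ S.pro (SpanFamily.parallel m))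
      fun i => lunitInv (m (f i)) ≫ᵥ
        hcomp (S.companionCoproj f x i) (S.parallelCoproj m (f i)) (by simp) :=
    IsCoproduct.precomp
      (S.isCoproduct_pcomp_right (x := fun i => x (f i)) (fun i => i) f (fun i => unit (x (f i)))
        (fun j => j) m)
      (fun i => lunitInv (m (f i))) (fun i => ⟨_, lunitInv_hom _, lunitHom_inv _⟩)
      (fun _ => left_lunitInv _) (fun _ => right_lunitInv _)
  obtain ⟨Φ, hΦ, -, hr, hκ⟩ := h₁.exists_invertible h₂
  refine IsReshape.isCommuter (F := S.structCompanion f x) (G := S.structCompanion f y) (Φ := Φ)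
    ⟨S.left_structCell f m, S.right_structCell f m, hr, ?_⟩ hΦ
  -- Moving the right unitor across leaves two cells out of the parallel coproduct of m (f i), which
  -- can be compared on coprojections. There the claim is the defining property `hκ` of `Φ`.
  have key : runitInv (S.pro (SpanFamily.parallel fun i => m (f i))) ≫ᵥ
      hcomp (cid _) (S.companionη f y) (by simp [left_companionη]) ≫ᵥ Φ =
      lunitInv _ ≫ᵥ hcomp (S.companionη f x) (S.structCell f m) (by simp [right_companionη]) := by
    refine S.parallel_ext fun i => ?_
    change S.parallelCoproj (fun i => m (f i)) i ≫ᵥ _ = S.parallelCoproj (fun i => m (f i)) i ≫ᵥ _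
    rw [vcomp_eq_vcomp_assoc (runitInv_natural (S.parallelCoproj (fun i => m (f i)) i)
        (S.right_parallelCoproj _ i)), hcomp_vcomp_hcomp_assoc,
      vcomp_eq_vcomp_assoc (lunitInv_natural (S.parallelCoproj (fun i => m (f i)) i)
        (S.left_parallelCoproj _ i)), hcomp_vcomp_hcomp,
      hcomp_congr (vcomp_cid _) (S.unitCell_ι_companionη f y i),
      hcomp_congr (S.unitCell_ι_companionη f x i) (S.parallelCoproj_structCell f m i)]
    exact (vcomp_assoc _ _ _).symm.trans (hκ i)
  have := congrArg (runitHom _ ≫ᵥ ·) key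
  simp only [runitHom_inv_assoc] at this
  exact this

/-! ### Conjoints of structure arrows and cocommuters -/

/-- The family of external identities whose coproduct is the conjoint of a structure arrow. -/
@[reducible]
def conjointFamily (x : J → D) : SpanFamily x (fun i => x (f i)) :=
  SpanFamily.mk I f (fun i => i) fun i => unit (x (f i))

/-- The conjoint of a structure arrow, as a proarrow. -/
def conjointPro (x : J → D) : Pro (S.obj x) (S.obj fun i => x (f i)) :=
  S.pro (conjointFamily f x)

/-- The coprojections of the conjoint of a structure arrow. -/
def conjointCoproj (x : J → D) (i : I) : Cell (unit (x (f i))) (S.conjointPro f x) :=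
  S.ιCell (conjointFamily f x) i

@[simp] theorem left_conjointCoproj (x : J → D) (i : I) :
    left (S.conjointCoproj f x i) = S.ι x (f i) :=
  S.left_ιCell (conjointFamily f x) i

@[simp] theorem right_conjointCoproj (x : J → D) (i : I) :
    right (S.conjointCoproj f x i) = S.ι (fun i => x (f i)) i :=
  S.right_ιCell (conjointFamily f x) i

/-- The unit of the conjoint of a structure arrow. -/
noncomputable def conjointη (x : J → D) :
    Cell (unit (S.obj fun i => x (f i))) (S.conjointPro f x) :=
  (S.unit_invertible fun i => x (f i)).inv ≫ᵥ
    S.descCell (m := SpanFamily.unit fun i => x (f i))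
      { fst i := S.ι x (f i)
        snd := S.ι fun i => x (f i)
        cell i := S.conjointCoproj f x i
        left_cell i := S.left_conjointCoproj f x i
        right_cell i := S.right_conjointCoproj f x i }

/-- The counit of the conjoint of a structure arrow. -/
def conjointε (x : J → D) : Cell (S.conjointPro f x) (unit (S.obj x)) :=
  S.descCell
    { fst := S.ι x
      snd i := S.ι x (f i)
      cell i := unitCell (S.ι x (f i))
      left_cell _ := left_unitCell _
      right_cell _ := right_unitCell _ }

theorem unitCell_ι_conjointη (x : J → D) (i : I) :
    unitCell (S.ι (fun i => x (f i)) i) ≫ᵥ S.conjointη f x = S.conjointCoproj f x i := by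
  rw [conjointη, vcomp_eq_assoc (S.unitCell_ι_unit_inv i)]
  exact S.ιCell_descCell (m := SpanFamily.unit fun i => x (f i)) _ i

theorem conjointCoproj_conjointε (x : J → D) (i : I) :
    S.conjointCoproj f x i ≫ᵥ S.conjointε f x = unitCell (S.ι x (f i)) :=
  S.ιCell_descCell (m := (conjointFamily f x)) _ i

theorem left_conjointη (x : J → D) : left (S.conjointη f x) = S.structArrow f x := by
  rw [conjointη, left_vcomp, S.left_unit_inv, Category.id_comp]
  exact S.left_descCell _

theorem right_conjointη (x : J → D) : right (S.conjointη f x) = 𝟙 _ := by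
  rw [conjointη, right_vcomp, S.right_unit_inv, Category.id_comp]
  exact (S.right_descCell _).trans (S.desc_ι _)

theorem left_conjointε (x : J → D) : left (S.conjointε f x) = 𝟙 _ :=
  (S.left_descCell _).trans (S.desc_ι _)

theorem right_conjointε (x : J → D) : right (S.conjointε f x) = S.structArrow f x :=
  S.right_descCell _

/-- Cells out of the conjoint of a structure arrow are determined by their boundaries and their
restrictions along the coprojections. -/
theorem conjointPro_ext {x : J → D} {t t' : D} {n : Pro t t'} {α β : Cell (S.conjointPro f x) n}
    (hl : left α = left β) (hr : right α = right β)
    (h : ∀ i, S.conjointCoproj f x i ≫ᵥ α = S.conjointCoproj f x i ≫ᵥ β) : α = β :=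
  S.cell_ext _ _ hl hr h

/-- The conjoint of a structure arrow. -/
noncomputable def structConjoint (x : J → D) : Conjoint (S.structArrow f x) where
  pro := S.conjointPro f x
  η := S.conjointη f x
  ε := S.conjointε f x
  left_η := S.left_conjointη f x
  right_η := S.right_conjointη f x
  left_ε := S.left_conjointε f x
  right_ε := S.right_conjointε f x
  hcomp_eq := by
    refine S.conjointPro_ext f (by simp [left_conjointε]) (by simp [right_conjointη]) fun i => ?_
    have h₁ := runitInv_natural (S.conjointCoproj f x i) (S.right_conjointCoproj f x i)
    have h₂ := lunitHom_natural (S.conjointCoproj f x i) (S.left_conjointCoproj f x i)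
    rw [vcomp_eq_vcomp_assoc h₁, hcomp_vcomp_hcomp_assoc,
      hcomp_congr (S.conjointCoproj_conjointε f x i) (S.unitCell_ι_conjointη f x i), ← h₂,
      ← lunitInv_unit, lunitInv_hom_assoc, vcomp_cid]
  vcomp_eq := S.unit_ext fun i => by
    rw [vcomp_eq_assoc (S.unitCell_ι_conjointη f x i), S.conjointCoproj_conjointε, ← unitCell_comp,
      S.ι_structArrow]

/-- The commuter argument with the span reversed: both composites are coproducts of m (f i) over J ←
I = I. -/
theorem isCocommuter_structCell {x y : J → D} (m : ∀ j, Pro (x j) (y j)) :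
    IsCocommuter (S.structCell f m) := by
  have h₁ : S.IsCoproduct (x := x) (y := fun i => y (f i)) f (fun i => i) (fun i => m (f i))
      (S.conjointPro f x ⊙ S.pro (SpanFamily.parallel fun i => m (f i)))
      fun i => lunitInv (m (f i)) ≫ᵥ
        hcomp (S.conjointCoproj f x i) (S.parallelCoproj (fun i => m (f i)) i) (by simp) :=
    IsCoproduct.precomp
      (S.isCoproduct_pcomp_right (z := fun i => y (f i)) f (fun i => i) (fun i => unit (x (f i)))
        (fun i => i) (fun i => m (f i)))
      (fun i => lunitInv (m (f i))) (fun i => ⟨_, lunitInv_hom _, lunitHom_inv _⟩)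
      (fun _ => left_lunitInv _) (fun _ => right_lunitInv _)
  have h₂ : S.IsCoproduct (x := x) (y := fun i => y (f i)) f (fun i => i) (fun i => m (f i))
      (S.pro (SpanFamily.parallel m) ⊙ S.conjointPro f y)
      fun i => runitInv (m (f i)) ≫ᵥ
        hcomp (S.parallelCoproj m (f i)) (S.conjointCoproj f y i) (by simp) :=
    IsCoproduct.precomp
      -- Here the parallel family over `J` comes first, so the right leg of the first span is used
      -- as the identity leg and the pullback is reindexed by the apex of the second.
      (S.isCoproduct_pcomp_left (z := fun i => y (f i)) (fun j => j) m f (fun i => i)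
        (fun i => unit (y (f i))))
      (fun i => runitInv (m (f i))) (fun i => ⟨_, runitInv_hom _, runitHom_inv _⟩)
      (fun _ => left_runitInv _) (fun _ => right_runitInv _)
  obtain ⟨Φ, hΦ, hl, -, hκ⟩ := h₁.exists_invertible h₂
  refine IsCoreshape.isCocommuter (F := S.structConjoint f x) (G := S.structConjoint f y) (Φ := Φ)
    ⟨S.left_structCell f m, S.right_structCell f m, hl, ?_⟩ hΦ
  have key : lunitInv (S.pro (SpanFamily.parallel fun i => m (f i))) ≫ᵥ
      hcomp (S.conjointη f x) (cid _) (by simp [right_conjointη]) ≫ᵥ Φ =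
      runitInv _ ≫ᵥ hcomp (S.structCell f m) (S.conjointη f y) (by simp [left_conjointη]) := by
    refine S.parallel_ext fun i => ?_
    change S.parallelCoproj (fun i => m (f i)) i ≫ᵥ _ = S.parallelCoproj (fun i => m (f i)) i ≫ᵥ _
    rw [vcomp_eq_vcomp_assoc (lunitInv_natural (S.parallelCoproj (fun i => m (f i)) i)
        (S.left_parallelCoproj _ i)), hcomp_vcomp_hcomp_assoc,
      vcomp_eq_vcomp_assoc (runitInv_natural (S.parallelCoproj (fun i => m (f i)) i)
        (S.right_parallelCoproj _ i)), hcomp_vcomp_hcomp,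
      hcomp_congr (S.unitCell_ι_conjointη f x i) (vcomp_cid _),
      hcomp_congr (S.parallelCoproj_structCell f m i) (S.unitCell_ι_conjointη f y i)]
    exact (vcomp_assoc _ _ _).symm.trans (hκ i)
  have := congrArg (lunitHom _ ≫ᵥ ·) key
  simp only [lunitHom_inv_assoc] at this
  exact this

end StrongCoproducts

end SigmaCompanions

theorem mainTheorem11 {D : Type u} [DoubleCategory.{u, v, p, c} D] (s : IndexSize)
    (S : StrongCoproducts.{w} s D) {I J : Type w} [s.Admits I] [s.Admits J] (f : I → J) :
    Nonempty (Companion (D := LaxDoubleFunctor (J → D) D) (S.sigmaTrans f)) ∧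
      Nonempty (Conjoint (D := LaxDoubleFunctor (J → D) D) (S.sigmaTrans f)) ∧
      ∀ {x y : J → D} (m : Pro x y),
        IsCommuter (DoubleNatTrans.cell (S.sigmaTrans f) m) ∧
          IsCocommuter (DoubleNatTrans.cell (S.sigmaTrans f) m) :=
  -- The components of `S.sigmaTrans f` are the structure arrows and structure cells by definition,
  -- so the pointwise results apply without conversion.
  ⟨nonempty_companion_of_isCommuter _ (fun x => ⟨S.structCompanion f x⟩)
      fun m => S.isCommuter_structCell f m,
    nonempty_conjoint_of_isCocommuter _ (fun x => ⟨S.structConjoint f x⟩)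
      fun m => S.isCocommuter_structCell f m,
    fun m => ⟨S.isCommuter_structCell f m, S.isCocommuter_structCell f m⟩⟩
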